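/- Let $k$ be a commutative ring. Dg algebras are unital associative $\mathbb Z$-graded $k$-algebras with a differential $d$ of degree $+1$ satisfying $d(ab)=(da)b+(-1)^{|a|}a\,db$; morphisms are unital algebra maps of degree $0$ commuting with $d$. A set of generating morphisms of a dg algebra $A$ is a family of homogeneous elements $(x_i)$, indexed by an ordinal (well-ordered set), which freely generates $A$ as an algebra and such that each $dx_i$ lies in the subalgebra generated by $\{x_j : j<i\}$; $A$ is semifree if it has such a family. A morphism $F\colon A\to B$ is a semifree extension if $B$ is, as an algebra, the free extension of $F(A)\cong A$ by homogeneous elements $(s_i)$ indexed by an ordinal, with each $ds_i$ in the subalgebra generated by $F(A)$ and $\{s_j : j<i\}$. A morphism is a quasi-equivalence if it induces an isomorphism on $H^*$. Let $\mathrm{dgAlg}_s$ be the full subcategory of dg algebras consisting of the semifree ones. Fix a set of generating morphisms for every semifree dg algebra. For $A$ semifree with generators $x$, let $\mathrm{Cyl}(A)$ be the semifree dg algebra on generators $x^1,x^2$ of degree $|x|$ and $t_x$ of degree $|x|-1$, with $dx^r=i_r(dx)$ and $dt_x=(-1)^{|x|}(x^2-x^1)+t_{dx}$, where $i_r\colon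 A\to \mathrm{Cyl}(A)$ is the algebra map $x\mapsto x^r$ and $\theta\mapsto t_\theta$ is the $k$-linear map with $t_1=0$ and $$t_{x_n\cdots x_1}=\sum_{j=1}^n(-1)^{|x_{j-1}|+\dots+|x_1|}\,x_n^2\cdots x_{j+1}^2\,t_{x_j}\,x_{j-1}^1\cdots x_1^1$$ for generators $x_1,\dots,x_n$. For $F\colon A\to B$ let $\mathrm{Cyl}(F)(x^r)=i_r(F(x))$ and $\mathrm{Cyl}(F)(t_x)=t_{F(x)}$. This is a functor $\mathrm{Cyl}\colon \mathrm{dgAlg}_s\to\mathrm{dgAlg}_s$ with natural transformations $i_1,i_2\colon \mathrm{id}\Rightarrow\mathrm{Cyl}$ and $p\colon\mathrm{Cyl}\Rightarrow\mathrm{id}$, $p(x^1)=p(x^2)=x$, $p(t_x)=0$. **Theorem.** For every such choice of generating morphisms: 1. $\mathrm{dgAlg}_s$, with semifree extensions as cofibrations and $I=\mathrm{Cyl}$ (with $i_1,i_2,p$), is an $I$-category in the sense of Baues. That is, there is an initial object $\emptyset$, and: (cylinder) $p\circ i_r=\mathrm{id}$; (pushout) pushouts along cofibrations exist, cofibrations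 are stable under pushout, $I(\emptyset)=\emptyset$, and $I$ preserves pushouts along cofibrations; (cofibration) isomorphisms and all maps $\emptyset\to A$ are cofibrations, cofibrations are closed under composition, and every cofibration $F\colon A\to B$ has the homotopy extension property: for $r\in\{1,2\}$, $G\colon B\to C$ and $H\colon I(A)\to C$ with $GF=Hi_r$ there is $E\colon I(B)\to C$ with $Ei_r=G$ and $E\,I(F)=H$; (relative cylinder) for every cofibration $F\colon A\to B$ the induced map $B\cup_A I(A)\cup_A B\to I(B)$ is a cofibration; (interchange) for every $A$ there is $T\colon I(I(A))\to I(I(A))$ with $T\circ i_r=I(i_r)$ and $T\circ I(i_r)=i_r$ for $r\in\{1,2\}$. 2. $\mathrm{dgAlg}_s$, with semifree extensions as cofibrations and quasi-equivalences as weak equivalences, is a cofibration category in the sense of Baues. That is: (composition) isomorphisms are both weak equivalences and cofibrations, weak equivalences have the two-out-of-three property, and cofibrations are closed under composition; (pushout) pushouts along cofibrations exist, cofibrations and trivial cofibrations (cofibrations that are weak equivalences) are stable under pushout, and weak equivalences are stable under pushout along cofibrations; (factorization) every morphism factors as a cofibration followed by a weak equivalence; (fibrant models) every object admits a trivial cofibration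 to a fibrant object. Moreover, every object is fibrant (every trivial cofibration out of it has a retraction) and cofibrant (the map from $\emptyset$ to it is a cofibration). In particular, $\mathrm{dgAlg}_s$ is a category of cofibrant objects (the dual of Brown's categories of fibrant objects: it has finite coproducts; isomorphisms are weak equivalences and cofibrations; weak equivalences satisfy two-out-of-three; cofibrations are closed under composition; pushouts along cofibrations exist and preserve cofibrations and trivial cofibrations; every codiagonal $X\sqcup X\to X$ factors as a cofibration followed by a weak equivalence; every object is cofibrant). -/

import Mathlib

open CategoryTheory CategoryTheory.Limits

universe u

namespace SemifreeDGA

noncomputable section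

/-! ### Differential graded algebras -/

/-- The Koszul sign `(-1)^n`, as an element of `k`. -/
def sgn (k : Type u) [CommRing k] (n : ℤ) : k := ((n.negOnePow : ℤˣ) : ℤ)

section sgn

variable {k : Type u} [CommRing k]

@[simp] lemma sgn_zero : sgn k 0 = 1 := by simp [sgn]

lemma sgn_add (m n : ℤ) : sgn k (m + n) = sgn k m * sgn k n := by
  simp [sgn, Int.negOnePow_add]

lemma sgn_succ (n : ℤ) : sgn k (n + 1) = - sgn k n := by
  simp [sgn, Int.negOnePow_succ]

lemma sgn_pred (n : ℤ) : sgn k (n - 1) = - sgn k n := by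
  have := sgn_succ (k := k) (n - 1)
  rw [sub_add_cancel] at this
  rw [this, neg_neg]

@[simp] lemma sgn_mul_self (n : ℤ) : sgn k n * sgn k n = 1 := by
  rw [sgn, ← Int.cast_mul, ← Units.val_mul, Int.units_mul_self]
  simp

end sgn

/-- A (unital, associative, `ℤ`-graded, cohomological) differential graded algebra over `k`. -/
structure DGAlg (k : Type u) [CommRing k] where
  /-- the underlying algebra -/
  carrier : Type u
  [ring : Ring carrier]
  [algebra : Algebra k carrier]
  /-- the homogeneous components -/
  gr : ℤ → Submodule k carrier
  [graded : GradedAlgebra gr]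
  /-- the differential -/
  d : carrier →ₗ[k] carrier
  d_mem : ∀ {n : ℤ} {a : carrier}, a ∈ gr n → d a ∈ gr (n + 1)
  d_d : ∀ a : carrier, d (d a) = 0
  leibniz : ∀ {n : ℤ} {a : carrier}, a ∈ gr n → ∀ b : carrier,
    d (a * b) = d a * b + sgn k n • (a * d b)

attribute [instance] DGAlg.ring DGAlg.algebra DGAlg.graded

variable {k : Type u} [CommRing k]

/-- Morphisms of dg algebras: unital algebra maps of degree zero commuting with the differentials. -/
@[ext] structure DGAlg.Hom (A B : DGAlg k) where
  /-- the underlying map of algebras -/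
  toAlgHom : A.carrier →ₐ[k] B.carrier
  map_mem : ∀ {n : ℤ} {a : A.carrier}, a ∈ A.gr n → toAlgHom a ∈ B.gr n
  map_d : ∀ a : A.carrier, toAlgHom (A.d a) = B.d (toAlgHom a)

instance DGAlg.category : Category.{u} (DGAlg k) where
  Hom A B := DGAlg.Hom A B
  id A := ⟨AlgHom.id k A.carrier, fun h => h, fun _ => rfl⟩
  comp f g := ⟨g.toAlgHom.comp f.toAlgHom, fun h => g.map_mem (f.map_mem h), fun a => by
    simp [f.map_d, g.map_d]⟩

/-- The underlying algebra map of a morphism of dg algebras. -/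
def DGAlg.toAlgHom {A B : DGAlg k} (f : A ⟶ B) : A.carrier →ₐ[k] B.carrier := DGAlg.Hom.toAlgHom f

lemma DGAlg.hom_ext {A B : DGAlg k} {f g : A ⟶ B} (h : toAlgHom f = toAlgHom g) : f = g :=
  DGAlg.Hom.ext h

lemma DGAlg.toAlgHom_mem {A B : DGAlg k} (f : A ⟶ B) {n : ℤ} {a : A.carrier} (h : a ∈ A.gr n) :
    toAlgHom f a ∈ B.gr n := DGAlg.Hom.map_mem f h

lemma DGAlg.toAlgHom_d {A B : DGAlg k} (f : A ⟶ B) (a : A.carrier) :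
    toAlgHom f (A.d a) = B.d (toAlgHom f a) := DGAlg.Hom.map_d f a

@[simp] lemma DGAlg.toAlgHom_id (A : DGAlg k) : toAlgHom (𝟙 A) = AlgHom.id k A.carrier := rfl

@[simp] lemma DGAlg.toAlgHom_comp {A B C : DGAlg k} (f : A ⟶ B) (g : B ⟶ C) :
    toAlgHom (f ≫ g) = (toAlgHom g).comp (toAlgHom f) := rfl

/-! ### Cohomology and quasi-equivalences -/

/-- The total cohomology `H^*(A) = ker d / im d`. -/
abbrev DGAlg.Cohomology (A : DGAlg k) : Type u :=
  LinearMap.ker A.d ⧸ (LinearMap.range A.d).submoduleOf (LinearMap.ker A.d)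

/-- The map induced by a morphism of dg algebras on cocycles. -/
def DGAlg.cocyclesMap {A B : DGAlg k} (f : A ⟶ B) : LinearMap.ker A.d →ₗ[k] LinearMap.ker B.d :=
  (toAlgHom f).toLinearMap.restrict fun a ha => by
    rw [LinearMap.mem_ker] at ha ⊢
    rw [AlgHom.toLinearMap_apply, ← toAlgHom_d, ha, map_zero]

/-- The map `H^*(f)` induced by a morphism of dg algebras on cohomology. -/
def DGAlg.cohomologyMap {A B : DGAlg k} (f : A ⟶ B) : A.Cohomology →ₗ[k] B.Cohomology :=
  Submodule.mapQ _ _ (cocyclesMap f) (by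
    rintro ⟨a, ha⟩ ⟨b, hb⟩
    exact ⟨toAlgHom f b, by rw [← toAlgHom_d, hb]; rfl⟩)

/-- A morphism of dg algebras, viewed as a dg functor between dg categories with one object, is a
quasi-equivalence when it induces a bijection on cohomology (essential surjectivity of the functor
on `H^0` is automatic, as there is only one object). -/
def DGAlg.IsQuasiEquivalence {A B : DGAlg k} (f : A ⟶ B) : Prop :=
  Function.Bijective (cohomologyMap f)

/-! ### Semifree dg algebras and semifree extensions -/

/-- A set of generating morphisms of a dg algebra `A`: a family of homogeneous elements, indexed by
a well-ordered set, that freely generates the algebra `A`, and such that the differential of each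
generator lies in the subalgebra generated by the smaller ones. -/
structure Generators (A : DGAlg k) where
  /-- the index set -/
  X : Type u
  /-- the well-order -/
  lt : X → X → Prop
  wo : IsWellOrder X lt
  /-- the degrees of the generators -/
  deg : X → ℤ
  /-- the generators -/
  gen : X → A.carrier
  gen_mem : ∀ x, gen x ∈ A.gr (deg x)
  bijective : Function.Bijective (FreeAlgebra.lift k gen)
  d_gen : ∀ x, A.d (gen x) ∈ Algebra.adjoin k (gen '' {y | lt y x})

attribute [instance] Generators.wo

/-- A dg algebra is semifree if it has a set of generating morphisms. -/
def IsSemifree : ObjectProperty (DGAlg k) := fun A => Nonempty (Generators A)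

variable (k) in
/-- The category of semifree dg algebras, as a full subcategory of that of dg algebras. -/
abbrev SemifreeDGAlg : Type (u + 1) := (IsSemifree (k := k)).FullSubcategory

/-- `F : A ⟶ B` is a semifree extension: there is a family of homogeneous elements `s x` of `B`,
indexed by a well-ordered set, such that the algebra `B` is the free extension of `A` by the `s x`
(that is, the free product of `A`, via `F`, and the free algebra on the `s x`, expressed by its
universal property; this forces `F` to be injective), and the differential of each `s x` lies in
the subalgebra generated by the image of `A` and by the `s y` with `y < x`. -/
def IsSemifreeExtension {A B : DGAlg k} (F : A ⟶ B) : Prop :=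
  ∃ (X : Type u) (lt : X → X → Prop) (deg : X → ℤ) (s : X → B.carrier),
    IsWellOrder X lt ∧
    (∀ x, s x ∈ B.gr (deg x)) ∧
    (∀ (C : Type u) [Ring C] [Algebra k C] (f : A.carrier →ₐ[k] C) (c : X → C),
      ∃! φ : B.carrier →ₐ[k] C, φ.comp (DGAlg.toAlgHom F) = f ∧ ∀ x, φ (s x) = c x) ∧
    ∀ x, B.d (s x) ∈ Algebra.adjoin k (Set.range (DGAlg.toAlgHom F) ∪ s '' {y | lt y x})

variable (k) in
/-- The class of semifree extensions between semifree dg algebras. -/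
def semifreeExtensions : MorphismProperty (SemifreeDGAlg k) :=
  fun _ _ F => IsSemifreeExtension F.hom

variable (k) in
/-- The class of quasi-equivalences between semifree dg algebras. -/
def quasiEquivalences : MorphismProperty (SemifreeDGAlg k) :=
  fun _ _ F => DGAlg.IsQuasiEquivalence F.hom

/-! ### Free graded algebras and twisted derivations on them -/

section Free

variable {Y : Type u}

/-- The degree `n` part of the free algebra on generators `y` of degree `deg y`: the span of the
words of total degree `n`. -/
def freeGr (deg : Y → ℤ) (n : ℤ) : Submodule k (FreeAlgebra k Y) :=
  Submodule.span k {w | ∃ l : List Y, (l.map (FreeAlgebra.ι k)).prod = w ∧ (l.map deg).sum = n}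

lemma ι_mem_freeGr (deg : Y → ℤ) (y : Y) : FreeAlgebra.ι k y ∈ freeGr (k := k) deg (deg y) :=
  Submodule.subset_span ⟨[y], by simp, by simp⟩

instance freeGr_gradedMonoid (deg : Y → ℤ) : SetLike.GradedMonoid (freeGr (k := k) deg) where
  one_mem := Submodule.subset_span ⟨[], by simp, by simp⟩
  mul_mem := by
    intro i j a b ha hb
    refine Submodule.span_induction₂ (p := fun a b _ _ => a * b ∈ freeGr (k := k) deg (i + j))
      ?_ ?_ ?_ ?_ ?_ ?_ ?_ ha hb
    · rintro _ _ ⟨l, rfl, hl⟩ ⟨l', rfl, hl'⟩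
      exact Submodule.subset_span ⟨l ++ l', by simp, by simp [hl, hl']⟩
    · intros; simp
    · intros; simp
    · intro x y z _ _ _ h h'
      rw [add_mul]; exact Submodule.add_mem _ h h'
    · intro x y z _ _ _ h h'
      rw [mul_add]; exact Submodule.add_mem _ h h'
    · intro r x y _ _ h
      rw [smul_mul_assoc]; exact Submodule.smul_mem _ _ h
    · intro r x y _ _ h
      rw [mul_smul_comm]; exact Submodule.smul_mem _ _ h

/-- Induction principle for homogeneous elements of a free algebra. -/
lemma freeGr_induction {deg : Y → ℤ} {motive : ℤ → FreeAlgebra k Y → Prop}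
    (zero : ∀ n, motive n 0) (add : ∀ n a b, motive n a → motive n b → motive n (a + b))
    (smul : ∀ n (r : k) a, motive n a → motive n (r • a)) (one : motive 0 1)
    (mul : ∀ y n a, a ∈ freeGr deg n → motive n a →
      motive (deg y + n) (FreeAlgebra.ι k y * a))
    {n : ℤ} {a : FreeAlgebra k Y} (ha : a ∈ freeGr deg n) : motive n a := by
  refine Submodule.span_induction (p := fun a _ => motive n a) ?_ (zero n)
    (fun a b _ _ => add n a b) (fun r a _ => smul n r a) ha
  rintro _ ⟨l, rfl, rfl⟩
  clear ha
  induction l with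
  | nil => simpa using one
  | cons y l ih =>
    simp only [List.map_cons, List.prod_cons, List.sum_cons]
    exact mul y _ _ (Submodule.subset_span ⟨l, rfl, rfl⟩) ih

/-- The decomposition of the free algebra into homogeneous components. -/
def freeDecompose (deg : Y → ℤ) :
    FreeAlgebra k Y →ₐ[k] DirectSum ℤ fun n => freeGr (k := k) deg n :=
  FreeAlgebra.lift k fun y =>
    DirectSum.of (fun n => freeGr (k := k) deg n) (deg y) ⟨FreeAlgebra.ι k y, ι_mem_freeGr deg y⟩

lemma freeDecompose_of_mem (deg : Y → ℤ) {n : ℤ} {a : FreeAlgebra k Y}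
    (ha : a ∈ freeGr (k := k) deg n) :
    freeDecompose deg a = DirectSum.of (fun n => freeGr (k := k) deg n) n ⟨a, ha⟩ := by
  suffices h : ∃ h : a ∈ freeGr (k := k) deg n,
      freeDecompose deg a = DirectSum.of (fun n => freeGr (k := k) deg n) n ⟨a, h⟩ from h.2
  refine freeGr_induction (motive := fun n a => ∃ h : a ∈ freeGr (k := k) deg n,
      freeDecompose deg a = DirectSum.of (fun n => freeGr (k := k) deg n) n ⟨a, h⟩)
      ?_ ?_ ?_ ?_ ?_ ha
  · intro n
    refine ⟨Submodule.zero_mem _, ?_⟩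
    rw [map_zero]
    exact (map_zero (DirectSum.of (fun n => freeGr (k := k) deg n) n)).symm
  · rintro n a b ⟨h, e⟩ ⟨h', e'⟩
    refine ⟨Submodule.add_mem _ h h', ?_⟩
    rw [map_add, e, e', ← map_add]
    rfl
  · rintro n r a ⟨h, e⟩
    refine ⟨Submodule.smul_mem _ r h, ?_⟩
    rw [map_smul, e]
    exact (map_smul (DirectSum.lof k ℤ (fun n => freeGr (k := k) deg n) n) r ⟨a, h⟩).symm
  · refine ⟨SetLike.GradedOne.one_mem, ?_⟩
    rw [map_one]
    rfl
  · rintro y n a - ⟨h, e⟩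
    refine ⟨SetLike.GradedMul.mul_mem (ι_mem_freeGr deg y) h, ?_⟩
    rw [map_mul, e, freeDecompose, FreeAlgebra.lift_ι_apply, DirectSum.of_mul_of]
    rfl

instance freeGr_gradedAlgebra (deg : Y → ℤ) : GradedAlgebra (freeGr (k := k) deg) :=
  GradedAlgebra.ofAlgHom _ (freeDecompose deg)
    (by
      apply FreeAlgebra.hom_ext
      funext y
      simp [freeDecompose])
    (fun n x => freeDecompose_of_mem deg x.2)

/-- Induction principle for arbitrary elements of a free algebra with graded generators. -/
lemma free_induction (deg : Y → ℤ) {motive : FreeAlgebra k Y → Prop}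
    (zero : motive 0) (add : ∀ a b, motive a → motive b → motive (a + b))
    (smul : ∀ (r : k) a, motive a → motive (r • a)) (one : motive 1)
    (mul : ∀ y a, motive a → motive (FreeAlgebra.ι k y * a)) (a : FreeAlgebra k Y) : motive a := by
  refine DirectSum.Decomposition.inductionOn (freeGr (k := k) deg) zero ?_ add a
  rintro n ⟨a, ha⟩
  exact freeGr_induction (motive := fun _ a => motive a) (fun _ => zero) (fun _ => add)
    (fun _ => smul) one (fun y _ a _ => mul y a) ha

variable {B : Type u} [Ring B] [Algebra k B]

/-- The algebra map from a free algebra to `2 × 2`-matrices sending the generator `y` to the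
upper triangular matrix with rows `(f y, h y)` and `(0, g y)`. -/
def triHom (f h g : Y → B) : FreeAlgebra k Y →ₐ[k] Matrix (Fin 2) (Fin 2) B :=
  FreeAlgebra.lift k fun y => !![f y, h y; 0, g y]

/-- The linear map `D` on the free algebra with `D y = h y` on generators and
`D (a * b) = f a * D b + D a * g b`, where `f` and `g` are extended to algebra maps. -/
def tri (f h g : Y → B) : FreeAlgebra k Y →ₗ[k] B where
  toFun a := triHom f h g a 0 1
  map_add' a b := by simp
  map_smul' r a := by simp

lemma triHom_entries (f h g : Y → B) (a : FreeAlgebra k Y) :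
    triHom f h g a 0 0 = FreeAlgebra.lift k f a ∧ triHom f h g a 1 1 = FreeAlgebra.lift k g a ∧
      triHom f h g a 1 0 = 0 := by
  induction a using FreeAlgebra.induction with
  | grade0 r => simp [Matrix.algebraMap_matrix_apply]
  | grade1 y => simp [triHom]
  | mul a b ha hb =>
    obtain ⟨h1, h2, h3⟩ := ha
    obtain ⟨h1', h2', h3'⟩ := hb
    simp [Matrix.mul_apply, h1, h2, h3, h1', h2', h3']
  | add a b ha hb =>
    obtain ⟨h1, h2, h3⟩ := ha
    obtain ⟨h1', h2', h3'⟩ := hb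
    simp [h1, h2, h3, h1', h2', h3']

lemma tri_ι (f h g : Y → B) (y : Y) : tri f h g (FreeAlgebra.ι k y) = h y := by
  simp [tri, triHom]

lemma tri_one (f h g : Y → B) : tri f h g (1 : FreeAlgebra k Y) = 0 := by
  simp [tri]

lemma tri_mul (f h g : Y → B) (a b : FreeAlgebra k Y) :
    tri f h g (a * b) =
      FreeAlgebra.lift k f a * tri f h g b + tri f h g a * FreeAlgebra.lift k g b := by
  simp [tri, Matrix.mul_apply, (triHom_entries f h g a).1, (triHom_entries f h g b).2.1]

/-- Twisting the generators by Koszul signs multiplies an algebra map by the Koszul sign on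
homogeneous elements. -/
lemma lift_sgn (deg : Y → ℤ) (f : Y → B) {n : ℤ} {a : FreeAlgebra k Y} (ha : a ∈ freeGr deg n) :
    FreeAlgebra.lift k (fun y => sgn k (deg y) • f y) a = sgn k n • FreeAlgebra.lift k f a := by
  refine freeGr_induction (motive := fun n a =>
    FreeAlgebra.lift k (fun y => sgn k (deg y) • f y) a = sgn k n • FreeAlgebra.lift k f a)
    ?_ ?_ ?_ ?_ ?_ ha
  · simp
  · intro n a b h h'
    rw [map_add, map_add, h, h', smul_add]
  · intro n r a h
    rw [map_smul, map_smul, h, smul_comm]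
  · simp
  · intro y n a _ h
    rw [map_mul, map_mul, h, FreeAlgebra.lift_ι_apply, FreeAlgebra.lift_ι_apply, sgn_add,
      smul_mul_smul_comm]

/-- The degree one derivation of the free algebra with prescribed values on the generators. -/
def freeD (deg : Y → ℤ) (δ : Y → FreeAlgebra k Y) : FreeAlgebra k Y →ₗ[k] FreeAlgebra k Y :=
  tri (fun y => sgn k (deg y) • FreeAlgebra.ι k y) δ (FreeAlgebra.ι k)

lemma lift_ι_self (a : FreeAlgebra k Y) : FreeAlgebra.lift k (FreeAlgebra.ι k) a = a := by
  have : FreeAlgebra.lift k (FreeAlgebra.ι k) = AlgHom.id k (FreeAlgebra k Y) :=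
    FreeAlgebra.hom_ext (by funext y; simp)
  rw [this]; rfl

lemma freeD_mul (deg : Y → ℤ) (δ : Y → FreeAlgebra k Y) {n : ℤ} {a : FreeAlgebra k Y}
    (ha : a ∈ freeGr deg n) (b : FreeAlgebra k Y) :
    freeD deg δ (a * b) = freeD deg δ a * b + sgn k n • (a * freeD deg δ b) := by
  rw [freeD, tri_mul, lift_sgn deg _ ha, lift_ι_self, lift_ι_self, add_comm, smul_mul_assoc]

lemma freeD_ι (deg : Y → ℤ) (δ : Y → FreeAlgebra k Y) (y : Y) :
    freeD deg δ (FreeAlgebra.ι k y) = δ y := tri_ι _ _ _ _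

lemma freeD_mem (deg : Y → ℤ) (δ : Y → FreeAlgebra k Y)
    (hδ : ∀ y, δ y ∈ freeGr (k := k) deg (deg y + 1)) {n : ℤ} {a : FreeAlgebra k Y}
    (ha : a ∈ freeGr deg n) : freeD deg δ a ∈ freeGr (k := k) deg (n + 1) := by
  refine freeGr_induction (motive := fun n a => freeD deg δ a ∈ freeGr (k := k) deg (n + 1))
    ?_ ?_ ?_ ?_ ?_ ha
  · intro n; rw [map_zero]; exact Submodule.zero_mem _
  · intro n a b h h'; rw [map_add]; exact Submodule.add_mem _ h h'
  · intro n r a h; rw [map_smul]; exact Submodule.smul_mem _ _ h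
  · rw [freeD, tri_one]; exact Submodule.zero_mem _
  · intro y n a ha h
    rw [freeD_mul deg δ (ι_mem_freeGr deg y), freeD_ι]
    refine Submodule.add_mem _ ?_ (Submodule.smul_mem _ _ ?_)
    · have := SetLike.GradedMul.mul_mem (hδ y) ha
      rwa [add_right_comm] at this
    · have := SetLike.GradedMul.mul_mem (ι_mem_freeGr (k := k) deg y) h
      rwa [← add_assoc] at this

lemma freeD_freeD (deg : Y → ℤ) (δ : Y → FreeAlgebra k Y)
    (hδ : ∀ y, δ y ∈ freeGr (k := k) deg (deg y + 1)) (hδδ : ∀ y, freeD deg δ (δ y) = 0)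
    (a : FreeAlgebra k Y) : freeD deg δ (freeD deg δ a) = 0 := by
  refine DirectSum.Decomposition.inductionOn (freeGr (k := k) deg) (by simp) ?_ ?_ a
  · rintro n ⟨a, ha⟩
    refine freeGr_induction (motive := fun n a => freeD deg δ (freeD deg δ a) = 0)
      ?_ ?_ ?_ ?_ ?_ ha
    · intro n; simp
    · intro n a b h h'; rw [map_add, map_add, h, h', add_zero]
    · intro n r a h; rw [map_smul, map_smul, h, smul_zero]
    · rw [freeD, tri_one, map_zero]
    · intro y n a ha h
      rw [freeD_mul deg δ (ι_mem_freeGr deg y), freeD_ι, map_add, map_smul,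
        freeD_mul deg δ (hδ y), freeD_mul deg δ (ι_mem_freeGr deg y), hδδ, h, freeD_ι, sgn_succ]
      simp
  · intro a b h h'
    rw [map_add, map_add, h, h', add_zero]

/-- The dg algebra that is free as an algebra on generators `y` of degree `deg y` and
differential `δ y`. -/
@[simps] def freeDGAlg (deg : Y → ℤ) (δ : Y → FreeAlgebra k Y)
    (hδ : ∀ y, δ y ∈ freeGr (k := k) deg (deg y + 1)) (hδδ : ∀ y, freeD deg δ (δ y) = 0) :
    DGAlg k where
  carrier := FreeAlgebra k Y
  gr := freeGr deg
  d := freeD deg δ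
  d_mem := freeD_mem deg δ hδ
  d_d := freeD_freeD deg δ hδ hδδ
  leibniz := freeD_mul deg δ

end Free

/-! ### Calculus with a set of generating morphisms -/

namespace Generators

variable {A : DGAlg k} (P : Generators A)

/-- `A` is isomorphic, as an algebra, to the free algebra on its generating morphisms. -/
def equiv : FreeAlgebra k P.X ≃ₐ[k] A.carrier :=
  AlgEquiv.ofBijective (FreeAlgebra.lift k P.gen) P.bijective

@[simp] lemma equiv_ι (x : P.X) : P.equiv (FreeAlgebra.ι k x) = P.gen x := by
  simp [equiv]

@[simp] lemma equiv_symm_gen (x : P.X) : P.equiv.symm (P.gen x) = FreeAlgebra.ι k x := by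
  rw [← P.equiv_ι, AlgEquiv.symm_apply_apply]

lemma equiv_mem {n : ℤ} {w : FreeAlgebra k P.X} (hw : w ∈ freeGr P.deg n) :
    P.equiv w ∈ A.gr n := by
  refine freeGr_induction (motive := fun n w => P.equiv w ∈ A.gr n) ?_ ?_ ?_ ?_ ?_ hw
  · intro n; rw [map_zero]; exact Submodule.zero_mem _
  · intro n a b h h'; rw [map_add]; exact Submodule.add_mem _ h h'
  · intro n r a h; rw [map_smul]; exact Submodule.smul_mem _ _ h
  · rw [map_one]; exact SetLike.GradedOne.one_mem
  · intro y n a _ h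
    rw [map_mul, equiv_ι]
    exact SetLike.GradedMul.mul_mem (P.gen_mem y) h

lemma equiv_symm_mem {n : ℤ} {a : A.carrier} (ha : a ∈ A.gr n) :
    P.equiv.symm a ∈ freeGr (k := k) P.deg n := by
  classical
  set w := P.equiv.symm a with hw
  have hwa : P.equiv w = a := by simp [hw]
  have key : ∀ m, ((DirectSum.decompose A.gr (P.equiv w) m : A.gr m) : A.carrier) =
      P.equiv ((DirectSum.decompose (freeGr (k := k) P.deg) w m :
        freeGr (k := k) P.deg m) : FreeAlgebra k P.X) := by
    intro m
    refine DirectSum.Decomposition.inductionOn (freeGr (k := k) P.deg) (by simp) ?_ ?_ w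
    · rintro j ⟨v, hv⟩
      by_cases hj : j = m
      · subst hj
        rw [DirectSum.decompose_of_mem_same _ (P.equiv_mem hv),
          DirectSum.decompose_of_mem_same _ hv]
      · rw [DirectSum.decompose_of_mem_ne _ (P.equiv_mem hv) hj,
          DirectSum.decompose_of_mem_ne _ hv hj, map_zero]
    · intro v v' h h'
      simp [DirectSum.decompose_add, h, h']
  have h1 := key n
  rw [hwa, DirectSum.decompose_of_mem_same _ ha, ← hwa] at h1
  rw [P.equiv.injective h1]
  exact SetLike.coe_mem _

/-- Induction principle for homogeneous elements of a semifree dg algebra. -/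
lemma induction {motive : ℤ → A.carrier → Prop}
    (zero : ∀ n, motive n 0) (add : ∀ n a b, motive n a → motive n b → motive n (a + b))
    (smul : ∀ n (r : k) a, motive n a → motive n (r • a)) (one : motive 0 1)
    (mul : ∀ x n a, a ∈ A.gr n → motive n a → motive (P.deg x + n) (P.gen x * a))
    {n : ℤ} {a : A.carrier} (ha : a ∈ A.gr n) : motive n a := by
  have h := freeGr_induction (motive := fun n w => motive n (P.equiv w)) (deg := P.deg)
    (by intro n; rw [map_zero]; exact zero n)
    (by intro n a b h h'; rw [map_add]; exact add n _ _ h h')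
    (by intro n r a h; rw [map_smul]; exact smul n r _ h)
    (by rw [map_one]; exact one)
    (by intro y n a ha h
        rw [map_mul, equiv_ι]
        exact mul y n _ (P.equiv_mem ha) h) (P.equiv_symm_mem ha)
  simpa using h

lemma induction' {motive : A.carrier → Prop}
    (zero : motive 0) (add : ∀ a b, motive a → motive b → motive (a + b))
    (smul : ∀ (r : k) a, motive a → motive (r • a)) (one : motive 1)
    (mul : ∀ x n a, a ∈ A.gr n → motive a → motive (P.gen x * a)) (a : A.carrier) : motive a := by
  refine DirectSum.Decomposition.inductionOn A.gr zero ?_ add a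
  rintro n ⟨a, ha⟩
  exact P.induction (motive := fun _ a => motive a) (fun _ => zero) (fun _ => add)
    (fun _ => smul) one mul ha

/-! ### The cylinder -/

/-- The set indexing the generators of the cylinder: `(x, 0)`, `(x, 1)` and `(x, 2)` are the indices
of the generators `x¹ = i₁ x`, `x² = i₂ x` and `t_x`. -/
abbrev CylX : Type u := P.X × Fin 3

/-- The generator `x¹`. -/
def g₁ (x : P.X) : FreeAlgebra k P.CylX := FreeAlgebra.ι k (x, 0)

/-- The generator `x²`. -/
def g₂ (x : P.X) : FreeAlgebra k P.CylX := FreeAlgebra.ι k (x, 1)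

/-- The generator `t_x`. -/
def gt (x : P.X) : FreeAlgebra k P.CylX := FreeAlgebra.ι k (x, 2)

/-- The degrees of the generators of the cylinder: `|x¹| = |x²| = |x|`, `|t_x| = |x| - 1`. -/
def cylDeg (y : P.CylX) : ℤ := ![P.deg y.1, P.deg y.1, P.deg y.1 - 1] y.2

/-- The inclusion `i₁` of `A` into (the underlying algebra of) its cylinder. -/
def inc₁ : A.carrier →ₐ[k] FreeAlgebra k P.CylX :=
  (FreeAlgebra.lift k P.g₁).comp P.equiv.symm.toAlgHom

/-- The inclusion `i₂` of `A` into (the underlying algebra of) its cylinder. -/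
def inc₂ : A.carrier →ₐ[k] FreeAlgebra k P.CylX :=
  (FreeAlgebra.lift k P.g₂).comp P.equiv.symm.toAlgHom

/-- The map `θ ↦ t_θ`: the linear map which vanishes on `1` and takes the product
`f_n ⋯ f_1` of generators to
`∑ j, (-1)^(|f_{j-1}| + ⋯ + |f_1|) i₂(f_n) ⋯ i₂(f_{j+1}) t_{f_j} i₁(f_{j-1}) ⋯ i₁(f_1)`;
see `tmap_gen`, `tmap_one`, `tmap_mul`, `tmap_prod`. -/
def tmap : A.carrier →ₗ[k] FreeAlgebra k P.CylX :=
  (tri P.g₂ P.gt fun x => sgn k (P.deg x) • P.g₁ x).comp P.equiv.symm.toLinearMap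

@[simp] lemma inc₁_gen (x : P.X) : P.inc₁ (P.gen x) = P.g₁ x := by simp [inc₁]
@[simp] lemma inc₂_gen (x : P.X) : P.inc₂ (P.gen x) = P.g₂ x := by simp [inc₂]
@[simp] lemma tmap_gen (x : P.X) : P.tmap (P.gen x) = P.gt x := by simp [tmap, tri_ι]
@[simp] lemma tmap_one : P.tmap 1 = 0 := by simp [tmap, tri_one]

lemma tmap_mul (a : A.carrier) {n : ℤ} {b : A.carrier} (hb : b ∈ A.gr n) :
    P.tmap (a * b) = P.inc₂ a * P.tmap b + sgn k n • (P.tmap a * P.inc₁ b) := by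
  simp [tmap, tri_mul, lift_sgn P.deg P.g₁ (P.equiv_symm_mem hb), inc₁, inc₂]

/-- The explicit formula for `t_θ` on a word `θ` in the generators. -/
lemma tmap_prod (l : List P.X) :
    P.tmap (l.map P.gen).prod = ∑ j : Fin l.length,
      sgn k ((l.drop (j + 1)).map P.deg).sum •
        (((l.take j).map P.g₂).prod * P.gt l[j] * ((l.drop (j + 1)).map P.g₁).prod) := by
  induction l with
  | nil => simp
  | cons x l ih =>
    have hl : (l.map P.gen).prod ∈ A.gr (l.map P.deg).sum := by
      clear ih
      induction l with
      | nil => simpa using SetLike.GradedOne.one_mem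
      | cons y l ih =>
        simp only [List.map_cons, List.prod_cons, List.sum_cons]
        exact SetLike.GradedMul.mul_mem (P.gen_mem y) ih
    rw [List.map_cons, List.prod_cons, tmap_mul _ _ hl, ih, add_comm]
    have h1 : P.inc₁ (l.map P.gen).prod = (l.map P.g₁).prod := by
      rw [map_list_prod, List.map_map]
      congr 1
      exact List.map_congr_left fun y _ => P.inc₁_gen y
    simp only [List.length_cons]
    rw [Fin.sum_univ_succ]
    simp [h1, Finset.mul_sum, mul_assoc]

/-- The differential on the generators of the cylinder: `d x¹ = (d x)¹`, `d x² = (d x)²` and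
`d t_x = (-1)^|x| (x² - x¹) + t_{d x}`. -/
def cylδ (y : P.CylX) : FreeAlgebra k P.CylX :=
  ![P.inc₁ (A.d (P.gen y.1)), P.inc₂ (A.d (P.gen y.1)),
    sgn k (P.deg y.1) • (P.g₂ y.1 - P.g₁ y.1) + P.tmap (A.d (P.gen y.1))] y.2

lemma g₁_mem (x : P.X) : P.g₁ x ∈ freeGr (k := k) P.cylDeg (P.deg x) :=
  ι_mem_freeGr P.cylDeg (x, 0)

lemma g₂_mem (x : P.X) : P.g₂ x ∈ freeGr (k := k) P.cylDeg (P.deg x) :=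
  ι_mem_freeGr P.cylDeg (x, 1)

lemma gt_mem (x : P.X) : P.gt x ∈ freeGr (k := k) P.cylDeg (P.deg x - 1) :=
  ι_mem_freeGr P.cylDeg (x, 2)

lemma inc₁_mem {n : ℤ} {a : A.carrier} (ha : a ∈ A.gr n) :
    P.inc₁ a ∈ freeGr (k := k) P.cylDeg n := by
  refine P.induction (motive := fun n a => P.inc₁ a ∈ freeGr (k := k) P.cylDeg n)
    ?_ ?_ ?_ ?_ ?_ ha
  · intro n; rw [map_zero]; exact Submodule.zero_mem _
  · intro n a b h h'; rw [map_add]; exact Submodule.add_mem _ h h'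
  · intro n r a h; rw [map_smul]; exact Submodule.smul_mem _ _ h
  · rw [map_one]; exact SetLike.GradedOne.one_mem
  · intro x n a _ h
    rw [map_mul, inc₁_gen]
    exact SetLike.GradedMul.mul_mem (P.g₁_mem x) h

lemma inc₂_mem {n : ℤ} {a : A.carrier} (ha : a ∈ A.gr n) :
    P.inc₂ a ∈ freeGr (k := k) P.cylDeg n := by
  refine P.induction (motive := fun n a => P.inc₂ a ∈ freeGr (k := k) P.cylDeg n)
    ?_ ?_ ?_ ?_ ?_ ha
  · intro n; rw [map_zero]; exact Submodule.zero_mem _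
  · intro n a b h h'; rw [map_add]; exact Submodule.add_mem _ h h'
  · intro n r a h; rw [map_smul]; exact Submodule.smul_mem _ _ h
  · rw [map_one]; exact SetLike.GradedOne.one_mem
  · intro x n a _ h
    rw [map_mul, inc₂_gen]
    exact SetLike.GradedMul.mul_mem (P.g₂_mem x) h

lemma tmap_mem {n : ℤ} {a : A.carrier} (ha : a ∈ A.gr n) :
    P.tmap a ∈ freeGr (k := k) P.cylDeg (n - 1) := by
  refine P.induction (motive := fun n a => P.tmap a ∈ freeGr (k := k) P.cylDeg (n - 1))
    ?_ ?_ ?_ ?_ ?_ ha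
  · intro n; rw [map_zero]; exact Submodule.zero_mem _
  · intro n a b h h'; rw [map_add]; exact Submodule.add_mem _ h h'
  · intro n r a h; rw [map_smul]; exact Submodule.smul_mem _ _ h
  · rw [tmap_one]; exact Submodule.zero_mem _
  · intro x n a ha h
    rw [tmap_mul _ _ ha, inc₂_gen, tmap_gen]
    refine Submodule.add_mem _ ?_ (Submodule.smul_mem _ _ ?_)
    · have := SetLike.GradedMul.mul_mem (P.g₂_mem x) h
      rwa [← add_sub_assoc] at this
    · have := SetLike.GradedMul.mul_mem (P.gt_mem x) (P.inc₁_mem ha)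
      rwa [sub_add_eq_add_sub] at this

lemma cylδ_mem (y : P.CylX) : P.cylδ y ∈ freeGr (k := k) P.cylDeg (P.cylDeg y + 1) := by
  obtain ⟨x, j⟩ := y
  have hd := A.d_mem (P.gen_mem x)
  fin_cases j
  · exact P.inc₁_mem hd
  · exact P.inc₂_mem hd
  · have h1 := P.tmap_mem hd
    rw [add_sub_cancel_right] at h1
    have h2 : P.cylDeg (x, 2) + 1 = P.deg x := by simp [cylDeg]
    change _ ∈ freeGr (k := k) P.cylDeg (P.cylDeg (x, 2) + 1)
    rw [h2]
    exact Submodule.add_mem _ (Submodule.smul_mem _ _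
      (Submodule.sub_mem _ (P.g₂_mem x) (P.g₁_mem x))) h1

lemma d_one (A : DGAlg k) : A.d 1 = 0 := by
  have := A.leibniz (SetLike.GradedOne.one_mem (A := A.gr)) 1
  simpa using this

lemma freeD_one {Y : Type u} (deg : Y → ℤ) (δ : Y → FreeAlgebra k Y) : freeD deg δ 1 = 0 :=
  tri_one _ _ _

lemma freeD_inc₁ (a : A.carrier) : freeD P.cylDeg P.cylδ (P.inc₁ a) = P.inc₁ (A.d a) := by
  refine P.induction' (motive := fun a => freeD P.cylDeg P.cylδ (P.inc₁ a) = P.inc₁ (A.d a))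
    (by simp) ?_ ?_ ?_ ?_ a
  · intro a b h h'; simp only [map_add, h, h']
  · intro r a h; simp only [map_smul, h]
  · rw [map_one, d_one, freeD_one, map_zero]
  · intro x n a ha h
    rw [map_mul, inc₁_gen, freeD_mul _ _ (P.g₁_mem x), A.leibniz (P.gen_mem x), h, map_add,
      map_smul, map_mul, map_mul, inc₁_gen, g₁, freeD_ι]
    rfl

lemma freeD_inc₂ (a : A.carrier) : freeD P.cylDeg P.cylδ (P.inc₂ a) = P.inc₂ (A.d a) := by
  refine P.induction' (motive := fun a => freeD P.cylDeg P.cylδ (P.inc₂ a) = P.inc₂ (A.d a))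
    (by simp) ?_ ?_ ?_ ?_ a
  · intro a b h h'; simp only [map_add, h, h']
  · intro r a h; simp only [map_smul, h]
  · rw [map_one, d_one, freeD_one, map_zero]
  · intro x n a ha h
    rw [map_mul, inc₂_gen, freeD_mul _ _ (P.g₂_mem x), A.leibniz (P.gen_mem x), h, map_add,
      map_smul, map_mul, map_mul, inc₂_gen, g₂, freeD_ι]
    rfl

/-- `d t_θ = (-1)^|θ| (i₂ θ - i₁ θ) + t_{dθ}`. -/
lemma freeD_tmap {n : ℤ} {a : A.carrier} (ha : a ∈ A.gr n) :
    freeD P.cylDeg P.cylδ (P.tmap a) =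
      sgn k n • (P.inc₂ a - P.inc₁ a) + P.tmap (A.d a) := by
  refine P.induction (motive := fun n a => freeD P.cylDeg P.cylδ (P.tmap a) =
      sgn k n • (P.inc₂ a - P.inc₁ a) + P.tmap (A.d a)) ?_ ?_ ?_ ?_ ?_ ha
  · intro n; simp
  · intro n a b h h'
    simp only [map_add, h, h', smul_add, smul_sub]
    abel
  · intro n r a h
    simp only [map_smul, h, smul_add, smul_sub, smul_comm r]
  · simp [d_one]
  · intro x n a ha h
    have hδ : freeD P.cylDeg P.cylδ (P.gt x) =
        sgn k (P.deg x) • (P.g₂ x - P.g₁ x) + P.tmap (A.d (P.gen x)) := by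
      rw [gt, freeD_ι]; rfl
    have hδ2 : freeD P.cylDeg P.cylδ (P.g₂ x) = P.inc₂ (A.d (P.gen x)) := by
      rw [g₂, freeD_ι]; rfl
    rw [P.tmap_mul _ ha, map_add, map_smul, inc₂_gen, tmap_gen,
      freeD_mul _ _ (P.g₂_mem x), freeD_mul _ _ (P.gt_mem x), hδ, hδ2, h, freeD_inc₁,
      A.leibniz (P.gen_mem x), map_add, map_smul, P.tmap_mul _ ha, P.tmap_mul _ (A.d_mem ha),
      map_mul, map_mul, inc₁_gen, inc₂_gen, tmap_gen, sgn_succ, sgn_pred, sgn_add]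
    simp only [smul_add, smul_sub, add_mul, sub_mul, mul_add, mul_sub, smul_mul_assoc,
      mul_smul_comm, neg_smul, smul_neg, smul_smul, mul_comm (sgn k n) (sgn k (P.deg x))]
    abel

lemma freeD_cylδ (y : P.CylX) : freeD P.cylDeg P.cylδ (P.cylδ y) = 0 := by
  obtain ⟨x, j⟩ := y
  fin_cases j
  · change freeD P.cylDeg P.cylδ (P.inc₁ (A.d (P.gen x))) = 0
    rw [freeD_inc₁, A.d_d, map_zero]
  · change freeD P.cylDeg P.cylδ (P.inc₂ (A.d (P.gen x))) = 0
    rw [freeD_inc₂, A.d_d, map_zero]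
  · change freeD P.cylDeg P.cylδ
      (sgn k (P.deg x) • (P.g₂ x - P.g₁ x) + P.tmap (A.d (P.gen x))) = 0
    rw [map_add, map_smul, map_sub, freeD_tmap _ (A.d_mem (P.gen_mem x)), ← inc₁_gen, ← inc₂_gen,
      freeD_inc₁, freeD_inc₂, A.d_d, sgn_succ, map_zero]
    simp

/-- The cylinder of a semifree dg algebra with respect to a set of generating morphisms: the
semifree dg algebra on generators `x¹`, `x²`, `t_x`, one of each for each generating
morphism `x`. -/
def cyl : DGAlg k := freeDGAlg P.cylDeg P.cylδ P.cylδ_mem P.freeD_cylδ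

lemma maps_mem_adjoin {S : Set P.X} {T : Subalgebra k (FreeAlgebra k P.CylX)}
    (h1 : ∀ x ∈ S, P.g₁ x ∈ T) (h2 : ∀ x ∈ S, P.g₂ x ∈ T) (h3 : ∀ x ∈ S, P.gt x ∈ T)
    {a : A.carrier} (ha : a ∈ Algebra.adjoin k (P.gen '' S)) :
    P.inc₁ a ∈ T ∧ P.inc₂ a ∈ T ∧ P.tmap a ∈ T := by
  rw [← Subalgebra.mem_toSubmodule, Algebra.adjoin_eq_span] at ha
  have key : ∀ a ∈ Submonoid.closure (P.gen '' S), (∃ n, a ∈ A.gr n) ∧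
      P.inc₁ a ∈ T ∧ P.inc₂ a ∈ T ∧ P.tmap a ∈ T := by
    intro a ha
    induction ha using Submonoid.closure_induction with
    | mem a ha =>
      obtain ⟨x, hx, rfl⟩ := ha
      exact ⟨⟨_, P.gen_mem x⟩, by simpa using h1 x hx, by simpa using h2 x hx,
        by simpa using h3 x hx⟩
    | one => exact ⟨⟨0, SetLike.GradedOne.one_mem⟩, by simp [T.one_mem], by simp [T.one_mem],
        by simp [T.zero_mem]⟩
    | mul a b _ _ ha hb =>
      obtain ⟨⟨m, hm⟩, ha1, ha2, ha3⟩ := ha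
      obtain ⟨⟨n, hn⟩, hb1, hb2, hb3⟩ := hb
      refine ⟨⟨_, SetLike.GradedMul.mul_mem hm hn⟩, ?_, ?_, ?_⟩
      · rw [map_mul]; exact T.mul_mem ha1 hb1
      · rw [map_mul]; exact T.mul_mem ha2 hb2
      · rw [P.tmap_mul _ hn]
        exact T.add_mem (T.mul_mem ha2 hb3) (T.smul_mem (T.mul_mem ha3 hb1) _)
  induction ha using Submodule.span_induction with
  | mem a ha => exact (key a ha).2
  | zero => simp [T.zero_mem]
  | add a b _ _ ha hb =>
    exact ⟨by rw [map_add]; exact T.add_mem ha.1 hb.1,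
      by rw [map_add]; exact T.add_mem ha.2.1 hb.2.1,
      by rw [map_add]; exact T.add_mem ha.2.2 hb.2.2⟩
  | smul r a _ ha =>
    exact ⟨by rw [map_smul]; exact T.smul_mem ha.1 r,
      by rw [map_smul]; exact T.smul_mem ha.2.1 r,
      by rw [map_smul]; exact T.smul_mem ha.2.2 r⟩

/-- The evident set of generating morphisms of the cylinder, ordered lexicographically. -/
def cylGenerators : Generators P.cyl where
  X := P.CylX
  lt := Prod.Lex P.lt (· < ·)
  wo := inferInstance
  deg := P.cylDeg
  gen := FreeAlgebra.ι k
  gen_mem := ι_mem_freeGr P.cylDeg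
  bijective := by
    have : (FreeAlgebra.lift k (FreeAlgebra.ι k) : FreeAlgebra k P.CylX →ₐ[k] _) =
        AlgHom.id k _ := AlgHom.ext lift_ι_self
    exact this ▸ Function.bijective_id
  d_gen := by
    rintro ⟨x, j⟩
    let T : Subalgebra k (FreeAlgebra k P.CylX) :=
      Algebra.adjoin k (FreeAlgebra.ι k '' {y | Prod.Lex P.lt (· < ·) y (x, j)})
    have hT : ∀ y, P.lt y x → ∀ i, FreeAlgebra.ι k (y, i) ∈ T := fun y hy i =>
      Algebra.subset_adjoin ⟨(y, i), Prod.Lex.left _ _ hy, rfl⟩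
    obtain ⟨H1, H2, H3⟩ := P.maps_mem_adjoin (T := T) (fun y hy => hT y hy 0)
      (fun y hy => hT y hy 1) (fun y hy => hT y hy 2) (P.d_gen x)
    change freeD P.cylDeg P.cylδ (FreeAlgebra.ι k (x, j)) ∈ T
    rw [freeD_ι]
    fin_cases j
    · exact H1
    · exact H2
    · refine T.add_mem (T.smul_mem (T.sub_mem ?_ ?_) _) H3
      · exact Algebra.subset_adjoin ⟨(x, 1), Prod.Lex.right _ (by decide), rfl⟩
      · exact Algebra.subset_adjoin ⟨(x, 0), Prod.Lex.right _ (by decide), rfl⟩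

/-- The morphism `i₁ : A ⟶ Cyl A`. -/
def i₁ : A ⟶ P.cyl := (⟨P.inc₁, P.inc₁_mem, fun a => (P.freeD_inc₁ a).symm⟩ : DGAlg.Hom A P.cyl)

/-- The morphism `i₂ : A ⟶ Cyl A`. -/
def i₂ : A ⟶ P.cyl := (⟨P.inc₂, P.inc₂_mem, fun a => (P.freeD_inc₂ a).symm⟩ : DGAlg.Hom A P.cyl)

/-- A graded algebra map out of the cylinder commutes with the differentials
if it does on generators. -/
lemma cyl_map_d {C : DGAlg k} (φ : FreeAlgebra k P.CylX →ₐ[k] C.carrier)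
    (hφ : ∀ y, φ (FreeAlgebra.ι k y) ∈ C.gr (P.cylDeg y))
    (hd : ∀ y, φ (P.cylδ y) = C.d (φ (FreeAlgebra.ι k y))) :
    (∀ {n : ℤ} {a : FreeAlgebra k P.CylX}, a ∈ freeGr P.cylDeg n → φ a ∈ C.gr n) ∧
    ∀ a, φ (freeD P.cylDeg P.cylδ a) = C.d (φ a) := by
  constructor
  · intro n a ha
    refine freeGr_induction (motive := fun n a => φ a ∈ C.gr n) ?_ ?_ ?_ ?_ ?_ ha
    · intro n; rw [map_zero]; exact Submodule.zero_mem _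
    · intro n a b h h'; rw [map_add]; exact Submodule.add_mem _ h h'
    · intro n r a h; rw [map_smul]; exact Submodule.smul_mem _ _ h
    · rw [map_one]; exact SetLike.GradedOne.one_mem
    · intro y n a _ h
      rw [map_mul]
      exact SetLike.GradedMul.mul_mem (hφ y) h
  · intro a
    refine free_induction P.cylDeg (motive := fun a =>
      φ (freeD P.cylDeg P.cylδ a) = C.d (φ a)) ?_ ?_ ?_ ?_ ?_ a
    · simp
    · intro a b h h'
      rw [map_add, map_add, map_add, map_add, h, h']
    · intro r a h
      rw [map_smul, map_smul, map_smul, map_smul, h]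
    · rw [freeD_one, map_zero, map_one, d_one]
    · intro y a h
      rw [freeD_mul _ _ (ι_mem_freeGr P.cylDeg y), freeD_ι, map_add, map_smul, map_mul, map_mul,
        map_mul, h, hd, C.leibniz (hφ y)]

/-- The algebra map underlying `p`: `x¹, x² ↦ x` and `t_x ↦ 0`. -/
def projHom : FreeAlgebra k P.CylX →ₐ[k] A.carrier :=
  FreeAlgebra.lift k fun y => ![P.gen y.1, P.gen y.1, 0] y.2

lemma projHom_inc₁ (a : A.carrier) : P.projHom (P.inc₁ a) = a := by
  refine P.induction' (motive := fun a => P.projHom (P.inc₁ a) = a) (by simp) ?_ ?_ (by simp) ?_ a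
  · intro a b h h'; rw [map_add, map_add, h, h']
  · intro r a h; rw [map_smul, map_smul, h]
  · intro x n a _ h
    rw [map_mul, map_mul, h, inc₁_gen, g₁, projHom, FreeAlgebra.lift_ι_apply]
    rfl

lemma projHom_inc₂ (a : A.carrier) : P.projHom (P.inc₂ a) = a := by
  refine P.induction' (motive := fun a => P.projHom (P.inc₂ a) = a) (by simp) ?_ ?_ (by simp) ?_ a
  · intro a b h h'; rw [map_add, map_add, h, h']
  · intro r a h; rw [map_smul, map_smul, h]
  · intro x n a _ h
    rw [map_mul, map_mul, h, inc₂_gen, g₂, projHom, FreeAlgebra.lift_ι_apply]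
    rfl

lemma projHom_gt (x : P.X) : P.projHom (P.gt x) = 0 := by
  rw [gt, projHom, FreeAlgebra.lift_ι_apply]
  rfl

lemma projHom_tmap (a : A.carrier) : P.projHom (P.tmap a) = 0 := by
  refine P.induction' (motive := fun a => P.projHom (P.tmap a) = 0) (by simp) ?_ ?_ (by simp) ?_ a
  · intro a b h h'; rw [map_add, map_add, h, h', add_zero]
  · intro r a h; rw [map_smul, map_smul, h, smul_zero]
  · intro x n a ha h
    rw [P.tmap_mul _ ha, map_add, map_smul, map_mul, map_mul, h, tmap_gen, projHom_gt]
    simp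

lemma projHom_props :
    (∀ {n : ℤ} {a : FreeAlgebra k P.CylX}, a ∈ freeGr P.cylDeg n → P.projHom a ∈ A.gr n) ∧
    ∀ a, P.projHom (freeD P.cylDeg P.cylδ a) = A.d (P.projHom a) := by
  apply P.cyl_map_d
  · rintro ⟨x, j⟩
    rw [projHom, FreeAlgebra.lift_ι_apply]
    fin_cases j
    · exact P.gen_mem x
    · exact P.gen_mem x
    · exact Submodule.zero_mem _
  · rintro ⟨x, j⟩
    fin_cases j
    · change P.projHom (P.inc₁ _) = A.d (P.projHom (P.g₁ x))
      rw [projHom_inc₁, ← inc₁_gen, projHom_inc₁]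
    · change P.projHom (P.inc₂ _) = A.d (P.projHom (P.g₂ x))
      rw [projHom_inc₂, ← inc₂_gen, projHom_inc₂]
    · change P.projHom (sgn k (P.deg x) • (P.g₂ x - P.g₁ x) + P.tmap (A.d (P.gen x))) =
        A.d (P.projHom (P.gt x))
      rw [map_add, map_smul, map_sub, projHom_tmap, projHom_gt, ← inc₁_gen, ← inc₂_gen,
        projHom_inc₁, projHom_inc₂]
      simp

/-- The projection `p : Cyl A ⟶ A`. -/
def proj : P.cyl ⟶ A :=
  (⟨P.projHom, P.projHom_props.1, P.projHom_props.2⟩ : DGAlg.Hom P.cyl A)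

variable {B : DGAlg k} (Q : Generators B) (F : A ⟶ B)

/-- The algebra map underlying `Cyl F`: `x¹ ↦ (F x)¹`, `x² ↦ (F x)²` and `t_x ↦ t_{F x}`. -/
def cylMapHom : FreeAlgebra k P.CylX →ₐ[k] FreeAlgebra k Q.CylX :=
  FreeAlgebra.lift k fun y => ![Q.inc₁ (DGAlg.toAlgHom F (P.gen y.1)),
    Q.inc₂ (DGAlg.toAlgHom F (P.gen y.1)), Q.tmap (DGAlg.toAlgHom F (P.gen y.1))] y.2

lemma cylMapHom_g₁ (x : P.X) :
    P.cylMapHom Q F (P.g₁ x) = Q.inc₁ (DGAlg.toAlgHom F (P.gen x)) := by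
  rw [g₁, cylMapHom, FreeAlgebra.lift_ι_apply]
  rfl

lemma cylMapHom_g₂ (x : P.X) :
    P.cylMapHom Q F (P.g₂ x) = Q.inc₂ (DGAlg.toAlgHom F (P.gen x)) := by
  rw [g₂, cylMapHom, FreeAlgebra.lift_ι_apply]
  rfl

lemma cylMapHom_gt (x : P.X) :
    P.cylMapHom Q F (P.gt x) = Q.tmap (DGAlg.toAlgHom F (P.gen x)) := by
  rw [gt, cylMapHom, FreeAlgebra.lift_ι_apply]
  rfl

lemma cylMapHom_inc₁ (a : A.carrier) :
    P.cylMapHom Q F (P.inc₁ a) = Q.inc₁ (DGAlg.toAlgHom F a) := by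
  refine P.induction' (motive := fun a => P.cylMapHom Q F (P.inc₁ a) =
    Q.inc₁ (DGAlg.toAlgHom F a)) (by simp) ?_ ?_ (by simp) ?_ a
  · intro a b h h'; simp only [map_add, h, h']
  · intro r a h; simp only [map_smul, h]
  · intro x n a _ h
    rw [map_mul, map_mul, h, inc₁_gen, cylMapHom_g₁, map_mul, map_mul]

lemma cylMapHom_inc₂ (a : A.carrier) :
    P.cylMapHom Q F (P.inc₂ a) = Q.inc₂ (DGAlg.toAlgHom F a) := by
  refine P.induction' (motive := fun a => P.cylMapHom Q F (P.inc₂ a) =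
    Q.inc₂ (DGAlg.toAlgHom F a)) (by simp) ?_ ?_ (by simp) ?_ a
  · intro a b h h'; simp only [map_add, h, h']
  · intro r a h; simp only [map_smul, h]
  · intro x n a _ h
    rw [map_mul, map_mul, h, inc₂_gen, cylMapHom_g₂, map_mul, map_mul]

/-- `Cyl(F)(t_θ) = t_{F(θ)}`. -/
lemma cylMapHom_tmap (a : A.carrier) :
    P.cylMapHom Q F (P.tmap a) = Q.tmap (DGAlg.toAlgHom F a) := by
  refine P.induction' (motive := fun a => P.cylMapHom Q F (P.tmap a) =
    Q.tmap (DGAlg.toAlgHom F a)) (by simp) ?_ ?_ (by simp) ?_ a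
  · intro a b h h'; simp only [map_add, h, h']
  · intro r a h; simp only [map_smul, h]
  · intro x n a ha h
    rw [P.tmap_mul _ ha, map_add, map_smul, map_mul, map_mul, map_mul,
      Q.tmap_mul _ (DGAlg.toAlgHom_mem F ha), h, inc₂_gen, tmap_gen, cylMapHom_g₂, cylMapHom_gt,
      cylMapHom_inc₁]

lemma cylMapHom_props :
    (∀ {n : ℤ} {a : FreeAlgebra k P.CylX}, a ∈ freeGr P.cylDeg n →
      P.cylMapHom Q F a ∈ Q.cyl.gr n) ∧
    ∀ a, P.cylMapHom Q F (freeD P.cylDeg P.cylδ a) = Q.cyl.d (P.cylMapHom Q F a) := by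
  apply P.cyl_map_d (C := Q.cyl)
  · rintro ⟨x, j⟩
    have hx := DGAlg.toAlgHom_mem F (P.gen_mem x)
    change P.cylMapHom Q F (FreeAlgebra.ι k (x, j)) ∈ freeGr (k := k) Q.cylDeg (P.cylDeg (x, j))
    rw [cylMapHom, FreeAlgebra.lift_ι_apply]
    fin_cases j
    · exact Q.inc₁_mem hx
    · exact Q.inc₂_mem hx
    · exact Q.tmap_mem hx
  · rintro ⟨x, j⟩
    have hx := DGAlg.toAlgHom_mem F (P.gen_mem x)
    fin_cases j
    · change P.cylMapHom Q F (P.inc₁ _) = freeD Q.cylDeg Q.cylδ (P.cylMapHom Q F (P.g₁ x))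
      rw [cylMapHom_inc₁, cylMapHom_g₁, freeD_inc₁, DGAlg.toAlgHom_d]
    · change P.cylMapHom Q F (P.inc₂ _) = freeD Q.cylDeg Q.cylδ (P.cylMapHom Q F (P.g₂ x))
      rw [cylMapHom_inc₂, cylMapHom_g₂, freeD_inc₂, DGAlg.toAlgHom_d]
    · change P.cylMapHom Q F (sgn k (P.deg x) • (P.g₂ x - P.g₁ x) + P.tmap (A.d (P.gen x))) =
        freeD Q.cylDeg Q.cylδ (P.cylMapHom Q F (P.gt x))
      rw [map_add, map_smul, map_sub, cylMapHom_tmap, cylMapHom_gt, cylMapHom_g₁, cylMapHom_g₂,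
        Q.freeD_tmap hx, DGAlg.toAlgHom_d]

/-- The morphism `Cyl F : Cyl A ⟶ Cyl B`. -/
def cylMap : P.cyl ⟶ Q.cyl :=
  (⟨P.cylMapHom Q F, (P.cylMapHom_props Q F).1, (P.cylMapHom_props Q F).2⟩ :
    DGAlg.Hom P.cyl Q.cyl)

/-- Algebra maps out of the cylinder are determined by their values on the generators. -/
lemma cyl_algHom_ext {C : Type u} [Ring C] [Algebra k C] {φ ψ : FreeAlgebra k P.CylX →ₐ[k] C}
    (h1 : ∀ x, φ (P.g₁ x) = ψ (P.g₁ x)) (h2 : ∀ x, φ (P.g₂ x) = ψ (P.g₂ x))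
    (h3 : ∀ x, φ (P.gt x) = ψ (P.gt x)) : φ = ψ := by
  apply FreeAlgebra.hom_ext
  funext ⟨x, j⟩
  fin_cases j
  · exact h1 x
  · exact h2 x
  · exact h3 x

end Generators

/-! ### The cylinder functor -/

section CylFunctor

variable (gens : ∀ A : SemifreeDGAlg k, Generators A.obj)

/-- The cylinder functor on semifree dg algebras, with respect to a choice of
a set of generating morphisms for each of them. -/
@[simps obj] def Cyl : SemifreeDGAlg k ⥤ SemifreeDGAlg k where
  obj A := ⟨(gens A).cyl, ⟨(gens A).cylGenerators⟩⟩
  map {A B} F := ObjectProperty.homMk ((gens A).cylMap (gens B) F.hom)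
  map_id A := by
    apply ObjectProperty.hom_ext
    apply DGAlg.hom_ext
    exact (gens A).cyl_algHom_ext (fun x => by
        refine ((gens A).cylMapHom_g₁ (gens A) _ x).trans ?_; simp; rfl) (fun x => by
        refine ((gens A).cylMapHom_g₂ (gens A) _ x).trans ?_; simp; rfl) (fun x => by
        refine ((gens A).cylMapHom_gt (gens A) _ x).trans ?_; simp; rfl)
  map_comp {A B C} F G := by
    apply ObjectProperty.hom_ext
    apply DGAlg.hom_ext
    refine (gens A).cyl_algHom_ext (fun x => ?_) (fun x => ?_) (fun x => ?_)
    · change (gens A).cylMapHom (gens C) _ _ =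
        (gens B).cylMapHom (gens C) G.hom ((gens A).cylMapHom (gens B) F.hom _)
      rw [Generators.cylMapHom_g₁, Generators.cylMapHom_g₁, Generators.cylMapHom_inc₁]
      rfl
    · change (gens A).cylMapHom (gens C) _ _ =
        (gens B).cylMapHom (gens C) G.hom ((gens A).cylMapHom (gens B) F.hom _)
      rw [Generators.cylMapHom_g₂, Generators.cylMapHom_g₂, Generators.cylMapHom_inc₂]
      rfl
    · change (gens A).cylMapHom (gens C) _ _ =
        (gens B).cylMapHom (gens C) G.hom ((gens A).cylMapHom (gens B) F.hom _)
      rw [Generators.cylMapHom_gt, Generators.cylMapHom_gt, Generators.cylMapHom_tmap]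
      rfl

/-- The natural transformation `i₁ : id ⟶ Cyl`. -/
def cylI₁ : 𝟭 (SemifreeDGAlg k) ⟶ Cyl gens where
  app A := ObjectProperty.homMk (gens A).i₁
  naturality A B F := by
    apply ObjectProperty.hom_ext
    apply DGAlg.hom_ext
    exact AlgHom.ext fun a => ((gens A).cylMapHom_inc₁ (gens B) F.hom a).symm

/-- The natural transformation `i₂ : id ⟶ Cyl`. -/
def cylI₂ : 𝟭 (SemifreeDGAlg k) ⟶ Cyl gens where
  app A := ObjectProperty.homMk (gens A).i₂
  naturality A B F := by
    apply ObjectProperty.hom_ext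
    apply DGAlg.hom_ext
    exact AlgHom.ext fun a => ((gens A).cylMapHom_inc₂ (gens B) F.hom a).symm

/-- The natural transformation `p : Cyl ⟶ id`. -/
def cylP : Cyl gens ⟶ 𝟭 (SemifreeDGAlg k) where
  app A := ObjectProperty.homMk (gens A).proj
  naturality A B F := by
    apply ObjectProperty.hom_ext
    apply DGAlg.hom_ext
    refine (gens A).cyl_algHom_ext (fun x => ?_) (fun x => ?_) (fun x => ?_)
    · change (gens B).projHom ((gens A).cylMapHom (gens B) F.hom _) =
        DGAlg.toAlgHom F.hom ((gens A).projHom _)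
      rw [Generators.cylMapHom_g₁, Generators.projHom_inc₁, ← Generators.inc₁_gen,
        Generators.projHom_inc₁]
    · change (gens B).projHom ((gens A).cylMapHom (gens B) F.hom _) =
        DGAlg.toAlgHom F.hom ((gens A).projHom _)
      rw [Generators.cylMapHom_g₂, Generators.projHom_inc₂, ← Generators.inc₂_gen,
        Generators.projHom_inc₂]
    · change (gens B).projHom ((gens A).cylMapHom (gens B) F.hom _) =
        DGAlg.toAlgHom F.hom ((gens A).projHom _)
      rw [Generators.cylMapHom_gt, Generators.projHom_tmap, Generators.projHom_gt, map_zero]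

end CylFunctor

end

/-! ### Axioms for abstract homotopy theory -/

section Axioms

universe v w

variable {M : Type w} [Category.{v} M]

/-- `(M, cof, I)`, with the natural transformations `i 0, i 1 : id ⟶ I` (called `i₁`, `i₂` in the
literature) and `p : I ⟶ id`, is an `I`-category in the sense of Baues. -/
structure IsICategory (cof : MorphismProperty M) (I : M ⥤ M) (i : Fin 2 → (𝟭 M ⟶ I))
    (p : I ⟶ 𝟭 M) : Prop where
  /-- There is an initial object. -/
  hasInitial : HasInitial M
  /-- Cylinder axiom. -/
  cylinder : ∀ (r : Fin 2) (A : M), (i r).app A ≫ p.app A = 𝟙 A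
  /-- Pushout axiom: existence of pushouts along cofibrations. -/
  exists_pushout : ∀ {A B C : M} (F : A ⟶ B) (G : A ⟶ C), cof F →
    ∃ (D : M) (G' : B ⟶ D) (F' : C ⟶ D), IsPushout F G G' F' ∧ cof F'
  /-- Pushout axiom: cofibrations are stable under pushouts. -/
  cof_of_isPushout : ∀ {A B C D : M} {F : A ⟶ B} {G : A ⟶ C} {G' : B ⟶ D} {F' : C ⟶ D},
    IsPushout F G G' F' → cof F → cof F'
  /-- Pushout axiom: `I` preserves the initial object. -/
  initial_map : ∀ {E : M}, Nonempty (IsInitial E) → Nonempty (IsInitial (I.obj E))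
  /-- Pushout axiom: `I` preserves pushouts along cofibrations. -/
  isPushout_map : ∀ {A B C D : M} {F : A ⟶ B} {G : A ⟶ C} {G' : B ⟶ D} {F' : C ⟶ D},
    IsPushout F G G' F' → cof F → IsPushout (I.map F) (I.map G) (I.map G') (I.map F')
  /-- Cofibration axiom: isomorphisms are cofibrations. -/
  cof_of_isIso : ∀ {A B : M} (F : A ⟶ B), IsIso F → cof F
  /-- Cofibration axiom: every object is cofibrant. -/
  cof_initial : ∀ {E : M} (hE : IsInitial E) (A : M), cof (hE.to A)
  /-- Cofibration axiom: closure under composition. -/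
  cof_comp : ∀ {A B C : M} (F : A ⟶ B) (G : B ⟶ C), cof F → cof G → cof (F ≫ G)
  /-- Cofibration axiom: the homotopy extension property. -/
  hep : ∀ {A B C : M} (F : A ⟶ B), cof F → ∀ (r : Fin 2) (G : B ⟶ C) (H : I.obj A ⟶ C),
    F ≫ G = (i r).app A ≫ H → ∃ E : I.obj B ⟶ C, (i r).app B ≫ E = G ∧ I.map F ≫ E = H
  /-- Relative cylinder axiom: `AA` and `BB` are the coproducts `A ⊔ A` and `B ⊔ B`, and `D` is
  the pushout `B ∪_A I(A) ∪_A B` of `F ⊔ F` and `i₁ ⊔ i₂`. (These colimits exist, and all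
  the maps below are determined, by the axioms above.) -/
  relative_cylinder : ∀ {A B : M} (F : A ⟶ B), cof F →
    ∀ {AA BB D : M} (a₁ a₂ : A ⟶ AA) (b₁ b₂ : B ⟶ BB),
    Nonempty (IsColimit (BinaryCofan.mk a₁ a₂)) → Nonempty (IsColimit (BinaryCofan.mk b₁ b₂)) →
    ∀ (FF : AA ⟶ BB) (iA : AA ⟶ I.obj A) (iB : BB ⟶ I.obj B),
    a₁ ≫ FF = F ≫ b₁ → a₂ ≫ FF = F ≫ b₂ →
    a₁ ≫ iA = (i 0).app A → a₂ ≫ iA = (i 1).app A →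
    b₁ ≫ iB = (i 0).app B → b₂ ≫ iB = (i 1).app B →
    ∀ (j : BB ⟶ D) (l : I.obj A ⟶ D), IsPushout FF iA j l →
    ∀ G : D ⟶ I.obj B, j ≫ G = iB → l ≫ G = I.map F → cof G
  /-- Interchange axiom. -/
  interchange : ∀ A : M, ∃ T : I.obj (I.obj A) ⟶ I.obj (I.obj A),
    ∀ r : Fin 2, (i r).app (I.obj A) ≫ T = I.map ((i r).app A) ∧
      I.map ((i r).app A) ≫ T = (i r).app (I.obj A)

/-- An object `R` is fibrant if every trivial cofibration out of `R` admits a retraction. -/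
def IsFibrantObject (cof we : MorphismProperty M) (R : M) : Prop :=
  ∀ {Q : M} (i : R ⟶ Q), cof i → we i → ∃ r : Q ⟶ R, i ≫ r = 𝟙 R

/-- An object `X` is cofibrant if the map from the initial object to `X` is a cofibration. -/
def IsCofibrantObject (cof : MorphismProperty M) (X : M) : Prop :=
  ∃ (E : M) (hE : IsInitial E), cof (hE.to X)

/-- `(M, cof, we)` is a cofibration category in the sense of Baues. -/
structure IsCofibrationCategory (cof we : MorphismProperty M) : Prop where
  /-- Composition axiom. -/
  cof_of_isIso : ∀ {A B : M} (F : A ⟶ B), IsIso F → cof F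
  we_of_isIso : ∀ {A B : M} (F : A ⟶ B), IsIso F → we F
  two_out_of_three : we.HasTwoOutOfThreeProperty
  cof_comp : ∀ {A B C : M} (F : A ⟶ B) (G : B ⟶ C), cof F → cof G → cof (F ≫ G)
  /-- Pushout axiom. -/
  exists_pushout : ∀ {A B C : M} (F : A ⟶ B) (G : A ⟶ C), cof F →
    ∃ (D : M) (G' : B ⟶ D) (F' : C ⟶ D), IsPushout F G G' F' ∧ cof F'
  cof_of_isPushout : ∀ {A B C D : M} {F : A ⟶ B} {G : A ⟶ C} {G' : B ⟶ D} {F' : C ⟶ D},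
    IsPushout F G G' F' → cof F → cof F'
  we_of_isPushout : ∀ {A B C D : M} {F : A ⟶ B} {G : A ⟶ C} {G' : B ⟶ D} {F' : C ⟶ D},
    IsPushout F G G' F' → cof F → we G → we G'
  we_of_isPushout_of_cof : ∀ {A B C D : M} {F : A ⟶ B} {G : A ⟶ C} {G' : B ⟶ D} {F' : C ⟶ D},
    IsPushout F G G' F' → cof F → we F → we F'
  /-- Factorization axiom. -/
  factorization : ∀ {A B : M} (F : A ⟶ B),
    ∃ (Z : M) (j : A ⟶ Z) (q : Z ⟶ B), cof j ∧ we q ∧ j ≫ q = F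
  /-- Axiom on fibrant models. -/
  fibrant_model : ∀ X : M, ∃ (R : M) (j : X ⟶ R), cof j ∧ we j ∧ IsFibrantObject cof we R

/-- `(M, cof, we)` is a category of cofibrant objects (the dual of Brown's notion of a category
of fibrant objects). -/
structure IsCategoryOfCofibrantObjects (cof we : MorphismProperty M) : Prop where
  hasFiniteCoproducts : HasFiniteCoproducts M
  we_of_isIso : ∀ {A B : M} (F : A ⟶ B), IsIso F → we F
  two_out_of_three : we.HasTwoOutOfThreeProperty
  cof_of_isIso : ∀ {A B : M} (F : A ⟶ B), IsIso F → cof F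
  cof_comp : ∀ {A B C : M} (F : A ⟶ B) (G : B ⟶ C), cof F → cof G → cof (F ≫ G)
  /-- Pushouts of cofibrations along arbitrary maps exist. -/
  exists_pushout : ∀ {A B C : M} (F : A ⟶ B) (G : A ⟶ C), cof F →
    ∃ (D : M) (G' : B ⟶ D) (F' : C ⟶ D), IsPushout F G G' F'
  /-- Cofibrations are stable under pushouts. -/
  cof_of_isPushout : ∀ {A B C D : M} {F : A ⟶ B} {G : A ⟶ C} {G' : B ⟶ D} {F' : C ⟶ D},
    IsPushout F G G' F' → cof F → cof F'
  /-- Trivial cofibrations are stable under pushouts. -/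
  we_of_isPushout : ∀ {A B C D : M} {F : A ⟶ B} {G : A ⟶ C} {G' : B ⟶ D} {F' : C ⟶ D},
    IsPushout F G G' F' → cof F → we F → we F'
  /-- Every object `X` has a cylinder object: the codiagonal `X ⊔ X ⟶ X` factors as a cofibration
  followed by a weak equivalence. -/
  cylinder : ∀ {X XX : M} (a₁ a₂ : X ⟶ XX), Nonempty (IsColimit (BinaryCofan.mk a₁ a₂)) →
    ∃ (Z : M) (j : XX ⟶ Z) (q : Z ⟶ X), cof j ∧ we q ∧ a₁ ≫ j ≫ q = 𝟙 X ∧ a₂ ≫ j ≫ q = 𝟙 X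
  /-- Every object is cofibrant. -/
  cofibrant : ∀ X : M, IsCofibrantObject cof X

end Axioms

end SemifreeDGA

/-!
The proof reduces everything to algebra maps out of free algebras. A semifree extension `F : A ⟶ B`
is recorded by a well-ordered family of generators `s` (`RelGenerators`), and everything about it
is determined on generators: algebra maps by the universal property, and twisted derivations too,
because a map `D` with `D (a * b) = f a * D b + D a * g b` is the upper right entry of the algebra
map to `2 × 2`-matrices with diagonal `(f, g)`. Adjoining the same generators to another semifree
dg algebra gives pushouts along semifree extensions (`exists_isAlgPushout`), whose underlying
square of algebras is a pushout, so that twisted derivations can be glued along it.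

The cylinder has a universal property that does not mention generators: an algebra map out of
`Cyl A` is a pair of algebra maps `f₁, f₂` out of `A` and a linear map `T` with
`T (a * b) = f₂ a * T b + T a * f₁ (σ b)`, where `σ` is the sign involution
(`Generators.exists_cylDesc`); it is a morphism of dg algebras if `T` is moreover a homotopy.
Therefore `Cyl` preserves pushouts and the initial object, whatever the chosen generators. The
twisted derivation with `x¹ ↦ 0`, `x² ↦ t_x`, `t_x ↦ 0` contracts `Cyl A` onto `i₁ A`, so `p` is a
quasi-equivalence, and the interchange map swaps the two cylinder coordinates.

The homotopical input is that semifree extensions lift against surjective quasi-equivalences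
(`RelGenerators.exists_lift`), by well-founded recursion on the generators. Two consequences carry
the rest.

* A trivial semifree extension `F : A ⟶ B` is a retract, under `A`, of the extension of `A` by an
  acyclic family of generators `y, d y` (disks), with one `y` for each homogeneous element of `B`.
  Extensions by disks have retractions and are stable under pushout, so every semifree dg algebra is
  fibrant and trivial cofibrations are stable under pushout.
* For a semifree extension `F : A ⟶ B` with generators `s`, the map
  `B ∪_A Cyl A ∪_A B ⟶ Cyl B` is a semifree extension with generators `t_s`
  (`RelGenerators.relCyl`). After a second copy of `B` is attached, this exhibits
  `B ∪_A Cyl A ⟶ Cyl B` as a semifree extension. It is also a quasi-equivalence, and a retraction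
  of it gives the homotopy extension property.

Every morphism factors through its mapping cylinder as a cofibration followed by a
quasi-equivalence with a section. For stability of weak equivalences under pushout along a
cofibration it remains to treat a quasi-equivalence with a section: it is a homotopy equivalence
over its target by the lifting property, and homotopy extension together with the fact that `Cyl`
preserves the pushout carries this homotopy equivalence to the pushout.
-/

namespace SemifreeDGA

noncomputable section

variable {k : Type u} [CommRing k]

/-! ### The sign involution -/

namespace DGAlg

/-- The linear map underlying `DGAlg.sig`. -/
def sigLinear (A : DGAlg k) : A.carrier →ₗ[k] A.carrier :=
  (DirectSum.toModule k ℤ A.carrier fun n => sgn k n • (A.gr n).subtype) ∘ₗ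
    (DirectSum.decomposeLinearEquiv A.gr).toLinearMap

lemma sigLinear_of_mem (A : DGAlg k) {n : ℤ} {a : A.carrier} (ha : a ∈ A.gr n) :
    A.sigLinear a = sgn k n • a := by
  classical
  simp only [sigLinear, LinearMap.comp_apply, LinearEquiv.coe_coe,
    DirectSum.decomposeLinearEquiv_apply]
  rw [DirectSum.decompose_of_mem _ ha]
  exact DirectSum.toModule_lof k (M := fun n => A.gr n) n ⟨a, ha⟩

/-- Induction on the homogeneous components of an element of a dg algebra. -/
lemma homog_induction (A : DGAlg k) {motive : A.carrier → Prop} (zero : motive 0)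
    (homog : ∀ n a, a ∈ A.gr n → motive a)
    (add : ∀ a b, motive a → motive b → motive (a + b)) (a : A.carrier) : motive a :=
  DirectSum.Decomposition.inductionOn A.gr zero (fun {n} a => homog n a a.2) add a

/-- The sign involution `a ↦ (-1)^|a| a`, an algebra automorphism. It allows the Leibniz rule and
its variants to be stated for all elements instead of homogeneous ones. -/
def sig (A : DGAlg k) : A.carrier →ₐ[k] A.carrier :=
  AlgHom.ofLinearMap A.sigLinear
    (by rw [A.sigLinear_of_mem SetLike.GradedOne.one_mem, sgn_zero, one_smul])
    (by
      intro a b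
      induction a using A.homog_induction with
      | zero => simp
      | add a a' h h' => rw [add_mul, map_add, map_add, h, h', add_mul]
      | homog m a ha =>
        induction b using A.homog_induction with
        | zero => simp
        | add b b' h h' => rw [mul_add, map_add, map_add, h, h', mul_add]
        | homog n b hb =>
          rw [A.sigLinear_of_mem ha, A.sigLinear_of_mem hb,
            A.sigLinear_of_mem (SetLike.GradedMul.mul_mem ha hb), sgn_add, smul_mul_smul_comm])

lemma sig_of_mem (A : DGAlg k) {n : ℤ} {a : A.carrier} (ha : a ∈ A.gr n) :
    A.sig a = sgn k n • a := A.sigLinear_of_mem ha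

lemma sig_mem (A : DGAlg k) {n : ℤ} {a : A.carrier} (ha : a ∈ A.gr n) : A.sig a ∈ A.gr n := by
  rw [A.sig_of_mem ha]; exact Submodule.smul_mem _ _ ha

@[simp] lemma sig_sig (A : DGAlg k) (a : A.carrier) : A.sig (A.sig a) = a := by
  induction a using A.homog_induction with
  | zero => simp
  | add a a' h h' => rw [map_add, map_add, h, h']
  | homog m a ha => rw [A.sig_of_mem ha, map_smul, A.sig_of_mem ha, smul_smul, sgn_mul_self, one_smul]

lemma d_mul (A : DGAlg k) (a b : A.carrier) : A.d (a * b) = A.d a * b + A.sig a * A.d b := by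
  induction a using A.homog_induction with
  | zero => simp
  | add a a' h h' => simp only [add_mul, map_add, h, h']; abel
  | homog m a ha => rw [A.sig_of_mem ha, A.leibniz ha, smul_mul_assoc]

lemma d_sig (A : DGAlg k) (a : A.carrier) : A.d (A.sig a) = - A.sig (A.d a) := by
  induction a using A.homog_induction with
  | zero => simp
  | add a a' h h' => simp only [map_add, h, h']; abel
  | homog m a ha =>
    rw [A.sig_of_mem ha, A.sig_of_mem (A.d_mem ha), map_smul, sgn_succ, neg_smul, neg_neg]

lemma sig_toAlgHom {A B : DGAlg k} (f : A ⟶ B) (a : A.carrier) :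
    B.sig (toAlgHom f a) = toAlgHom f (A.sig a) := by
  induction a using A.homog_induction with
  | zero => simp
  | add a a' h h' => simp only [map_add, h, h']
  | homog m a ha => rw [A.sig_of_mem ha, B.sig_of_mem (toAlgHom_mem f ha), map_smul]

/-! ### Maps which are homogeneous, or compatible with differentials, on generators -/

/-- If `S` consists of homogeneous elements whose images under `φ` are homogeneous of the same
degree, then `φ` preserves the degrees on the subalgebra generated by `S`. -/
lemma map_mem_of_adjoin {B : Type u} [Ring B] [Algebra k B] {ℬ : ℤ → Submodule k B}
    [GradedAlgebra ℬ] {C : Type u} [Ring C] [Algebra k C] {𝒞 : ℤ → Submodule k C}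
    [GradedAlgebra 𝒞] {φ : B →ₐ[k] C} {S : Set B}
    (hS : ∀ b ∈ S, ∃ n, b ∈ ℬ n ∧ φ b ∈ 𝒞 n) {b : B} (hb : b ∈ Algebra.adjoin k S) {n : ℤ}
    (hn : b ∈ ℬ n) : φ b ∈ 𝒞 n := by
  classical
  suffices h : ∀ b ∈ Algebra.adjoin k S,
      φ (DirectSum.decompose ℬ b n) = DirectSum.decompose 𝒞 (φ b) n by
    have := h b hb
    rw [DirectSum.decompose_of_mem_same _ hn] at this
    rw [this]; exact SetLike.coe_mem _
  intro b hb
  have key : ∀ b ∈ Submonoid.closure S, ∃ m, b ∈ ℬ m ∧ φ b ∈ 𝒞 m := by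
    intro b hb
    induction hb using Submonoid.closure_induction with
    | mem b hb => exact hS b hb
    | one =>
      exact ⟨0, SetLike.GradedOne.one_mem, by rw [map_one]; exact SetLike.GradedOne.one_mem⟩
    | mul a b _ _ ha hb =>
      obtain ⟨i, h1, h2⟩ := ha
      obtain ⟨j, h3, h4⟩ := hb
      refine ⟨i + j, SetLike.GradedMul.mul_mem h1 h3, ?_⟩
      rw [map_mul]; exact SetLike.GradedMul.mul_mem h2 h4
  rw [← Subalgebra.mem_toSubmodule, Algebra.adjoin_eq_span] at hb
  induction hb using Submodule.span_induction with
  | mem b hb =>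
    obtain ⟨m, h1, h2⟩ := key b hb
    by_cases hm : m = n
    · subst hm
      rw [DirectSum.decompose_of_mem_same _ h1, DirectSum.decompose_of_mem_same _ h2]
    · rw [DirectSum.decompose_of_mem_ne _ h1 hm, DirectSum.decompose_of_mem_ne _ h2 hm, map_zero]
  | zero => simp
  | add a b _ _ ha hb => simp [DirectSum.decompose_add, ha, hb]
  | smul r a _ ha =>
    rw [DirectSum.decompose_smul, map_smul φ, DirectSum.decompose_smul]
    change φ (r • _) = r • _
    rw [map_smul, ha]

/-- An algebra map which respects the grading and commutes with `d` on a set `S` of homogeneous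
elements does so on the subalgebra generated by `S`. -/
lemma map_d_of_adjoin {B C : DGAlg k} {φ : B.carrier →ₐ[k] C.carrier} {S : Set B.carrier}
    (hS : ∀ b ∈ S, ∃ n, b ∈ B.gr n ∧ φ b ∈ C.gr n) (hd : ∀ b ∈ S, φ (B.d b) = C.d (φ b))
    {b : B.carrier} (hb : b ∈ Algebra.adjoin k S) : φ (B.d b) = C.d (φ b) := by
  have hsig : ∀ b ∈ Algebra.adjoin k S, φ (B.sig b) = C.sig (φ b) := by
    intro b hb
    change b ∈ AlgHom.equalizer (φ.comp B.sig) (C.sig.comp φ)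
    refine Algebra.adjoin_le ?_ hb
    intro b hb
    obtain ⟨n, h1, h2⟩ := hS b hb
    change φ (B.sig b) = C.sig (φ b)
    rw [B.sig_of_mem h1, C.sig_of_mem h2, map_smul]
  induction hb using Algebra.adjoin_induction with
  | mem b hb => exact hd b hb
  | algebraMap r =>
    rw [Algebra.algebraMap_eq_smul_one, map_smul, map_smul, Generators.d_one, map_smul,
      map_one, map_smul, Generators.d_one, smul_zero, map_zero, smul_zero]
  | add a b _ _ ha hb => simp only [map_add, ha, hb]
  | mul a b ha' _ ha hb =>
    rw [B.d_mul, map_add, map_mul, map_mul, map_mul, C.d_mul, ha, hb, hsig a ha']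

/-- A morphism of dg algebras is constructed from an algebra map by checking compatibility with the
structure on generators of the algebra. -/
def homOfAdjoin {B C : DGAlg k} (φ : B.carrier →ₐ[k] C.carrier) {S : Set B.carrier}
    (top : Algebra.adjoin k S = ⊤) (hS : ∀ b ∈ S, ∃ n, b ∈ B.gr n ∧ φ b ∈ C.gr n)
    (hd : ∀ b ∈ S, φ (B.d b) = C.d (φ b)) : B ⟶ C :=
  (⟨φ, fun h => map_mem_of_adjoin hS (top ▸ Algebra.mem_top) h,
    fun _ => map_d_of_adjoin hS hd (top ▸ Algebra.mem_top)⟩ : DGAlg.Hom B C)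

/-- The images of the homogeneous elements under a morphism of dg algebras. -/
def homImage {A B : DGAlg k} (f : A ⟶ B) : Set B.carrier :=
  {b | ∃ n, ∃ a ∈ A.gr n, toAlgHom f a = b}

lemma range_subset_adjoin_homImage {A B : DGAlg k} (f : A ⟶ B) :
    Set.range (toAlgHom f) ⊆ Algebra.adjoin k (homImage f) := by
  rintro _ ⟨a, rfl⟩
  induction a using A.homog_induction with
  | zero => rw [map_zero]; exact Subalgebra.zero_mem _
  | add a a' h h' => rw [map_add]; exact Subalgebra.add_mem _ h h'
  | homog n a ha => exact Algebra.subset_adjoin ⟨n, a, ha, rfl⟩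

/-! ### Cohomology -/

/-- Homotopic morphisms induce the same map on cohomology. The sign conventions are those of the
operation `t` of the cylinder: the usual homotopy equation holds for `a ↦ T (σ a)`, where `σ` is
the sign involution. -/
lemma cohomologyMap_eq_of_homotopy {A B : DGAlg k} {f g : A ⟶ B}
    (T : A.carrier →ₗ[k] B.carrier)
    (hT : ∀ a, B.d (T a) = toAlgHom g (A.sig a) - toAlgHom f (A.sig a) + T (A.d a)) :
    cohomologyMap f = cohomologyMap g := by
  apply LinearMap.ext
  intro x
  obtain ⟨⟨a, ha⟩, rfl⟩ := Submodule.Quotient.mk_surjective _ x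
  symm
  refine (Submodule.Quotient.eq _).2 ?_
  refine ⟨T (A.sig a), ?_⟩
  rw [hT, sig_sig, d_sig, LinearMap.mem_ker.1 ha]
  simp
  rfl

lemma cohomologyMap_id (A : DGAlg k) : cohomologyMap (𝟙 A) = LinearMap.id := by
  apply LinearMap.ext
  intro x
  obtain ⟨a, rfl⟩ := Submodule.Quotient.mk_surjective _ x
  rfl

lemma cohomologyMap_comp {A B C : DGAlg k} (f : A ⟶ B) (g : B ⟶ C) :
    cohomologyMap (f ≫ g) = cohomologyMap g ∘ₗ cohomologyMap f := by
  apply LinearMap.ext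
  intro x
  obtain ⟨a, rfl⟩ := Submodule.Quotient.mk_surjective _ x
  rfl

namespace IsQuasiEquivalence

/-- A morphism with a two-sided inverse on cohomology is a quasi-equivalence. -/
lemma of_inverse {A B : DGAlg k} {f : A ⟶ B} {g : B ⟶ A}
    (h : cohomologyMap (f ≫ g) = cohomologyMap (𝟙 A))
    (h' : cohomologyMap (g ≫ f) = cohomologyMap (𝟙 B)) : IsQuasiEquivalence f := by
  rw [cohomologyMap_comp, cohomologyMap_id] at h h'
  exact Function.bijective_iff_has_inverse.2
    ⟨cohomologyMap g, LinearMap.congr_fun h, LinearMap.congr_fun h'⟩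

lemma comp {A B C : DGAlg k} {f : A ⟶ B} {g : B ⟶ C} (hf : IsQuasiEquivalence f)
    (hg : IsQuasiEquivalence g) : IsQuasiEquivalence (f ≫ g) := by
  rw [IsQuasiEquivalence, cohomologyMap_comp, LinearMap.coe_comp]
  exact Function.Bijective.comp hg hf

lemma of_comp_left {A B C : DGAlg k} {f : A ⟶ B} {g : B ⟶ C} (hf : IsQuasiEquivalence f)
    (h : IsQuasiEquivalence (f ≫ g)) : IsQuasiEquivalence g := by
  rw [IsQuasiEquivalence, cohomologyMap_comp] at h
  exact (Function.Bijective.of_comp_iff _ hf).1 h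

lemma of_comp_right {A B C : DGAlg k} {f : A ⟶ B} {g : B ⟶ C} (hg : IsQuasiEquivalence g)
    (h : IsQuasiEquivalence (f ≫ g)) : IsQuasiEquivalence f := by
  rw [IsQuasiEquivalence, cohomologyMap_comp] at h
  exact (Function.Bijective.of_comp_iff' hg _).1 h

lemma of_iso {A B : DGAlg k} {f : A ⟶ B} {g : B ⟶ A} (h : f ≫ g = 𝟙 A) (h' : g ≫ f = 𝟙 B) :
    IsQuasiEquivalence f := of_inverse (by rw [h]) (by rw [h'])

/-- Quasi-equivalences are closed under retracts in the category of objects under `A`. -/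
lemma of_retract {A X Y : DGAlg k} {i : A ⟶ X} {j : A ⟶ Y} {s : X ⟶ Y} {r : Y ⟶ X}
    (his : i ≫ s = j) (hsr : s ≫ r = 𝟙 X) (hj : IsQuasiEquivalence j) :
    IsQuasiEquivalence i := by
  rw [IsQuasiEquivalence, ← his, cohomologyMap_comp] at hj
  have h1 : cohomologyMap r ∘ₗ cohomologyMap s = LinearMap.id := by
    rw [← cohomologyMap_comp, hsr, cohomologyMap_id]
  have h2 : Function.Injective (cohomologyMap s) := fun x y h => by
    have := congrArg (cohomologyMap r) h
    rwa [← LinearMap.comp_apply, ← LinearMap.comp_apply, h1] at this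
  refine ⟨Function.Injective.of_comp hj.1, fun x => ?_⟩
  obtain ⟨a, ha⟩ := hj.2 (cohomologyMap s x)
  exact ⟨a, h2 ha⟩

/-- Given a surjective quasi-equivalence `q : Y ⟶ Z`, a cocycle `y` of `Y` and an element `z` of `Z`
with `d z = q y`, there is `w` with `d w = y` and `q w = z`. -/
lemma exists_lift {Y Z : DGAlg k} {q : Y ⟶ Z} (hq : IsQuasiEquivalence q)
    (hs : Function.Surjective (toAlgHom q)) {n : ℤ} {y : Y.carrier} {z : Z.carrier}
    (hy : y ∈ Y.gr (n + 1)) (hdy : Y.d y = 0) (hz : z ∈ Z.gr n) (hzy : Z.d z = toAlgHom q y) :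
    ∃ w ∈ Y.gr n, Y.d w = y ∧ toAlgHom q w = z := by
  classical
  obtain ⟨w₀, hw₀⟩ : ∃ w₀, Y.d w₀ = y := by
    have h0 : cohomologyMap q (Submodule.Quotient.mk ⟨y, hdy⟩) = cohomologyMap q 0 := by
      rw [map_zero]
      refine (Submodule.Quotient.mk_eq_zero _).2 ⟨z, ?_⟩
      exact hzy
    obtain ⟨w₀, hw₀⟩ := (Submodule.Quotient.mk_eq_zero _).1 (hq.1 h0)
    exact ⟨w₀, hw₀⟩
  have hc : Z.d (toAlgHom q w₀ - z) = 0 := by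
    rw [map_sub, ← toAlgHom_d, hw₀, hzy, sub_self]
  obtain ⟨⟨v, hv⟩, hvq⟩ : ∃ v : LinearMap.ker Y.d,
      cohomologyMap q (Submodule.Quotient.mk v) = Submodule.Quotient.mk ⟨_, hc⟩ := by
    obtain ⟨x, hx⟩ := hq.2 (Submodule.Quotient.mk ⟨_, hc⟩)
    obtain ⟨v, rfl⟩ := Submodule.Quotient.mk_surjective _ x
    exact ⟨v, hx⟩
  obtain ⟨t, ht⟩ := (Submodule.Quotient.eq _).1 hvq
  obtain ⟨t', rfl⟩ := hs t
  change Z.d (toAlgHom q t') = toAlgHom q v - (toAlgHom q w₀ - z) at ht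
  -- a lift, not necessarily homogeneous; its component of degree `n` is again a lift
  obtain ⟨w, hw, hwz⟩ : ∃ w, Y.d w = y ∧ toAlgHom q w = z := by
    refine ⟨w₀ - v + Y.d t', ?_, ?_⟩
    · rw [map_add, map_sub, hw₀, LinearMap.mem_ker.1 hv, Y.d_d]; simp
    · rw [map_add, map_sub, toAlgHom_d, ht]; abel
  have h1 : ∀ w, Y.d (DirectSum.decompose Y.gr w n) = DirectSum.decompose Y.gr (Y.d w) (n + 1) := by
    intro w
    induction w using Y.homog_induction with
    | zero => simp
    | add a b ha hb => simp [DirectSum.decompose_add, ha, hb]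
    | homog m a ha =>
      by_cases hm : m = n
      · subst hm
        rw [DirectSum.decompose_of_mem_same _ ha, DirectSum.decompose_of_mem_same _ (Y.d_mem ha)]
      · rw [DirectSum.decompose_of_mem_ne _ ha hm,
          DirectSum.decompose_of_mem_ne _ (Y.d_mem ha) (by omega), map_zero]
  have h2 : ∀ w, toAlgHom q (DirectSum.decompose Y.gr w n) =
      DirectSum.decompose Z.gr (toAlgHom q w) n := by
    intro w
    induction w using Y.homog_induction with
    | zero => simp
    | add a b ha hb => simp [DirectSum.decompose_add, ha, hb]
    | homog m a ha =>
      by_cases hm : m = n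
      · subst hm
        rw [DirectSum.decompose_of_mem_same _ ha,
          DirectSum.decompose_of_mem_same _ (toAlgHom_mem q ha)]
      · rw [DirectSum.decompose_of_mem_ne _ ha hm,
          DirectSum.decompose_of_mem_ne _ (toAlgHom_mem q ha) hm, map_zero]
  refine ⟨DirectSum.decompose Y.gr w n, SetLike.coe_mem _, ?_, ?_⟩
  · rw [h1, hw, DirectSum.decompose_of_mem_same _ hy]
  · rw [h2, hwz, DirectSum.decompose_of_mem_same _ hz]

end IsQuasiEquivalence

end DGAlg

/-! ### Twisted derivations and triangular matrices -/

section Derivations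

variable {B : Type u} [Ring B] [Algebra k B] {Z : Type u} [Ring Z] [Algebra k Z]

/-- A linear map `D` is a `(φ, ψ)`-derivation if `D (a * b) = φ a * D b + D a * ψ b`. -/
def IsDeriv (φ ψ : B →ₐ[k] Z) (D : B →ₗ[k] Z) : Prop :=
  ∀ a b, D (a * b) = φ a * D b + D a * ψ b

namespace IsDeriv

variable {φ ψ : B →ₐ[k] Z} {D D' : B →ₗ[k] Z}

lemma map_one (h : IsDeriv φ ψ D) : D 1 = 0 := by
  have := h 1 1
  simpa using this

lemma map_algebraMap (h : IsDeriv φ ψ D) (r : k) : D (algebraMap k B r) = 0 := by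
  rw [Algebra.algebraMap_eq_smul_one, map_smul, h.map_one, smul_zero]

/-- Twisted derivations are determined by their values on generators. -/
lemma eqOn_adjoin (h : IsDeriv φ ψ D) (h' : IsDeriv φ ψ D') {S : Set B} (hS : Set.EqOn D D' S) :
    Set.EqOn D D' (Algebra.adjoin k S) := by
  intro b hb
  induction hb using Algebra.adjoin_induction with
  | mem b hb => exact hS hb
  | algebraMap r => rw [h.map_algebraMap, h'.map_algebraMap]
  | add a b _ _ ha hb => rw [map_add, map_add, ha, hb]
  | mul a b _ _ ha hb => rw [h, h', ha, hb]

lemma ext (h : IsDeriv φ ψ D) (h' : IsDeriv φ ψ D') {S : Set B} (top : Algebra.adjoin k S = ⊤)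
    (hS : Set.EqOn D D' S) : D = D' :=
  LinearMap.ext fun _ => h.eqOn_adjoin h' hS (top ▸ Algebra.mem_top)

lemma comp {B' : Type u} [Ring B'] [Algebra k B'] (h : IsDeriv φ ψ D) (f : B' →ₐ[k] B) :
    IsDeriv (φ.comp f) (ψ.comp f) (D ∘ₗ f.toLinearMap) := fun a b => by
  simp [h (f a) (f b)]

lemma postcomp {Z' : Type u} [Ring Z'] [Algebra k Z'] (h : IsDeriv φ ψ D) (f : Z →ₐ[k] Z') :
    IsDeriv (f.comp φ) (f.comp ψ) (f.toLinearMap ∘ₗ D) := fun a b => by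
  simp [h a b]

end IsDeriv

variable (k Z) in
/-- The algebra of upper triangular `2 × 2`-matrices. -/
def Upper : Subalgebra k (Matrix (Fin 2) (Fin 2) Z) where
  carrier := {m | m 1 0 = 0}
  mul_mem' {a b} ha hb := by
    simp only [Set.mem_ofPred_eq] at *
    simp [Matrix.mul_apply, ha, hb]
  add_mem' {a b} ha hb := by
    simp only [Set.mem_ofPred_eq] at *
    simp [ha, hb]
  algebraMap_mem' r := by simp [Matrix.algebraMap_matrix_apply]

namespace Upper

/-- The triangular matrix with given entries. -/
def mk (x y z : Z) : Upper k Z := ⟨!![x, y; 0, z], by simp [Upper]⟩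

/-- The upper left entry. -/
def fst : Upper k Z →ₐ[k] Z where
  toFun m := m.1 0 0
  map_one' := by simp
  map_zero' := by simp
  map_add' := by simp
  map_mul' a b := by
    have hb : b.1 1 0 = 0 := b.2
    simp [Matrix.mul_apply, hb]
  commutes' r := by simp [Matrix.algebraMap_matrix_apply]

/-- The lower right entry. -/
def snd : Upper k Z →ₐ[k] Z where
  toFun m := m.1 1 1
  map_one' := by simp
  map_zero' := by simp
  map_add' := by simp
  map_mul' a b := by
    have ha : a.1 1 0 = 0 := a.2
    simp [Matrix.mul_apply, ha]
  commutes' r := by simp [Matrix.algebraMap_matrix_apply]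

/-- The upper right entry. -/
def off : Upper k Z →ₗ[k] Z where
  toFun m := m.1 0 1
  map_add' := by simp
  map_smul' := by simp

@[simp] lemma fst_mk (x y z : Z) : fst (mk x y z : Upper k Z) = x := rfl
@[simp] lemma snd_mk (x y z : Z) : snd (mk x y z : Upper k Z) = z := rfl
@[simp] lemma off_mk (x y z : Z) : off (mk x y z : Upper k Z) = y := rfl

lemma ext {a b : Upper k Z} (h1 : fst a = fst b) (h2 : off a = off b) (h3 : snd a = snd b) :
    a = b := by
  apply Subtype.ext
  ext i j
  fin_cases i <;> fin_cases j
  · exact h1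
  · exact h2
  · exact (show a.1 1 0 = 0 from a.2).trans (show b.1 1 0 = 0 from b.2).symm
  · exact h3

lemma off_isDeriv : IsDeriv (fst (k := k) (Z := Z)) snd off := fun a b => by
  change (a.1 * b.1) 0 1 = a.1 0 0 * b.1 0 1 + a.1 0 1 * b.1 1 1
  simp [Matrix.mul_apply]

end Upper

/-- The algebra map to triangular matrices given by a twisted derivation. -/
def IsDeriv.toUpper {φ ψ : B →ₐ[k] Z} {D : B →ₗ[k] Z} (h : IsDeriv φ ψ D) : B →ₐ[k] Upper k Z :=
  AlgHom.ofLinearMap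
    { toFun b := Upper.mk (φ b) (D b) (ψ b)
      map_add' a b := Upper.ext (by simp) (by simp) (by simp)
      map_smul' r b := Upper.ext (by simp) (by simp) (by simp) }
    (Upper.ext (by simp) (h.map_one.trans (by rfl)) (by simp))
    (fun a b => Upper.ext (by simp)
      (by
        rw [Upper.off_isDeriv]
        exact h a b) (by simp))

end Derivations

/-! ### Semifree extensions -/

/-- The data exhibiting a morphism `F` as a semifree extension. -/
structure RelGenerators {A B : DGAlg k} (F : A ⟶ B) where
  /-- the index set of the adjoined generators -/
  X : Type u
  /-- the well-order -/
  lt : X → X → Prop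
  wo : IsWellOrder X lt
  /-- the degrees of the adjoined generators -/
  deg : X → ℤ
  /-- the adjoined generators -/
  s : X → B.carrier
  s_mem : ∀ x, s x ∈ B.gr (deg x)
  existsUnique : ∀ (C : Type u) [Ring C] [Algebra k C] (f : A.carrier →ₐ[k] C) (c : X → C),
    ∃! φ : B.carrier →ₐ[k] C, φ.comp (DGAlg.toAlgHom F) = f ∧ ∀ x, φ (s x) = c x
  d_s : ∀ x, B.d (s x) ∈ Algebra.adjoin k (Set.range (DGAlg.toAlgHom F) ∪ s '' {y | lt y x})

attribute [instance] RelGenerators.wo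

lemma isSemifreeExtension_iff {A B : DGAlg k} {F : A ⟶ B} :
    IsSemifreeExtension F ↔ Nonempty (RelGenerators F) := by
  constructor
  · rintro ⟨X, lt, deg, s, h1, h2, h3, h4⟩
    exact ⟨⟨X, lt, h1, deg, s, h2, h3, h4⟩⟩
  · rintro ⟨S⟩
    exact ⟨S.X, S.lt, S.deg, S.s, S.wo, S.s_mem, S.existsUnique, S.d_s⟩

namespace RelGenerators

variable {A B : DGAlg k} {F : A ⟶ B} (S : RelGenerators F)
variable {C : Type u} [Ring C] [Algebra k C]

/-- The algebra map out of a free extension with prescribed values. -/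
def desc (f : A.carrier →ₐ[k] C) (c : S.X → C) : B.carrier →ₐ[k] C :=
  (S.existsUnique C f c).choose

lemma desc_comp (f : A.carrier →ₐ[k] C) (c : S.X → C) :
    (S.desc f c).comp (DGAlg.toAlgHom F) = f := (S.existsUnique C f c).choose_spec.1.1

@[simp] lemma desc_apply (f : A.carrier →ₐ[k] C) (c : S.X → C) (a : A.carrier) :
    S.desc f c (DGAlg.toAlgHom F a) = f a := DFunLike.congr_fun (S.desc_comp f c) a

@[simp] lemma desc_s (f : A.carrier →ₐ[k] C) (c : S.X → C) (x : S.X) :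
    S.desc f c (S.s x) = c x := (S.existsUnique C f c).choose_spec.1.2 x

lemma algHom_ext {φ ψ : B.carrier →ₐ[k] C}
    (h : φ.comp (DGAlg.toAlgHom F) = ψ.comp (DGAlg.toAlgHom F))
    (hs : ∀ x, φ (S.s x) = ψ (S.s x)) : φ = ψ :=
  (S.existsUnique C _ _).unique ⟨h, hs⟩ ⟨rfl, fun _ => rfl⟩

lemma adjoin_eq_top :
    Algebra.adjoin k (Set.range (DGAlg.toAlgHom F) ∪ Set.range S.s) = ⊤ := by
  set T := Algebra.adjoin k (Set.range (DGAlg.toAlgHom F) ∪ Set.range S.s) with hT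
  let f : A.carrier →ₐ[k] T := (DGAlg.toAlgHom F).codRestrict T fun a =>
    Algebra.subset_adjoin (Or.inl ⟨a, rfl⟩)
  let c : S.X → T := fun x => ⟨S.s x, Algebra.subset_adjoin (Or.inr ⟨x, rfl⟩)⟩
  have h : T.val.comp (S.desc f c) = AlgHom.id k _ := by
    apply S.algHom_ext
    · rw [AlgHom.comp_assoc, S.desc_comp]; rfl
    · intro x; rw [AlgHom.comp_apply, S.desc_s]; rfl
  rw [eq_top_iff]
  intro b _
  have := DFunLike.congr_fun h b
  rw [AlgHom.id_apply] at this
  rw [← this]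
  exact (S.desc f c b).2

/-- A generating set consisting of homogeneous elements. -/
lemma adjoin_homImage_eq_top :
    Algebra.adjoin k (DGAlg.homImage F ∪ Set.range S.s) = ⊤ := by
  rw [← top_le_iff, ← S.adjoin_eq_top]
  refine Algebra.adjoin_le (Set.union_subset ?_ ?_)
  · exact (DGAlg.range_subset_adjoin_homImage F).trans
      (Algebra.adjoin_mono Set.subset_union_left)
  · exact Set.subset_union_right.trans Algebra.subset_adjoin

/-- Extension of twisted derivations along a free extension. -/
lemma exists_deriv (φ ψ : B.carrier →ₐ[k] C) {D₀ : A.carrier →ₗ[k] C}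
    (h : IsDeriv (φ.comp (DGAlg.toAlgHom F)) (ψ.comp (DGAlg.toAlgHom F)) D₀) (c : S.X → C) :
    ∃ D : B.carrier →ₗ[k] C, IsDeriv φ ψ D ∧ (∀ a, D (DGAlg.toAlgHom F a) = D₀ a) ∧
      ∀ x, D (S.s x) = c x := by
  let M := S.desc h.toUpper fun x => Upper.mk (φ (S.s x)) (c x) (ψ (S.s x))
  have h1 : Upper.fst.comp M = φ := S.algHom_ext
    (AlgHom.ext fun a => by simp [M]; rfl) (fun x => by simp [M])
  have h2 : Upper.snd.comp M = ψ := S.algHom_ext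
    (AlgHom.ext fun a => by simp [M]; rfl) (fun x => by simp [M])
  refine ⟨Upper.off ∘ₗ M.toLinearMap, ?_, fun a => ?_, fun x => ?_⟩
  · have := Upper.off_isDeriv.comp M
    rwa [h1, h2] at this
  · simp [M]; rfl
  · simp [M]

lemma adjoin_lower_homImage (x : S.X) :
    Algebra.adjoin k (DGAlg.homImage F ∪ S.s '' {y | S.lt y x}) =
      Algebra.adjoin k (Set.range (DGAlg.toAlgHom F) ∪ S.s '' {y | S.lt y x}) := by
  apply le_antisymm
  · refine Algebra.adjoin_mono (Set.union_subset_union_left _ ?_)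
    rintro _ ⟨n, a, -, rfl⟩
    exact ⟨a, rfl⟩
  · refine Algebra.adjoin_le (Set.union_subset ?_ ?_)
    · exact (DGAlg.range_subset_adjoin_homImage F).trans
        (Algebra.adjoin_mono Set.subset_union_left)
    · exact Set.subset_union_right.trans Algebra.subset_adjoin

/-- A morphism out of a semifree extension is determined by its restriction to the base and
its values on the adjoined generators. -/
lemma hom_ext {Z : DGAlg k} {f g : B ⟶ Z} (h : F ≫ f = F ≫ g)
    (hs : ∀ x, DGAlg.toAlgHom f (S.s x) = DGAlg.toAlgHom g (S.s x)) : f = g :=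
  DGAlg.hom_ext (S.algHom_ext (congrArg DGAlg.toAlgHom h) hs)

/-- The morphism out of a semifree extension extending a given one on the base, with prescribed
values on the adjoined generators. -/
def homDesc {Z : DGAlg k} (f : A ⟶ Z) (c : S.X → Z.carrier) (hc : ∀ x, c x ∈ Z.gr (S.deg x))
    (hd : ∀ x, S.desc (DGAlg.toAlgHom f) c (B.d (S.s x)) = Z.d (c x)) : B ⟶ Z :=
  DGAlg.homOfAdjoin (S.desc (DGAlg.toAlgHom f) c) S.adjoin_homImage_eq_top
    (by
      rintro _ (⟨n, a, ha, rfl⟩ | ⟨x, rfl⟩)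
      · exact ⟨n, DGAlg.toAlgHom_mem F ha, by rw [desc_apply]; exact DGAlg.toAlgHom_mem f ha⟩
      · exact ⟨_, S.s_mem x, by rw [desc_s]; exact hc x⟩)
    (by
      rintro _ (⟨n, a, ha, rfl⟩ | ⟨x, rfl⟩)
      · rw [← DGAlg.toAlgHom_d, desc_apply, desc_apply, DGAlg.toAlgHom_d]
      · rw [hd, desc_s])

lemma comp_homDesc {Z : DGAlg k} (f : A ⟶ Z) (c : S.X → Z.carrier) (hc hd) :
    F ≫ S.homDesc f c hc hd = f := DGAlg.hom_ext (S.desc_comp _ _)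

lemma homDesc_s {Z : DGAlg k} (f : A ⟶ Z) (c : S.X → Z.carrier) (hc hd) (x : S.X) :
    DGAlg.toAlgHom (S.homDesc f c hc hd) (S.s x) = c x := S.desc_s _ _ x

end RelGenerators

/-! ### Isomorphisms and composites of semifree extensions -/

lemma map_mem_of_mem_adjoin {B C : Type u} [Ring B] [Algebra k B] [Ring C] [Algebra k C]
    (f : B →ₐ[k] C) {S : Set B} {T : Subalgebra k C} (h : ∀ b ∈ S, f b ∈ T) {b : B}
    (hb : b ∈ Algebra.adjoin k S) : f b ∈ T :=
  Algebra.adjoin_le (S := T.comap f) h hb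

namespace RelGenerators

/-- An isomorphism is a semifree extension without generators. -/
def ofIso {A B : DGAlg k} {f : A ⟶ B} {g : B ⟶ A} (h : f ≫ g = 𝟙 A) (h' : g ≫ f = 𝟙 B) :
    RelGenerators f where
  X := PEmpty
  lt := emptyRelation
  wo := inferInstance
  deg := PEmpty.elim
  s := fun x => x.elim
  s_mem := fun x => x.elim
  existsUnique C _ _ φ c := by
    have e := congrArg DGAlg.toAlgHom h
    have e' := congrArg DGAlg.toAlgHom h'
    rw [DGAlg.toAlgHom_comp, DGAlg.toAlgHom_id] at e e'
    refine ⟨φ.comp (DGAlg.toAlgHom g), ⟨?_, fun x => x.elim⟩, ?_⟩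
    · rw [AlgHom.comp_assoc, e, AlgHom.comp_id]
    · rintro ψ ⟨rfl, -⟩
      rw [AlgHom.comp_assoc, e', AlgHom.comp_id]
  d_s := fun x => x.elim

/-- The composite of semifree extensions `F` and `G`: the generators of `F` come first. -/
def comp {A B C : DGAlg k} {F : A ⟶ B} {G : B ⟶ C} (S : RelGenerators F) (T : RelGenerators G) :
    RelGenerators (F ≫ G) where
  X := S.X ⊕ T.X
  lt := Sum.Lex S.lt T.lt
  wo := inferInstance
  deg := Sum.elim S.deg T.deg
  s := Sum.elim (fun x => DGAlg.toAlgHom G (S.s x)) T.s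
  s_mem := by
    rintro (x | x)
    · exact DGAlg.toAlgHom_mem G (S.s_mem x)
    · exact T.s_mem x
  existsUnique Z _ _ f c := by
    refine ⟨T.desc (S.desc f fun x => c (Sum.inl x)) fun x => c (Sum.inr x), ⟨?_, ?_⟩, ?_⟩
    · apply AlgHom.ext
      intro a
      simp
    · rintro (x | x) <;> simp
    · rintro ψ ⟨h1, h2⟩
      refine T.algHom_ext (S.algHom_ext (AlgHom.ext fun a => ?_) fun x => ?_) fun x => ?_
      · simpa using DFunLike.congr_fun h1 a
      · simpa using h2 (Sum.inl x)
      · simpa using h2 (Sum.inr x)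
  d_s := by
    rintro (x | x)
    · rw [Sum.elim_inl, ← DGAlg.toAlgHom_d]
      refine map_mem_of_mem_adjoin _ ?_ (S.d_s x)
      rintro _ (⟨a, rfl⟩ | ⟨y, hy, rfl⟩)
      · exact Algebra.subset_adjoin (Or.inl ⟨a, rfl⟩)
      · exact Algebra.subset_adjoin (Or.inr ⟨Sum.inl y, Sum.Lex.inl hy, rfl⟩)
    · refine Algebra.adjoin_le (Set.union_subset ?_ ?_) (T.d_s x)
      · rintro _ ⟨b, rfl⟩
        have hb : b ∈ Algebra.adjoin k (Set.range (DGAlg.toAlgHom F) ∪ Set.range S.s) := by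
          rw [S.adjoin_eq_top]; exact Algebra.mem_top
        refine map_mem_of_mem_adjoin _ ?_ hb
        rintro _ (⟨a, rfl⟩ | ⟨y, rfl⟩)
        · exact Algebra.subset_adjoin (Or.inl ⟨a, rfl⟩)
        · exact Algebra.subset_adjoin (Or.inr ⟨Sum.inl y, Sum.Lex.sep _ _, rfl⟩)
      · rintro _ ⟨y, hy, rfl⟩
        exact Algebra.subset_adjoin (Or.inr ⟨Sum.inr y, Sum.Lex.inr hy, rfl⟩)

end RelGenerators

/-! ### Attaching generators -/

/-- The sign involution of a free algebra with graded generators. -/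
def freeSig {Y : Type u} (deg : Y → ℤ) : FreeAlgebra k Y →ₐ[k] FreeAlgebra k Y :=
  FreeAlgebra.lift k fun y => sgn k (deg y) • FreeAlgebra.ι k y

lemma freeD_isDeriv {Y : Type u} (deg : Y → ℤ) (δ : Y → FreeAlgebra k Y) :
    IsDeriv (freeSig deg) (AlgHom.id k _) (freeD deg δ) := fun a b => by
  rw [freeD, tri_mul, lift_ι_self]; rfl

lemma DGAlg.d_isDeriv (A : DGAlg k) : IsDeriv A.sig (AlgHom.id k _) A.d := fun a b => by
  rw [A.d_mul, add_comm]; rfl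

namespace Generators

variable {A : DGAlg k} (P : Generators A)

lemma adjoin_eq_top : Algebra.adjoin k (Set.range P.gen) = ⊤ := by
  have h := AlgHom.range_eq_top (FreeAlgebra.lift k P.gen) |>.2 P.bijective.2
  rw [← h, ← Algebra.map_top, ← FreeAlgebra.adjoin_range_ι, AlgHom.map_adjoin, ← Set.range_comp]
  congr 1
  ext a
  simp

lemma algHom_ext {Z : Type u} [Ring Z] [Algebra k Z] {φ ψ : A.carrier →ₐ[k] Z}
    (h : ∀ x, φ (P.gen x) = ψ (P.gen x)) : φ = ψ := by
  refine AlgHom.ext_of_adjoin_eq_top P.adjoin_eq_top ?_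
  rintro _ ⟨x, rfl⟩
  exact h x

variable {V : Type u} (deg : V → ℤ) (δ : V → FreeAlgebra k (P.X ⊕ V))

/-- The inclusion of `A` into the algebra obtained by adjoining free generators. -/
def attachInc (V : Type u) : A.carrier →ₐ[k] FreeAlgebra k (P.X ⊕ V) :=
  (FreeAlgebra.lift k fun x => FreeAlgebra.ι k (Sum.inl x)).comp P.equiv.symm.toAlgHom

@[simp] lemma attachInc_gen (x : P.X) :
    P.attachInc V (P.gen x) = FreeAlgebra.ι k (Sum.inl x) := by
  simp [attachInc]

/-- The degrees of the generators after attaching generators of degrees `deg`. -/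
abbrev attachDeg : P.X ⊕ V → ℤ := Sum.elim P.deg deg

/-- The differentials of the generators after attaching generators with differentials `δ`. -/
abbrev attachδ : P.X ⊕ V → FreeAlgebra k (P.X ⊕ V) :=
  Sum.elim (fun x => P.attachInc V (A.d (P.gen x))) δ

lemma attachInc_mem {n : ℤ} {a : A.carrier} (ha : a ∈ A.gr n) :
    P.attachInc V a ∈ freeGr (k := k) (P.attachDeg deg) n := by
  refine DGAlg.map_mem_of_adjoin (ℬ := A.gr) (S := Set.range P.gen) ?_ ?_ ha
  · rintro _ ⟨x, rfl⟩
    exact ⟨_, P.gen_mem x, by rw [attachInc_gen]; exact ι_mem_freeGr (P.attachDeg deg) (Sum.inl x)⟩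
  · rw [P.adjoin_eq_top]; exact Algebra.mem_top

lemma freeSig_comp_attachInc :
    (freeSig (P.attachDeg deg)).comp (P.attachInc V) = (P.attachInc V).comp A.sig :=
  P.algHom_ext fun x => by
    simp [freeSig, A.sig_of_mem (P.gen_mem x)]

lemma freeD_attachInc (a : A.carrier) :
    freeD (P.attachDeg deg) (P.attachδ δ) (P.attachInc V a) = P.attachInc V (A.d a) := by
  have h1 := (freeD_isDeriv (P.attachDeg deg) (P.attachδ δ)).comp (P.attachInc V)
  have h2 := A.d_isDeriv.postcomp (P.attachInc V)
  rw [freeSig_comp_attachInc] at h1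
  refine LinearMap.congr_fun (h1.ext h2 P.adjoin_eq_top ?_) a
  rintro _ ⟨x, rfl⟩
  simp [freeD_ι]

variable (lt : V → V → Prop)
  (hδ : ∀ v, δ v ∈ freeGr (k := k) (P.attachDeg deg) (deg v + 1))
  (hδδ : ∀ v, freeD (P.attachDeg deg) (P.attachδ δ) (δ v) = 0)
  (hlt : ∀ v, δ v ∈ Algebra.adjoin k
    (Set.range (P.attachInc V) ∪ (fun w => FreeAlgebra.ι k (Sum.inr w)) '' {w | lt w v}))

/-- The dg algebra obtained by attaching free generators to a semifree dg algebra. -/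
def attach : DGAlg k := freeDGAlg (P.attachDeg deg) (P.attachδ δ)
  (by
    rintro (x | v)
    · exact P.attachInc_mem deg (A.d_mem (P.gen_mem x))
    · exact hδ v)
  (by
    rintro (x | v)
    · change freeD _ _ (P.attachInc V (A.d (P.gen x))) = 0
      rw [freeD_attachInc, A.d_d, map_zero]
    · exact hδδ v)

/-- The inclusion of a semifree dg algebra into that obtained by attaching generators. -/
def attachι : A ⟶ P.attach deg δ hδ hδδ :=
  (⟨P.attachInc V, P.attachInc_mem deg, fun a => (P.freeD_attachInc deg δ a).symm⟩ :
    DGAlg.Hom A (P.attach deg δ hδ hδδ))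

include lt hlt in
lemma attach_d_mem (y : P.X ⊕ V) : freeD (P.attachDeg deg) (P.attachδ δ) (FreeAlgebra.ι k y) ∈
    Algebra.adjoin k (FreeAlgebra.ι k '' {z | Sum.Lex P.lt lt z y}) := by
  rw [freeD_ι]
  obtain x | v := y
  · refine map_mem_of_mem_adjoin _ ?_ (P.d_gen x)
    rintro _ ⟨y, hy, rfl⟩
    exact Algebra.subset_adjoin ⟨Sum.inl y, Sum.Lex.inl hy, (P.attachInc_gen y).symm⟩
  · refine Algebra.adjoin_le (Set.union_subset ?_ ?_) (hlt v)
    · rintro _ ⟨a, rfl⟩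
      have ha : a ∈ Algebra.adjoin k (Set.range P.gen) := by
        rw [P.adjoin_eq_top]; exact Algebra.mem_top
      refine map_mem_of_mem_adjoin _ ?_ ha
      rintro _ ⟨y, rfl⟩
      exact Algebra.subset_adjoin ⟨Sum.inl y, Sum.Lex.sep _ _, (P.attachInc_gen y).symm⟩
    · rintro _ ⟨w, hw, rfl⟩
      exact Algebra.subset_adjoin ⟨Sum.inr w, Sum.Lex.inr hw, rfl⟩

variable [IsWellOrder V lt]

include hlt in
/-- The generators of a dg algebra with attached generators. -/
def attachGenerators : Generators (P.attach deg δ hδ hδδ) where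
  X := P.X ⊕ V
  lt := Sum.Lex P.lt lt
  wo := inferInstance
  deg := P.attachDeg deg
  gen := FreeAlgebra.ι k
  gen_mem := ι_mem_freeGr (P.attachDeg deg)
  bijective := by
    have : (FreeAlgebra.lift k (FreeAlgebra.ι k) : FreeAlgebra k (P.X ⊕ V) →ₐ[k] _) =
        AlgHom.id k _ := AlgHom.ext lift_ι_self
    exact this ▸ Function.bijective_id
  d_gen := P.attach_d_mem deg δ lt hlt

/-- Attaching generators is a semifree extension. -/
def attachRel : RelGenerators (P.attachι deg δ hδ hδδ) where
  X := V
  lt := lt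
  wo := inferInstance
  deg := deg
  s v := FreeAlgebra.ι k (Sum.inr v)
  s_mem v := ι_mem_freeGr (P.attachDeg deg) (Sum.inr v)
  existsUnique C _ _ f c := by
    refine ⟨FreeAlgebra.lift k (Sum.elim (fun x => f (P.gen x)) c), ⟨?_, fun v => ?_⟩, ?_⟩
    · refine P.algHom_ext fun x => ?_
      change FreeAlgebra.lift k _ (P.attachInc V (P.gen x)) = _
      rw [attachInc_gen, FreeAlgebra.lift_ι_apply]; rfl
    · exact FreeAlgebra.lift_ι_apply _ _
    · rintro ψ ⟨h1, h2⟩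
      apply FreeAlgebra.hom_ext
      funext y
      obtain x | v := y
      · have := DFunLike.congr_fun h1 (P.gen x)
        change ψ (P.attachInc V (P.gen x)) = _ at this
        rw [attachInc_gen] at this
        rw [Function.comp_apply, Function.comp_apply, FreeAlgebra.lift_ι_apply]
        exact this
      · rw [Function.comp_apply, Function.comp_apply, FreeAlgebra.lift_ι_apply]
        exact h2 v
  d_s v := by
    change freeD _ _ (FreeAlgebra.ι k (Sum.inr v)) ∈ _
    rw [freeD_ι]
    exact hlt v

end Generators

/-! ### Pushouts along semifree extensions -/

/-- A commutative square of dg algebras whose underlying square of algebras is a pushout. -/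
structure IsAlgPushout {A B C D : DGAlg k} (F : A ⟶ B) (G : A ⟶ C) (G' : B ⟶ D) (F' : C ⟶ D) :
    Prop where
  w : F ≫ G' = G ≫ F'
  existsUnique : ∀ (Z : Type u) [Ring Z] [Algebra k Z] (f : B.carrier →ₐ[k] Z)
    (g : C.carrier →ₐ[k] Z), f.comp (DGAlg.toAlgHom F) = g.comp (DGAlg.toAlgHom G) →
    ∃! h : D.carrier →ₐ[k] Z, h.comp (DGAlg.toAlgHom G') = f ∧ h.comp (DGAlg.toAlgHom F') = g

namespace IsAlgPushout

section

variable {A B C D : DGAlg k} {F : A ⟶ B} {G : A ⟶ C} {G' : B ⟶ D} {F' : C ⟶ D}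
variable (h : IsAlgPushout F G G' F')
variable {Z : Type u} [Ring Z] [Algebra k Z]

include h

lemma algHom_ext {φ ψ : D.carrier →ₐ[k] Z}
    (h1 : φ.comp (DGAlg.toAlgHom G') = ψ.comp (DGAlg.toAlgHom G'))
    (h2 : φ.comp (DGAlg.toAlgHom F') = ψ.comp (DGAlg.toAlgHom F')) : φ = ψ :=
  (h.existsUnique Z _ _ (by
    have := congrArg DGAlg.toAlgHom h.w
    rw [DGAlg.toAlgHom_comp, DGAlg.toAlgHom_comp] at this
    rw [AlgHom.comp_assoc, AlgHom.comp_assoc, this])).unique ⟨h1, h2⟩ ⟨rfl, rfl⟩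

lemma adjoin_eq_top :
    Algebra.adjoin k (Set.range (DGAlg.toAlgHom G') ∪ Set.range (DGAlg.toAlgHom F')) = ⊤ := by
  set T := Algebra.adjoin k (Set.range (DGAlg.toAlgHom G') ∪ Set.range (DGAlg.toAlgHom F'))
    with hT
  let f : B.carrier →ₐ[k] T := (DGAlg.toAlgHom G').codRestrict T fun a =>
    Algebra.subset_adjoin (Or.inl ⟨a, rfl⟩)
  let g : C.carrier →ₐ[k] T := (DGAlg.toAlgHom F').codRestrict T fun a =>
    Algebra.subset_adjoin (Or.inr ⟨a, rfl⟩)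
  obtain ⟨r, ⟨h1, h2⟩, -⟩ := h.existsUnique T f g
    (AlgHom.ext fun a => Subtype.ext (DFunLike.congr_fun (congrArg DGAlg.toAlgHom h.w) a))
  have e : T.val.comp r = AlgHom.id k _ := by
    apply h.algHom_ext
    · rw [AlgHom.comp_assoc, h1]; rfl
    · rw [AlgHom.comp_assoc, h2]; rfl
  rw [eq_top_iff]
  intro b _
  have := DFunLike.congr_fun e b
  rw [AlgHom.id_apply] at this
  rw [← this]
  exact (r b).2

lemma adjoin_homImage_eq_top :
    Algebra.adjoin k (DGAlg.homImage G' ∪ DGAlg.homImage F') = ⊤ := by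
  rw [← top_le_iff, ← h.adjoin_eq_top]
  refine Algebra.adjoin_le (Set.union_subset ?_ ?_)
  · exact (DGAlg.range_subset_adjoin_homImage G').trans (Algebra.adjoin_mono Set.subset_union_left)
  · exact (DGAlg.range_subset_adjoin_homImage F').trans (Algebra.adjoin_mono Set.subset_union_right)

/-- Extension of twisted derivations along a pushout of algebras. -/
lemma exists_deriv (φ ψ : D.carrier →ₐ[k] Z) {T : B.carrier →ₗ[k] Z} {U : C.carrier →ₗ[k] Z}
    (hT : IsDeriv (φ.comp (DGAlg.toAlgHom G')) (ψ.comp (DGAlg.toAlgHom G')) T)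
    (hU : IsDeriv (φ.comp (DGAlg.toAlgHom F')) (ψ.comp (DGAlg.toAlgHom F')) U)
    (e : T ∘ₗ (DGAlg.toAlgHom F).toLinearMap = U ∘ₗ (DGAlg.toAlgHom G).toLinearMap) :
    ∃ E : D.carrier →ₗ[k] Z, IsDeriv φ ψ E ∧ (∀ b, E (DGAlg.toAlgHom G' b) = T b) ∧
      ∀ c, E (DGAlg.toAlgHom F' c) = U c := by
  have hw : ∀ a, DGAlg.toAlgHom G' (DGAlg.toAlgHom F a) = DGAlg.toAlgHom F' (DGAlg.toAlgHom G a) :=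
    DFunLike.congr_fun (congrArg DGAlg.toAlgHom h.w)
  obtain ⟨M, ⟨h1, h2⟩, -⟩ := h.existsUnique (Upper k Z) hT.toUpper hU.toUpper
    (AlgHom.ext fun a => Upper.ext (congrArg φ (hw a)) (LinearMap.congr_fun e a)
      (congrArg ψ (hw a)))
  have e1 : Upper.fst.comp M = φ := h.algHom_ext
    (by rw [AlgHom.comp_assoc, h1]; rfl) (by rw [AlgHom.comp_assoc, h2]; rfl)
  have e2 : Upper.snd.comp M = ψ := h.algHom_ext
    (by rw [AlgHom.comp_assoc, h1]; rfl) (by rw [AlgHom.comp_assoc, h2]; rfl)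
  refine ⟨Upper.off ∘ₗ M.toLinearMap, ?_, fun b => ?_, fun c => ?_⟩
  · have := Upper.off_isDeriv.comp M
    rwa [e1, e2] at this
  · exact congrArg Upper.off (DFunLike.congr_fun h1 b)
  · exact congrArg Upper.off (DFunLike.congr_fun h2 c)

/-- A pushout of algebras is a pushout of dg algebras. -/
lemma existsUnique_hom {Z : DGAlg k} (f : B ⟶ Z) (g : C ⟶ Z) (w : F ≫ f = G ≫ g) :
    ∃! r : D ⟶ Z, G' ≫ r = f ∧ F' ≫ r = g := by
  obtain ⟨r, ⟨h1, h2⟩, -⟩ := h.existsUnique Z.carrier (DGAlg.toAlgHom f) (DGAlg.toAlgHom g)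
    (congrArg DGAlg.toAlgHom w)
  have e1 : ∀ b, r (DGAlg.toAlgHom G' b) = DGAlg.toAlgHom f b := DFunLike.congr_fun h1
  have e2 : ∀ c, r (DGAlg.toAlgHom F' c) = DGAlg.toAlgHom g c := DFunLike.congr_fun h2
  refine ⟨DGAlg.homOfAdjoin r h.adjoin_homImage_eq_top ?_ ?_,
    ⟨DGAlg.hom_ext h1, DGAlg.hom_ext h2⟩, ?_⟩
  · rintro _ (⟨n, b, hb, rfl⟩ | ⟨n, c, hc, rfl⟩)
    · exact ⟨n, DGAlg.toAlgHom_mem _ hb, by rw [e1]; exact DGAlg.toAlgHom_mem _ hb⟩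
    · exact ⟨n, DGAlg.toAlgHom_mem _ hc, by rw [e2]; exact DGAlg.toAlgHom_mem _ hc⟩
  · rintro _ (⟨n, b, hb, rfl⟩ | ⟨n, c, hc, rfl⟩)
    · rw [← DGAlg.toAlgHom_d, e1, e1, DGAlg.toAlgHom_d]
    · rw [← DGAlg.toAlgHom_d, e2, e2, DGAlg.toAlgHom_d]
  · rintro r' ⟨h1', h2'⟩
    exact DGAlg.hom_ext (h.algHom_ext ((congrArg DGAlg.toAlgHom h1').trans h1.symm)
      ((congrArg DGAlg.toAlgHom h2').trans h2.symm))

end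

section

variable {A B C D : SemifreeDGAlg k} {F : A ⟶ B} {G : A ⟶ C} {G' : B ⟶ D} {F' : C ⟶ D}

lemma isPushout (h : IsAlgPushout F.hom G.hom G'.hom F'.hom) : IsPushout F G G' F' := by
  refine ⟨⟨ObjectProperty.hom_ext _ h.w⟩, ⟨PushoutCocone.IsColimit.mk _
    (fun s => ObjectProperty.homMk (h.existsUnique_hom s.inl.hom s.inr.hom
      (congrArg InducedCategory.Hom.hom s.condition)).choose) (fun s => ?_) (fun s => ?_) ?_⟩⟩
  · exact ObjectProperty.hom_ext _ (h.existsUnique_hom s.inl.hom s.inr.hom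
      (congrArg InducedCategory.Hom.hom s.condition)).choose_spec.1.1
  · exact ObjectProperty.hom_ext _ (h.existsUnique_hom s.inl.hom s.inr.hom
      (congrArg InducedCategory.Hom.hom s.condition)).choose_spec.1.2
  · intro s m h1 h2
    exact ObjectProperty.hom_ext _ ((h.existsUnique_hom s.inl.hom s.inr.hom
      (congrArg InducedCategory.Hom.hom s.condition)).choose_spec.2 _
      ⟨congrArg InducedCategory.Hom.hom h1, congrArg InducedCategory.Hom.hom h2⟩)

end

end IsAlgPushout

/-- The pushout of a semifree extension along a morphism of semifree dg algebras is obtained by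
attaching the same generators. -/
lemma RelGenerators.exists_isAlgPushout {A B C : DGAlg k} {F : A ⟶ B} (S : RelGenerators F)
    (G : A ⟶ C) (R : Generators C) :
    ∃ (D : DGAlg k) (_ : Generators D) (G' : B ⟶ D) (F' : C ⟶ D) (_ : RelGenerators F'),
      IsAlgPushout F G G' F' := by
  let j := R.attachInc S.X
  let φ : B.carrier →ₐ[k] FreeAlgebra k (R.X ⊕ S.X) :=
    S.desc (j.comp (DGAlg.toAlgHom G)) fun x => FreeAlgebra.ι k (Sum.inr x)
  have hφ : ∀ {n : ℤ} {b : B.carrier}, b ∈ B.gr n → φ b ∈ freeGr (k := k) (R.attachDeg S.deg) n := by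
    intro n b hb
    refine DGAlg.map_mem_of_adjoin (ℬ := B.gr) ?_
      (S.adjoin_homImage_eq_top ▸ Algebra.mem_top) hb
    rintro _ (⟨n, a, ha, rfl⟩ | ⟨x, rfl⟩)
    · refine ⟨n, DGAlg.toAlgHom_mem F ha, ?_⟩
      simp only [φ, S.desc_apply]
      exact R.attachInc_mem S.deg (DGAlg.toAlgHom_mem G ha)
    · refine ⟨_, S.s_mem x, ?_⟩
      simp only [φ, S.desc_s]
      exact ι_mem_freeGr (R.attachDeg S.deg) (Sum.inr x)
  let δ : S.X → FreeAlgebra k (R.X ⊕ S.X) := fun x => φ (B.d (S.s x))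
  have hsig : (freeSig (R.attachDeg S.deg)).comp φ = φ.comp B.sig := by
    apply S.algHom_ext
    · apply AlgHom.ext
      intro a
      have := DFunLike.congr_fun (R.freeSig_comp_attachInc S.deg) (DGAlg.toAlgHom G a)
      simp only [AlgHom.comp_apply, DGAlg.sig_toAlgHom, φ, S.desc_apply, j] at this ⊢
      exact this
    · intro x
      simp only [AlgHom.comp_apply, φ, S.desc_s, B.sig_of_mem (S.s_mem x), map_smul]
      simp [freeSig]
  have hd : ∀ b, freeD (R.attachDeg S.deg) (R.attachδ δ) (φ b) = φ (B.d b) := by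
    have h1 := (freeD_isDeriv (R.attachDeg S.deg) (R.attachδ δ)).comp φ
    have h2 := B.d_isDeriv.postcomp φ
    rw [hsig] at h1
    refine LinearMap.congr_fun (h1.ext h2 S.adjoin_eq_top ?_)
    rintro _ (⟨a, rfl⟩ | ⟨x, rfl⟩)
    · simp only [LinearMap.comp_apply, AlgHom.toLinearMap_apply, φ, S.desc_apply,
        ← DGAlg.toAlgHom_d, j, AlgHom.comp_apply, R.freeD_attachInc]
    · simp only [LinearMap.comp_apply, AlgHom.toLinearMap_apply]
      rw [show φ (S.s x) = FreeAlgebra.ι k (Sum.inr x) from S.desc_s _ _ x, freeD_ι]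
      rfl
  have hδ : ∀ x, δ x ∈ freeGr (k := k) (R.attachDeg S.deg) (S.deg x + 1) :=
    fun x => hφ (B.d_mem (S.s_mem x))
  have hδδ : ∀ x, freeD (R.attachDeg S.deg) (R.attachδ δ) (δ x) = 0 := fun x => by
    rw [hd, B.d_d, map_zero]
  have hlt : ∀ x, δ x ∈ Algebra.adjoin k (Set.range (R.attachInc S.X) ∪
      (fun w => FreeAlgebra.ι k (Sum.inr w)) '' {w | S.lt w x}) := by
    intro x
    refine map_mem_of_mem_adjoin φ ?_ (S.d_s x)
    rintro _ (⟨a, rfl⟩ | ⟨y, hy, rfl⟩)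
    · refine Algebra.subset_adjoin (Or.inl ⟨DGAlg.toAlgHom G a, ?_⟩)
      simp only [φ, S.desc_apply]; rfl
    · refine Algebra.subset_adjoin (Or.inr ⟨y, hy, ?_⟩)
      simp only [φ, S.desc_s]
  let T := R.attachRel S.deg δ S.lt hδ hδδ hlt
  refine ⟨R.attach S.deg δ hδ hδδ, R.attachGenerators S.deg δ S.lt hδ hδδ hlt,
    (⟨φ, hφ, fun b => (hd b).symm⟩ : DGAlg.Hom B (R.attach S.deg δ hδ hδδ)),
    R.attachι S.deg δ hδ hδδ, T, DGAlg.hom_ext (S.desc_comp _ _), ?_⟩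
  intro Z _ _ f g e
  refine ⟨T.desc g fun x => f (S.s x), ⟨?_, T.desc_comp _ _⟩, ?_⟩
  · apply S.algHom_ext
    · apply AlgHom.ext
      intro a
      change T.desc g _ (φ (DGAlg.toAlgHom F a)) = f (DGAlg.toAlgHom F a)
      simp only [φ, S.desc_apply]
      exact (T.desc_apply _ _ _).trans (DFunLike.congr_fun e a).symm
    · intro x
      change T.desc g _ (φ (S.s x)) = f (S.s x)
      simp only [φ, S.desc_s]
      exact T.desc_s _ _ x
  · rintro r ⟨h1, h2⟩
    apply T.algHom_ext
    · rw [h2, T.desc_comp]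
    · intro x
      rw [T.desc_s, ← h1]
      exact congrArg r (S.desc_s _ _ x).symm

section Semifree

variable {A B C D : SemifreeDGAlg k} {F : A ⟶ B} {G : A ⟶ C} {G' : B ⟶ D} {F' : C ⟶ D}

lemma semifreeExtensions_iff : semifreeExtensions k F ↔ Nonempty (RelGenerators F.hom) :=
  isSemifreeExtension_iff

lemma semifreeExtensions_of_isIso (F : A ⟶ B) (_ : IsIso F) : semifreeExtensions k F :=
  semifreeExtensions_iff.2 ⟨RelGenerators.ofIso (g := (inv F).hom)
    (congrArg InducedCategory.Hom.hom (IsIso.hom_inv_id F))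
    (congrArg InducedCategory.Hom.hom (IsIso.inv_hom_id F))⟩

lemma semifreeExtensions_comp (F : A ⟶ B) (G : B ⟶ C) (hF : semifreeExtensions k F)
    (hG : semifreeExtensions k G) : semifreeExtensions k (F ≫ G) := by
  obtain ⟨S⟩ := semifreeExtensions_iff.1 hF
  obtain ⟨T⟩ := semifreeExtensions_iff.1 hG
  exact semifreeExtensions_iff.2 ⟨S.comp T⟩

lemma exists_isAlgPushout (F : A ⟶ B) (G : A ⟶ C) (hF : semifreeExtensions k F) :
    ∃ (D : SemifreeDGAlg k) (G' : B ⟶ D) (F' : C ⟶ D),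
      IsAlgPushout F.hom G.hom G'.hom F'.hom ∧ semifreeExtensions k F' := by
  obtain ⟨S⟩ := semifreeExtensions_iff.1 hF
  obtain ⟨R⟩ := C.property
  obtain ⟨D, Q, G', F', T, h⟩ := S.exists_isAlgPushout G.hom R
  exact ⟨⟨D, ⟨Q⟩⟩, ObjectProperty.homMk G', ObjectProperty.homMk F', h,
    semifreeExtensions_iff.2 ⟨T⟩⟩

/-- Every pushout of a semifree extension in the category of semifree dg algebras is isomorphic to
the one obtained by attaching generators, and hence a pushout of algebras and a semifree
extension. -/
lemma isAlgPushout_and_cof_of_isPushout (h : IsPushout F G G' F') (hF : semifreeExtensions k F) :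
    IsAlgPushout F.hom G.hom G'.hom F'.hom ∧ semifreeExtensions k F' := by
  obtain ⟨D₀, G₀, F₀, h₀, hF₀⟩ := exists_isAlgPushout F G hF
  obtain ⟨e, e1, e2⟩ : ∃ e : D₀ ≅ D, G₀ ≫ e.hom = G' ∧ F₀ ≫ e.hom = F' :=
    ⟨h₀.isPushout.isoIsPushout _ _ h, h₀.isPushout.inl_isoIsPushout_hom _ _ h,
      h₀.isPushout.inr_isoIsPushout_hom _ _ h⟩
  have e3 : e.hom.hom ≫ e.inv.hom = 𝟙 _ := congrArg InducedCategory.Hom.hom e.hom_inv_id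
  have e4 : e.inv.hom ≫ e.hom.hom = 𝟙 _ := congrArg InducedCategory.Hom.hom e.inv_hom_id
  subst e1 e2
  refine ⟨⟨congrArg InducedCategory.Hom.hom h.w, ?_⟩,
    semifreeExtensions_comp _ _ hF₀ (semifreeExtensions_of_isIso _ inferInstance)⟩
  intro Z _ _ f g w
  obtain ⟨r, ⟨h1, h2⟩, h3⟩ := h₀.existsUnique Z f g w
  have e3' := DFunLike.congr_fun (congrArg DGAlg.toAlgHom e3)
  have e4' := DFunLike.congr_fun (congrArg DGAlg.toAlgHom e4)
  refine ⟨r.comp (DGAlg.toAlgHom e.inv.hom), ⟨?_, ?_⟩, ?_⟩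
  · rw [← h1]
    exact AlgHom.ext fun b => congrArg r (e3' _)
  · rw [← h2]
    exact AlgHom.ext fun b => congrArg r (e3' _)
  · rintro r' ⟨h1', h2'⟩
    rw [← h3 (r'.comp (DGAlg.toAlgHom e.hom.hom)) ⟨h1', h2'⟩]
    exact AlgHom.ext fun b => congrArg r' (e4' b).symm

lemma exists_isPushout (F : A ⟶ B) (G : A ⟶ C) (hF : semifreeExtensions k F) :
    ∃ (D : SemifreeDGAlg k) (G' : B ⟶ D) (F' : C ⟶ D),
      IsPushout F G G' F' ∧ semifreeExtensions k F' := by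
  obtain ⟨D, G', F', h, hF'⟩ := exists_isAlgPushout F G hF
  exact ⟨D, G', F', h.isPushout, hF'⟩

end Semifree

/-! ### The universal property of the cylinder -/

/-- A linear map of degree `-1` anticommutes with the sign involutions. -/
lemma DGAlg.sig_of_degree_neg_one {B Z : DGAlg k} {T : B.carrier →ₗ[k] Z.carrier}
    (h : ∀ {n : ℤ} {b : B.carrier}, b ∈ B.gr n → T b ∈ Z.gr (n - 1)) (b : B.carrier) :
    Z.sig (T b) = - T (B.sig b) := by
  induction b using B.homog_induction with
  | zero => simp
  | add a b ha hb => simp only [map_add, ha, hb]; abel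
  | homog n b hb => rw [B.sig_of_mem hb, Z.sig_of_mem (h hb), sgn_pred, map_smul, neg_smul]

/-- For a twisted derivation `T` of degree `-1`, the homotopy equation `d T - T d = g - f` (up to
signs) needs to be checked on generators only. -/
lemma IsDeriv.homotopy_of_adjoin {B Z : DGAlg k} {f g : B ⟶ Z} {T : B.carrier →ₗ[k] Z.carrier}
    (hT : IsDeriv (DGAlg.toAlgHom g) ((DGAlg.toAlgHom f).comp B.sig) T)
    (hsig : ∀ b, Z.sig (T b) = - T (B.sig b)) {S : Set B.carrier}
    (h : ∀ b ∈ S, Z.d (T b) = DGAlg.toAlgHom g (B.sig b) - DGAlg.toAlgHom f (B.sig b) + T (B.d b))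
    {b : B.carrier} (hb : b ∈ Algebra.adjoin k S) :
    Z.d (T b) = DGAlg.toAlgHom g (B.sig b) - DGAlg.toAlgHom f (B.sig b) + T (B.d b) := by
  induction hb using Algebra.adjoin_induction with
  | mem b hb => exact h b hb
  | algebraMap r =>
    rw [hT.map_algebraMap, Algebra.algebraMap_eq_smul_one]
    simp [Generators.d_one]
  | add a b _ _ ha hb => simp only [map_add, ha, hb]; abel
  | mul a b _ _ ha hb =>
    rw [hT a b, B.d_mul, map_add, map_add, hT, hT, Z.d_mul, Z.d_mul, ha, hb, hsig]
    simp only [AlgHom.comp_apply, map_mul, ← DGAlg.toAlgHom_d, DGAlg.sig_toAlgHom, DGAlg.d_sig,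
      map_neg, mul_add, mul_sub, add_mul, sub_mul, neg_mul, mul_neg, neg_neg]
    abel

namespace Generators

variable {A : DGAlg k} (P : Generators A)

/-- Twisted derivations with prescribed values on free generators exist. -/
lemma exists_deriv {Z : Type u} [Ring Z] [Algebra k Z] (φ ψ : A.carrier →ₐ[k] Z) (c : P.X → Z) :
    ∃ D : A.carrier →ₗ[k] Z, IsDeriv φ ψ D ∧ ∀ x, D (P.gen x) = c x := by
  let M : A.carrier →ₐ[k] Upper k Z :=
    (FreeAlgebra.lift k fun x => Upper.mk (φ (P.gen x)) (c x) (ψ (P.gen x))).comp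
      P.equiv.symm.toAlgHom
  have hM : ∀ x, M (P.gen x) = Upper.mk (φ (P.gen x)) (c x) (ψ (P.gen x)) := fun x => by
    simp [M]
  have h1 : Upper.fst.comp M = φ := P.algHom_ext fun x => by simp [hM]
  have h2 : Upper.snd.comp M = ψ := P.algHom_ext fun x => by simp [hM]
  refine ⟨Upper.off ∘ₗ M.toLinearMap, ?_, fun x => by simp [hM]⟩
  have := Upper.off_isDeriv.comp M
  rwa [h1, h2] at this

lemma deriv_mem {Z : DGAlg k} {f g : A ⟶ Z} {T : A.carrier →ₗ[k] Z.carrier}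
    (hT : IsDeriv (DGAlg.toAlgHom g) ((DGAlg.toAlgHom f).comp A.sig) T)
    (h : ∀ x, T (P.gen x) ∈ Z.gr (P.deg x - 1)) {n : ℤ} {a : A.carrier} (ha : a ∈ A.gr n) :
    T a ∈ Z.gr (n - 1) := by
  refine P.induction (motive := fun n a => T a ∈ Z.gr (n - 1)) ?_ ?_ ?_ ?_ ?_ ha
  · intro n; rw [map_zero]; exact Submodule.zero_mem _
  · intro n a b h h'; rw [map_add]; exact Submodule.add_mem _ h h'
  · intro n r a h; rw [map_smul]; exact Submodule.smul_mem _ _ h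
  · rw [hT.map_one]; exact Submodule.zero_mem _
  · intro x n a ha h'
    rw [hT]
    refine Submodule.add_mem _ ?_ ?_
    · have := SetLike.GradedMul.mul_mem (DGAlg.toAlgHom_mem g (P.gen_mem x)) h'
      rwa [← add_sub_assoc] at this
    · have := SetLike.GradedMul.mul_mem (h x) (DGAlg.toAlgHom_mem f (A.sig_mem ha))
      rwa [sub_add_eq_add_sub] at this

/-- The twisted derivation `θ ↦ t_θ` with values in the cylinder. -/
def T : A.carrier →ₗ[k] P.cyl.carrier := P.tmap

lemma T_isDeriv :
    IsDeriv (DGAlg.toAlgHom P.i₂) ((DGAlg.toAlgHom P.i₁).comp A.sig) P.T := fun a b => by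
  induction b using A.homog_induction with
  | zero => simp
  | add b b' h h' => simp only [mul_add, map_add, h, h']; abel
  | homog n b hb =>
    rw [AlgHom.comp_apply, A.sig_of_mem hb, map_smul, mul_smul_comm]
    exact P.tmap_mul a hb

lemma T_mem {n : ℤ} {a : A.carrier} (ha : a ∈ A.gr n) : P.T a ∈ P.cyl.gr (n - 1) := P.tmap_mem ha

lemma sig_T (a : A.carrier) : P.cyl.sig (P.T a) = - P.T (A.sig a) :=
  DGAlg.sig_of_degree_neg_one P.T_mem a

lemma d_T (a : A.carrier) : P.cyl.d (P.T a) =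
    DGAlg.toAlgHom P.i₂ (A.sig a) - DGAlg.toAlgHom P.i₁ (A.sig a) + P.T (A.d a) := by
  induction a using A.homog_induction with
  | zero => simp
  | add a b ha hb => simp only [map_add, ha, hb]; abel
  | homog n a ha =>
    rw [A.sig_of_mem ha, map_smul, map_smul, ← smul_sub]
    exact P.freeD_tmap ha

/-- The two inclusions into the cylinder agree on cohomology. -/
lemma cohomologyMap_i₁_eq_i₂ : DGAlg.cohomologyMap P.i₁ = DGAlg.cohomologyMap P.i₂ :=
  DGAlg.cohomologyMap_eq_of_homotopy P.T P.d_T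

lemma cyl_ext {Z : Type u} [Ring Z] [Algebra k Z] {φ ψ : P.cyl.carrier →ₐ[k] Z}
    (h1 : ∀ a, φ (DGAlg.toAlgHom P.i₁ a) = ψ (DGAlg.toAlgHom P.i₁ a))
    (h2 : ∀ a, φ (DGAlg.toAlgHom P.i₂ a) = ψ (DGAlg.toAlgHom P.i₂ a))
    (h3 : ∀ a, φ (P.T a) = ψ (P.T a)) : φ = ψ := by
  refine P.cyl_algHom_ext (φ := φ) (ψ := ψ) (fun x => ?_) (fun x => ?_) (fun x => ?_)
  · rw [← inc₁_gen]; exact h1 _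
  · rw [← inc₂_gen]; exact h2 _
  · rw [← tmap_gen]; exact h3 _

/-- Algebra maps out of the cylinder correspond to two algebra maps out of `A` and a twisted
derivation between them. In particular, the cylinder does not depend on the generators. -/
lemma exists_cylDesc {Z : Type u} [Ring Z] [Algebra k Z] {f₁ f₂ : A.carrier →ₐ[k] Z}
    {D : A.carrier →ₗ[k] Z} (hD : IsDeriv f₂ (f₁.comp A.sig) D) :
    ∃ γ : P.cyl.carrier →ₐ[k] Z, γ.comp (DGAlg.toAlgHom P.i₁) = f₁ ∧
      γ.comp (DGAlg.toAlgHom P.i₂) = f₂ ∧ ∀ a, γ (P.T a) = D a := by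
  let γ : FreeAlgebra k P.CylX →ₐ[k] Z :=
    FreeAlgebra.lift k fun y => ![f₁ (P.gen y.1), f₂ (P.gen y.1), D (P.gen y.1)] y.2
  have e1 : γ.comp P.inc₁ = f₁ := P.algHom_ext fun x => by
    simp [γ, g₁]
  have e2 : γ.comp P.inc₂ = f₂ := P.algHom_ext fun x => by
    simp [γ, g₂]
  refine ⟨γ, e1, e2, fun a => ?_⟩
  have h : IsDeriv f₂ (f₁.comp A.sig) (γ.toLinearMap ∘ₗ P.tmap) := by
    rw [← e1, ← e2]
    exact P.T_isDeriv.postcomp (Z' := Z) γ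
  refine LinearMap.congr_fun (h.ext hD P.adjoin_eq_top ?_) a
  rintro _ ⟨x, rfl⟩
  change γ (P.tmap (P.gen x)) = D (P.gen x)
  simp [γ, gt]

/-- Morphisms out of the cylinder from homotopies. -/
lemma exists_cylHom {Z : DGAlg k} {f₁ f₂ : A ⟶ Z} {D : A.carrier →ₗ[k] Z.carrier}
    (hD : IsDeriv (DGAlg.toAlgHom f₂) ((DGAlg.toAlgHom f₁).comp A.sig) D)
    (hmem : ∀ {n : ℤ} {a : A.carrier}, a ∈ A.gr n → D a ∈ Z.gr (n - 1))
    (hd : ∀ a, Z.d (D a) =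
      DGAlg.toAlgHom f₂ (A.sig a) - DGAlg.toAlgHom f₁ (A.sig a) + D (A.d a)) :
    ∃ γ : P.cyl ⟶ Z, P.i₁ ≫ γ = f₁ ∧ P.i₂ ≫ γ = f₂ ∧ ∀ a, DGAlg.toAlgHom γ (P.T a) = D a := by
  obtain ⟨γ, h1, h2, h3⟩ := P.exists_cylDesc hD
  have e1 : ∀ a, γ (DGAlg.toAlgHom P.i₁ a) = DGAlg.toAlgHom f₁ a := DFunLike.congr_fun h1
  have e2 : ∀ a, γ (DGAlg.toAlgHom P.i₂ a) = DGAlg.toAlgHom f₂ a := DFunLike.congr_fun h2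
  have g1 : ∀ x, (P.cylGenerators).gen (x, 0) = DGAlg.toAlgHom P.i₁ (P.gen x) := fun x =>
    (P.inc₁_gen x).symm
  have g2 : ∀ x, (P.cylGenerators).gen (x, 1) = DGAlg.toAlgHom P.i₂ (P.gen x) := fun x =>
    (P.inc₂_gen x).symm
  have g3 : ∀ x, (P.cylGenerators).gen (x, 2) = P.T (P.gen x) := fun x =>
    (P.tmap_gen x).symm
  refine ⟨DGAlg.homOfAdjoin γ P.cylGenerators.adjoin_eq_top ?_ ?_, DGAlg.hom_ext h1,
    DGAlg.hom_ext h2, h3⟩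
  · rintro _ ⟨⟨x, j⟩, rfl⟩
    refine ⟨_, P.cylGenerators.gen_mem _, ?_⟩
    fin_cases j
    · exact (congrArg γ (g1 x)).trans (e1 _) ▸ DGAlg.toAlgHom_mem f₁ (P.gen_mem x)
    · exact (congrArg γ (g2 x)).trans (e2 _) ▸ DGAlg.toAlgHom_mem f₂ (P.gen_mem x)
    · exact (congrArg γ (g3 x)).trans (h3 _) ▸ hmem (P.gen_mem x)
  · rintro _ ⟨⟨x, j⟩, rfl⟩
    fin_cases j
    · change γ (P.cyl.d (P.cylGenerators.gen (x, 0))) = Z.d (γ (P.cylGenerators.gen (x, 0)))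
      rw [g1, ← DGAlg.toAlgHom_d, e1, e1, DGAlg.toAlgHom_d]
    · change γ (P.cyl.d (P.cylGenerators.gen (x, 1))) = Z.d (γ (P.cylGenerators.gen (x, 1)))
      rw [g2, ← DGAlg.toAlgHom_d, e2, e2, DGAlg.toAlgHom_d]
    · change γ (P.cyl.d (P.cylGenerators.gen (x, 2))) = Z.d (γ (P.cylGenerators.gen (x, 2)))
      rw [g3, d_T, map_add, map_sub, e1, e2, h3, h3, hd]

section Map

variable {B : DGAlg k} (Q : Generators B) (F : A ⟶ B)

lemma cylMap_i₁ (a : A.carrier) : DGAlg.toAlgHom (P.cylMap Q F) (DGAlg.toAlgHom P.i₁ a) =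
    DGAlg.toAlgHom Q.i₁ (DGAlg.toAlgHom F a) := P.cylMapHom_inc₁ Q F a

lemma cylMap_i₂ (a : A.carrier) : DGAlg.toAlgHom (P.cylMap Q F) (DGAlg.toAlgHom P.i₂ a) =
    DGAlg.toAlgHom Q.i₂ (DGAlg.toAlgHom F a) := P.cylMapHom_inc₂ Q F a

lemma cylMap_T (a : A.carrier) : DGAlg.toAlgHom (P.cylMap Q F) (P.T a) =
    Q.T (DGAlg.toAlgHom F a) := P.cylMapHom_tmap Q F a

end Map

/-! ### The projection of the cylinder is a quasi-equivalence -/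

lemma proj_i₁ (a : A.carrier) : DGAlg.toAlgHom P.proj (DGAlg.toAlgHom P.i₁ a) = a :=
  P.projHom_inc₁ a

lemma proj_i₂ (a : A.carrier) : DGAlg.toAlgHom P.proj (DGAlg.toAlgHom P.i₂ a) = a :=
  P.projHom_inc₂ a

lemma proj_T (a : A.carrier) : DGAlg.toAlgHom P.proj (P.T a) = 0 :=
  P.projHom_tmap a

lemma i₁_proj : P.i₁ ≫ P.proj = 𝟙 A := DGAlg.hom_ext (AlgHom.ext P.proj_i₁)

lemma i₂_proj : P.i₂ ≫ P.proj = 𝟙 A := DGAlg.hom_ext (AlgHom.ext P.proj_i₂)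

lemma adjoin_cyl_eq_top : Algebra.adjoin k (Set.range (DGAlg.toAlgHom P.i₁) ∪
    Set.range (DGAlg.toAlgHom P.i₂) ∪ Set.range P.T) = ⊤ := by
  rw [← top_le_iff, ← P.cylGenerators.adjoin_eq_top]
  refine Algebra.adjoin_mono ?_
  rintro _ ⟨⟨x, j⟩, rfl⟩
  fin_cases j
  · exact Or.inl (Or.inl ⟨P.gen x, P.inc₁_gen x⟩)
  · exact Or.inl (Or.inr ⟨P.gen x, P.inc₂_gen x⟩)
  · exact Or.inr ⟨P.gen x, P.tmap_gen x⟩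

/-- A twisted derivation on the cylinder with prescribed values on the generators. -/
lemma exists_cyl_deriv {Z : DGAlg k} (f g : P.cyl ⟶ Z) (c₁ c₂ c₃ : P.X → Z.carrier)
    (h₁ : ∀ x, c₁ x ∈ Z.gr (P.deg x - 1)) (h₂ : ∀ x, c₂ x ∈ Z.gr (P.deg x - 1))
    (h₃ : ∀ x, c₃ x ∈ Z.gr (P.deg x - 1 - 1)) :
    ∃ D : P.cyl.carrier →ₗ[k] Z.carrier,
      IsDeriv (DGAlg.toAlgHom g) ((DGAlg.toAlgHom f).comp P.cyl.sig) D ∧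
      (∀ {n : ℤ} {a : P.cyl.carrier}, a ∈ P.cyl.gr n → D a ∈ Z.gr (n - 1)) ∧
      (∀ x, D (DGAlg.toAlgHom P.i₁ (P.gen x)) = c₁ x) ∧
      (∀ x, D (DGAlg.toAlgHom P.i₂ (P.gen x)) = c₂ x) ∧ ∀ x, D (P.T (P.gen x)) = c₃ x := by
  obtain ⟨D, hD, hc⟩ := P.cylGenerators.exists_deriv (DGAlg.toAlgHom g)
    ((DGAlg.toAlgHom f).comp P.cyl.sig) (fun y : P.CylX => ![c₁ y.1, c₂ y.1, c₃ y.1] y.2)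
  have e1 : ∀ x, D (DGAlg.toAlgHom P.i₁ (P.gen x)) = c₁ x := fun x =>
    (congrArg D (P.inc₁_gen x)).trans (hc (x, 0))
  have e2 : ∀ x, D (DGAlg.toAlgHom P.i₂ (P.gen x)) = c₂ x := fun x =>
    (congrArg D (P.inc₂_gen x)).trans (hc (x, 1))
  have e3 : ∀ x, D (P.T (P.gen x)) = c₃ x := fun x =>
    (congrArg D (P.tmap_gen x)).trans (hc (x, 2))
  refine ⟨D, hD, fun ha => P.cylGenerators.deriv_mem hD ?_ ha, e1, e2, e3⟩
  rintro ⟨x, j⟩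
  refine Set.mem_of_eq_of_mem (s := (Z.gr _ : Set Z.carrier)) (hc (x, j)) ?_
  fin_cases j
  · exact h₁ x
  · exact h₂ x
  · exact h₃ x

/-- The projection of the cylinder is a quasi-equivalence: the twisted derivation with
`x¹ ↦ 0`, `x² ↦ t_x` and `t_x ↦ 0` is a homotopy from `i₁ p` to the identity. -/
lemma proj_isQuasiEquivalence : DGAlg.IsQuasiEquivalence P.proj := by
  obtain ⟨D, hD, hmem, h1, h2, h3⟩ := P.exists_cyl_deriv (P.proj ≫ P.i₁) (𝟙 P.cyl)
    (fun _ => 0) (fun x => P.T (P.gen x)) (fun _ => 0) (fun _ => Submodule.zero_mem _)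
    (fun x => P.T_mem (P.gen_mem x)) (fun _ => Submodule.zero_mem _)
  have e1 : ∀ a, D (DGAlg.toAlgHom P.i₁ a) = 0 := by
    have h0 : IsDeriv ((DGAlg.toAlgHom (𝟙 P.cyl)).comp (DGAlg.toAlgHom P.i₁))
        (((DGAlg.toAlgHom (P.proj ≫ P.i₁)).comp P.cyl.sig).comp (DGAlg.toAlgHom P.i₁)) 0 :=
      fun a b => by simp
    refine LinearMap.congr_fun ((hD.comp (DGAlg.toAlgHom P.i₁)).ext h0 P.adjoin_eq_top ?_)
    rintro _ ⟨x, rfl⟩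
    exact h1 x
  have e2 : ∀ a, D (DGAlg.toAlgHom P.i₂ a) = P.T a := by
    have h := hD.comp (DGAlg.toAlgHom P.i₂)
    have e : ((DGAlg.toAlgHom (P.proj ≫ P.i₁)).comp P.cyl.sig).comp (DGAlg.toAlgHom P.i₂) =
        (DGAlg.toAlgHom P.i₁).comp A.sig := AlgHom.ext fun a => by
      simp [DGAlg.sig_toAlgHom, proj_i₂]
    rw [e] at h
    refine LinearMap.congr_fun (h.ext P.T_isDeriv P.adjoin_eq_top ?_)
    rintro _ ⟨x, rfl⟩
    exact h2 x
  have e3 : ∀ a, D (P.T a) = 0 := by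
    intro a
    have ha : a ∈ Algebra.adjoin k (Set.range P.gen) := P.adjoin_eq_top ▸ Algebra.mem_top
    induction ha using Algebra.adjoin_induction with
    | mem a ha => obtain ⟨x, rfl⟩ := ha; exact h3 x
    | algebraMap r => rw [P.T_isDeriv.map_algebraMap, map_zero]
    | add a b _ _ ha hb => rw [map_add, map_add, ha, hb, add_zero]
    | mul a b _ _ ha hb =>
      rw [P.T_isDeriv, map_add, hD, hD, ha, hb, e2, AlgHom.comp_apply, AlgHom.comp_apply,
        AlgHom.comp_apply, sig_T, e1, DGAlg.toAlgHom_comp, AlgHom.comp_apply, map_neg, proj_T]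
      simp
  have hd : ∀ b, P.cyl.d (D b) = DGAlg.toAlgHom (𝟙 P.cyl) (P.cyl.sig b) -
      DGAlg.toAlgHom (P.proj ≫ P.i₁) (P.cyl.sig b) + D (P.cyl.d b) := by
    intro b
    refine hD.homotopy_of_adjoin (DGAlg.sig_of_degree_neg_one hmem) ?_
      (P.adjoin_cyl_eq_top ▸ Algebra.mem_top : b ∈ _)
    rintro _ ((⟨a, rfl⟩ | ⟨a, rfl⟩) | ⟨a, rfl⟩)
    · rw [← DGAlg.toAlgHom_d, e1, e1]
      simp [DGAlg.sig_toAlgHom, proj_i₁]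
    · rw [← DGAlg.toAlgHom_d, e2, e2, d_T]
      simp [DGAlg.sig_toAlgHom, proj_i₂]
    · rw [d_T, map_add, map_sub, e3, e3, e1, e2, sig_T]
      simp [proj_T]
  refine DGAlg.IsQuasiEquivalence.of_inverse (g := P.i₁)
    (DGAlg.cohomologyMap_eq_of_homotopy D hd) ?_
  rw [i₁_proj]

/-! ### The interchange -/

/-- The interchange of the two cylinder coordinates, which fixes the four copies of a generator `x`,
exchanges `t_x^r` and `t_{x^r}`, and changes the sign of `t_{t_x}`. -/
lemma exists_interchange (Q : Generators P.cyl) :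
    ∃ γ : Q.cyl ⟶ Q.cyl, (Q.i₁ ≫ γ = P.cylMap Q P.i₁ ∧ P.cylMap Q P.i₁ ≫ γ = Q.i₁) ∧
      (Q.i₂ ≫ γ = P.cylMap Q P.i₂ ∧ P.cylMap Q P.i₂ ≫ γ = Q.i₂) := by
  obtain ⟨D, hD, hmem, h1, h2, h3⟩ := P.exists_cyl_deriv (P.cylMap Q P.i₁) (P.cylMap Q P.i₂)
    (fun x => DGAlg.toAlgHom Q.i₁ (P.T (P.gen x))) (fun x => DGAlg.toAlgHom Q.i₂ (P.T (P.gen x)))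
    (fun x => - Q.T (P.T (P.gen x))) (fun x => DGAlg.toAlgHom_mem _ (P.T_mem (P.gen_mem x)))
    (fun x => DGAlg.toAlgHom_mem _ (P.T_mem (P.gen_mem x)))
    (fun x => Submodule.neg_mem _ (Q.T_mem (P.T_mem (P.gen_mem x))))
  have e1 : ∀ a, D (DGAlg.toAlgHom P.i₁ a) = DGAlg.toAlgHom Q.i₁ (P.T a) := by
    have h := hD.comp (DGAlg.toAlgHom P.i₁)
    have h' := P.T_isDeriv.postcomp (DGAlg.toAlgHom Q.i₁)
    have e : (DGAlg.toAlgHom (P.cylMap Q P.i₂)).comp (DGAlg.toAlgHom P.i₁) =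
        (DGAlg.toAlgHom Q.i₁).comp (DGAlg.toAlgHom P.i₂) := AlgHom.ext fun a => by
      simp [cylMap_i₁]
    have e' : ((DGAlg.toAlgHom (P.cylMap Q P.i₁)).comp P.cyl.sig).comp (DGAlg.toAlgHom P.i₁) =
        (DGAlg.toAlgHom Q.i₁).comp ((DGAlg.toAlgHom P.i₁).comp A.sig) := AlgHom.ext fun a => by
      simp [DGAlg.sig_toAlgHom, cylMap_i₁]
    rw [e, e'] at h
    refine LinearMap.congr_fun (h.ext h' P.adjoin_eq_top ?_)
    rintro _ ⟨x, rfl⟩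
    exact h1 x
  have e2 : ∀ a, D (DGAlg.toAlgHom P.i₂ a) = DGAlg.toAlgHom Q.i₂ (P.T a) := by
    have h := hD.comp (DGAlg.toAlgHom P.i₂)
    have h' := P.T_isDeriv.postcomp (DGAlg.toAlgHom Q.i₂)
    have e : (DGAlg.toAlgHom (P.cylMap Q P.i₂)).comp (DGAlg.toAlgHom P.i₂) =
        (DGAlg.toAlgHom Q.i₂).comp (DGAlg.toAlgHom P.i₂) := AlgHom.ext fun a => by
      simp [cylMap_i₂]
    have e' : ((DGAlg.toAlgHom (P.cylMap Q P.i₁)).comp P.cyl.sig).comp (DGAlg.toAlgHom P.i₂) =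
        (DGAlg.toAlgHom Q.i₂).comp ((DGAlg.toAlgHom P.i₁).comp A.sig) := AlgHom.ext fun a => by
      simp [DGAlg.sig_toAlgHom, cylMap_i₂]
    rw [e, e'] at h
    refine LinearMap.congr_fun (h.ext h' P.adjoin_eq_top ?_)
    rintro _ ⟨x, rfl⟩
    exact h2 x
  have e3 : ∀ a, D (P.T a) = - Q.T (P.T a) := by
    intro a
    have ha : a ∈ Algebra.adjoin k (Set.range P.gen) := P.adjoin_eq_top ▸ Algebra.mem_top
    induction ha using Algebra.adjoin_induction with
    | mem a ha => obtain ⟨x, rfl⟩ := ha; exact h3 x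
    | algebraMap r => rw [P.T_isDeriv.map_algebraMap, map_zero, map_zero, neg_zero]
    | add a b _ _ ha hb => simp only [map_add, ha, hb]; abel
    | mul a b _ _ ha hb =>
      rw [P.T_isDeriv, map_add, map_add, hD, hD, Q.T_isDeriv, Q.T_isDeriv, ha, hb]
      simp only [AlgHom.comp_apply, e1, e2, sig_T, cylMap_T, cylMap_i₁, cylMap_i₂,
        DGAlg.sig_toAlgHom, map_neg, DGAlg.sig_sig]
      simp only [mul_neg, neg_mul]
      abel
  have hd : ∀ b, Q.cyl.d (D b) = DGAlg.toAlgHom (P.cylMap Q P.i₂) (P.cyl.sig b) -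
      DGAlg.toAlgHom (P.cylMap Q P.i₁) (P.cyl.sig b) + D (P.cyl.d b) := by
    intro b
    refine hD.homotopy_of_adjoin (DGAlg.sig_of_degree_neg_one hmem) ?_
      (P.adjoin_cyl_eq_top ▸ Algebra.mem_top : b ∈ _)
    rintro _ ((⟨a, rfl⟩ | ⟨a, rfl⟩) | ⟨a, rfl⟩)
    · rw [← DGAlg.toAlgHom_d, e1, e1, ← DGAlg.toAlgHom_d, d_T]
      simp [DGAlg.sig_toAlgHom, cylMap_i₁]
    · rw [← DGAlg.toAlgHom_d, e2, e2, ← DGAlg.toAlgHom_d, d_T]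
      simp [DGAlg.sig_toAlgHom, cylMap_i₂]
    · rw [d_T, e3]
      simp only [map_add, map_sub, map_neg, d_T, e1, e2, e3, sig_T, cylMap_T]
      abel
  obtain ⟨γ, g1, g2, g3⟩ := Q.exists_cylHom hD hmem hd
  have g1' : ∀ a, DGAlg.toAlgHom γ (DGAlg.toAlgHom Q.i₁ a) = DGAlg.toAlgHom (P.cylMap Q P.i₁) a :=
    DFunLike.congr_fun (congrArg DGAlg.toAlgHom g1)
  have g2' : ∀ a, DGAlg.toAlgHom γ (DGAlg.toAlgHom Q.i₂ a) = DGAlg.toAlgHom (P.cylMap Q P.i₂) a :=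
    DFunLike.congr_fun (congrArg DGAlg.toAlgHom g2)
  refine ⟨γ, ⟨g1, DGAlg.hom_ext (P.cyl_ext (fun a => ?_) (fun a => ?_) fun a => ?_)⟩,
    g2, DGAlg.hom_ext (P.cyl_ext (fun a => ?_) (fun a => ?_) fun a => ?_)⟩ <;>
  simp only [DGAlg.toAlgHom_comp, AlgHom.comp_apply, cylMap_i₁, cylMap_i₂, cylMap_T, g1', g2', g3,
    e1, e2]

end Generators

/-! ### The cylinder preserves pushouts -/

lemma IsAlgPushout.cylMap {A B C D : DGAlg k} {F : A ⟶ B} {G : A ⟶ C} {G' : B ⟶ D} {F' : C ⟶ D}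
    (h : IsAlgPushout F G G' F') (P : Generators A) (Q : Generators B) (R : Generators C)
    (S : Generators D) :
    IsAlgPushout (P.cylMap Q F) (P.cylMap R G) (Q.cylMap S G') (R.cylMap S F') := by
  have hw : ∀ a, DGAlg.toAlgHom G' (DGAlg.toAlgHom F a) = DGAlg.toAlgHom F' (DGAlg.toAlgHom G a) :=
    DFunLike.congr_fun (congrArg DGAlg.toAlgHom h.w)
  refine ⟨DGAlg.hom_ext (P.cyl_ext (fun a => ?_) (fun a => ?_) fun a => ?_), ?_⟩
  · simp [Generators.cylMap_i₁, hw]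
  · simp [Generators.cylMap_i₂, hw]
  · simp [Generators.cylMap_T, hw]
  intro Z _ _ f g e
  have e : ∀ u, f (DGAlg.toAlgHom (P.cylMap Q F) u) = g (DGAlg.toAlgHom (P.cylMap R G) u) :=
    DFunLike.congr_fun e
  obtain ⟨f₁, ⟨h1, h1'⟩, u1⟩ := h.existsUnique Z (f.comp (DGAlg.toAlgHom Q.i₁))
    (g.comp (DGAlg.toAlgHom R.i₁)) (AlgHom.ext fun a => by
      simpa [Generators.cylMap_i₁] using e (DGAlg.toAlgHom P.i₁ a))
  obtain ⟨f₂, ⟨h2, h2'⟩, u2⟩ := h.existsUnique Z (f.comp (DGAlg.toAlgHom Q.i₂))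
    (g.comp (DGAlg.toAlgHom R.i₂)) (AlgHom.ext fun a => by
      simpa [Generators.cylMap_i₂] using e (DGAlg.toAlgHom P.i₂ a))
  have hT := Q.T_isDeriv.postcomp f
  have hU := R.T_isDeriv.postcomp g
  have q1 : f.comp ((DGAlg.toAlgHom Q.i₁).comp B.sig) =
      (f₁.comp D.sig).comp (DGAlg.toAlgHom G') := AlgHom.ext fun b => by
    have := DFunLike.congr_fun h1 (B.sig b)
    simp only [AlgHom.comp_apply, DGAlg.sig_toAlgHom] at this ⊢
    exact this.symm
  have q2 : g.comp ((DGAlg.toAlgHom R.i₁).comp C.sig) =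
      (f₁.comp D.sig).comp (DGAlg.toAlgHom F') := AlgHom.ext fun b => by
    have := DFunLike.congr_fun h1' (C.sig b)
    simp only [AlgHom.comp_apply, DGAlg.sig_toAlgHom] at this ⊢
    exact this.symm
  rw [← h2, q1] at hT
  rw [← h2', q2] at hU
  obtain ⟨E, hE, hE1, hE2⟩ := h.exists_deriv f₂ (f₁.comp D.sig) hT hU
    (LinearMap.ext fun a => by simpa [Generators.cylMap_T] using e (P.T a))
  obtain ⟨γ, g1, g2, g3⟩ := S.exists_cylDesc hE
  have g1' : ∀ d, γ (DGAlg.toAlgHom S.i₁ d) = f₁ d := DFunLike.congr_fun g1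
  have g2' : ∀ d, γ (DGAlg.toAlgHom S.i₂ d) = f₂ d := DFunLike.congr_fun g2
  refine ⟨γ, ⟨Q.cyl_ext (fun b => ?_) (fun b => ?_) fun b => ?_,
    R.cyl_ext (fun b => ?_) (fun b => ?_) fun b => ?_⟩, ?_⟩
  · simpa [Generators.cylMap_i₁, g1'] using DFunLike.congr_fun h1 b
  · simpa [Generators.cylMap_i₂, g2'] using DFunLike.congr_fun h2 b
  · simpa [Generators.cylMap_T, g3] using hE1 b
  · simpa [Generators.cylMap_i₁, g1'] using DFunLike.congr_fun h1' b
  · simpa [Generators.cylMap_i₂, g2'] using DFunLike.congr_fun h2' b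
  · simpa [Generators.cylMap_T, g3] using hE2 b
  · rintro γ' ⟨r1, r2⟩
    have r1' : ∀ b, γ' (DGAlg.toAlgHom (Q.cylMap S G') b) = f b := DFunLike.congr_fun r1
    have r2' : ∀ b, γ' (DGAlg.toAlgHom (R.cylMap S F') b) = g b := DFunLike.congr_fun r2
    have s1 : γ'.comp (DGAlg.toAlgHom S.i₁) = f₁ := u1 _
      ⟨AlgHom.ext fun b => by simpa [Generators.cylMap_i₁] using r1' (DGAlg.toAlgHom Q.i₁ b),
        AlgHom.ext fun b => by simpa [Generators.cylMap_i₁] using r2' (DGAlg.toAlgHom R.i₁ b)⟩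
    have s2 : γ'.comp (DGAlg.toAlgHom S.i₂) = f₂ := u2 _
      ⟨AlgHom.ext fun b => by simpa [Generators.cylMap_i₂] using r1' (DGAlg.toAlgHom Q.i₂ b),
        AlgHom.ext fun b => by simpa [Generators.cylMap_i₂] using r2' (DGAlg.toAlgHom R.i₂ b)⟩
    have hT' := S.T_isDeriv.postcomp γ'
    rw [← AlgHom.comp_assoc, s1, s2] at hT'
    refine S.cyl_ext (fun d => ?_) (fun d => ?_) fun d => ?_
    · exact (DFunLike.congr_fun s1 d).trans (g1' d).symm
    · exact (DFunLike.congr_fun s2 d).trans (g2' d).symm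
    · rw [g3]
      refine LinearMap.congr_fun (hT'.ext hE h.adjoin_eq_top ?_) d
      rintro _ (⟨b, rfl⟩ | ⟨c, rfl⟩)
      · rw [hE1]
        simpa [Generators.cylMap_T] using r1' (Q.T b)
      · rw [hE2]
        simpa [Generators.cylMap_T] using r2' (R.T c)

/-! ### Lifting against surjective quasi-equivalences -/

namespace RelGenerators

variable {A B : DGAlg k} {F : A ⟶ B} (S : RelGenerators F)

lemma desc_congr {C : Type u} [Ring C] [Algebra k C] (f : A.carrier →ₐ[k] C) {c c' : S.X → C}
    {x : S.X} (h : ∀ y, S.lt y x → c y = c' y) : S.desc f c (B.d (S.s x)) =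
      S.desc f c' (B.d (S.s x)) := by
  change _ ∈ AlgHom.equalizer (S.desc f c) (S.desc f c')
  refine Algebra.adjoin_le ?_ (S.d_s x)
  rintro _ (⟨a, rfl⟩ | ⟨y, hy, rfl⟩)
  · change S.desc f c _ = S.desc f c' _
    rw [desc_apply, desc_apply]
  · change S.desc f c _ = S.desc f c' _
    rw [desc_s, desc_s, h y hy]

include S in
/-- Semifree extensions have the left lifting property with respect to surjective
quasi-equivalences: the lift is constructed by well-founded recursion on the generators. -/
lemma exists_lift {Y Z : DGAlg k} {q : Y ⟶ Z} (hq : DGAlg.IsQuasiEquivalence q)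
    (hs : Function.Surjective (DGAlg.toAlgHom q)) (f : A ⟶ Y) (g : B ⟶ Z) (w : F ≫ g = f ≫ q) :
    ∃ h : B ⟶ Y, F ≫ h = f ∧ h ≫ q = g := by
  classical
  have hw : ∀ a, DGAlg.toAlgHom g (DGAlg.toAlgHom F a) = DGAlg.toAlgHom q (DGAlg.toAlgHom f a) :=
    DFunLike.congr_fun (congrArg DGAlg.toAlgHom w)
  let φ := S.desc (DGAlg.toAlgHom f)
  let good (c : S.X → Y.carrier) (x : S.X) (v : Y.carrier) : Prop :=
    v ∈ Y.gr (S.deg x) ∧ Y.d v = φ c (B.d (S.s x)) ∧ DGAlg.toAlgHom q v = DGAlg.toAlgHom g (S.s x)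
  let step (x : S.X) (c : (y : S.X) → S.lt y x → Y.carrier) : Y.carrier :=
    let c' : S.X → Y.carrier := fun y => if h : S.lt y x then c y h else 0
    if h : ∃ v, good c' x v then h.choose else 0
  let wf : WellFounded S.lt := IsWellFounded.wf
  let c : S.X → Y.carrier := wf.fix step
  have hc : ∀ x, good c x (c x) := by
    intro x
    induction x using wf.induction with
    | h x ih =>
    let c' : S.X → Y.carrier := fun y => if _ : S.lt y x then c y else 0
    have hcc : φ c' (B.d (S.s x)) = φ c (B.d (S.s x)) :=
      S.desc_congr _ fun y hy => by simp only [c', dif_pos hy]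
    suffices h : ∃ v, good c' x v by
      have e : c x = h.choose := by
        have : c x = step x fun y _ => c y := wf.fix_eq step x
        rw [this]
        exact dif_pos h
      obtain ⟨h1, h2, h3⟩ := h.choose_spec
      rw [← e] at h1 h2 h3
      exact ⟨h1, h2.trans hcc, h3⟩
    have hd := S.d_s x
    have hS : ∀ b ∈ DGAlg.homImage F ∪ S.s '' {y | S.lt y x},
        ∃ n, b ∈ B.gr n ∧ φ c b ∈ Y.gr n := by
      rintro _ (⟨n, a, ha, rfl⟩ | ⟨y, hy, rfl⟩)
      · exact ⟨n, DGAlg.toAlgHom_mem F ha, by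
          simp only [φ, S.desc_apply]; exact DGAlg.toAlgHom_mem f ha⟩
      · exact ⟨_, S.s_mem y, by simp only [φ, S.desc_s]; exact (ih y hy).1⟩
    have hSd : ∀ b ∈ DGAlg.homImage F ∪ S.s '' {y | S.lt y x},
        φ c (B.d b) = Y.d (φ c b) := by
      rintro _ (⟨n, a, ha, rfl⟩ | ⟨y, hy, rfl⟩)
      · simp only [φ, ← DGAlg.toAlgHom_d, S.desc_apply]
      · rw [← (ih y hy).2.1]
        simp only [φ, S.desc_s]
    have hq' : DGAlg.toAlgHom q (φ c (B.d (S.s x))) = DGAlg.toAlgHom g (B.d (S.s x)) := by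
      change B.d (S.s x) ∈ AlgHom.equalizer ((DGAlg.toAlgHom q).comp (φ c)) (DGAlg.toAlgHom g)
      refine Algebra.adjoin_le ?_ hd
      rintro _ (⟨a, rfl⟩ | ⟨y, hy, rfl⟩)
      · change DGAlg.toAlgHom q (φ c _) = DGAlg.toAlgHom g _
        simp only [φ, S.desc_apply, hw]
      · change DGAlg.toAlgHom q (φ c _) = DGAlg.toAlgHom g _
        simp only [φ, S.desc_s]
        exact (ih y hy).2.2
    rw [← adjoin_lower_homImage] at hd
    obtain ⟨v, h1, h2, h3⟩ := hq.exists_lift hs (y := φ c (B.d (S.s x)))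
      (z := DGAlg.toAlgHom g (S.s x)) (DGAlg.map_mem_of_adjoin hS hd (B.d_mem (S.s_mem x)))
      (by rw [← DGAlg.map_d_of_adjoin hS hSd hd, B.d_d, map_zero])
      (DGAlg.toAlgHom_mem g (S.s_mem x)) (by rw [hq', DGAlg.toAlgHom_d])
    exact ⟨v, h1, h2.trans hcc.symm, h3⟩
  let h := S.homDesc f c (fun x => (hc x).1) (fun x => (hc x).2.1.symm)
  refine ⟨h, S.comp_homDesc _ _ _ _, S.hom_ext ?_ fun x => ?_⟩
  · rw [← Category.assoc, S.comp_homDesc, w]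
  · rw [DGAlg.toAlgHom_comp, AlgHom.comp_apply, S.homDesc_s, (hc x).2.2]

end RelGenerators

/-! ### Attaching disks -/

namespace Generators

variable {A : DGAlg k} (P : Generators A) {W : Type u} (deg : W → ℤ)

/-- The degrees of the generators `z = (w, 0)` and `y = (w, 1)` of the disks, with `d y = z`. -/
def diskDeg (v : W × Fin 2) : ℤ := ![deg v.1 + 1, deg v.1] v.2

/-- The differentials of the generators of the disks. -/
def diskδ (v : W × Fin 2) : FreeAlgebra k (P.X ⊕ W × Fin 2) :=
  ![0, FreeAlgebra.ι k (Sum.inr (v.1, 0))] v.2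

/-- An arbitrary well-order on the set of disks, with `z` before `y`. -/
def diskLt : W × Fin 2 → W × Fin 2 → Prop := Prod.Lex WellOrderingRel (· < ·)

instance : IsWellOrder (W × Fin 2) diskLt :=
  inferInstanceAs (IsWellOrder (W × Fin 2) (Prod.Lex WellOrderingRel (· < ·)))

lemma diskδ_mem (v : W × Fin 2) :
    P.diskδ v ∈ freeGr (k := k) (P.attachDeg (diskDeg deg)) (diskDeg deg v + 1) := by
  obtain ⟨w, j⟩ := v
  fin_cases j
  · exact Submodule.zero_mem _
  · exact ι_mem_freeGr (P.attachDeg (diskDeg deg)) (Sum.inr (w, 0))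

lemma freeD_diskδ (v : W × Fin 2) :
    freeD (P.attachDeg (diskDeg deg)) (P.attachδ P.diskδ) (P.diskδ v) = 0 := by
  obtain ⟨w, j⟩ := v
  fin_cases j
  · exact map_zero _
  · exact freeD_ι _ _ _

lemma diskδ_mem_adjoin (v : W × Fin 2) : P.diskδ v ∈ Algebra.adjoin k
    (Set.range (P.attachInc (W × Fin 2)) ∪
      (fun w => FreeAlgebra.ι k (Sum.inr w)) '' {w | diskLt w v}) := by
  obtain ⟨w, j⟩ := v
  fin_cases j
  · exact Subalgebra.zero_mem _
  · exact Algebra.subset_adjoin (Or.inr ⟨(w, 0), Prod.Lex.right _ (by decide), rfl⟩)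

/-- The dg algebra obtained from `A` by freely adjoining elements `y w` of degree `deg w` and their
differentials, that is, by attaching acyclic disks. -/
def disk : DGAlg k := P.attach (diskDeg deg) P.diskδ (P.diskδ_mem deg) (P.freeD_diskδ deg)

/-- The inclusion of `A`. -/
def diskι : A ⟶ P.disk deg :=
  P.attachι (diskDeg deg) P.diskδ (P.diskδ_mem deg) (P.freeD_diskδ deg)

/-- Attaching disks to a semifree dg algebra gives a semifree dg algebra. -/
def diskGenerators : Generators (P.disk deg) :=
  P.attachGenerators (diskDeg deg) P.diskδ diskLt (P.diskδ_mem deg) (P.freeD_diskδ deg)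
    P.diskδ_mem_adjoin

/-- Attaching disks is a semifree extension. -/
def diskRel : RelGenerators (P.diskι deg) :=
  P.attachRel (diskDeg deg) P.diskδ diskLt (P.diskδ_mem deg) (P.freeD_diskδ deg)
    P.diskδ_mem_adjoin

/-- The adjoined generator of degree `deg w`. -/
def diskY (w : W) : (P.disk deg).carrier := (P.diskRel deg).s (w, 1)

lemma diskY_mem (w : W) : P.diskY deg w ∈ (P.disk deg).gr (deg w) := (P.diskRel deg).s_mem (w, 1)

lemma d_diskY (w : W) : (P.disk deg).d (P.diskY deg w) = (P.diskRel deg).s (w, 0) :=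
  freeD_ι _ _ _

lemma adjoin_disk_eq_top : Algebra.adjoin k (Set.range (DGAlg.toAlgHom (P.diskι deg)) ∪
    Set.range (P.diskY deg) ∪ Set.range fun w => (P.disk deg).d (P.diskY deg w)) = ⊤ := by
  rw [← top_le_iff, ← (P.diskRel deg).adjoin_eq_top]
  refine Algebra.adjoin_mono ?_
  rintro _ (h | ⟨⟨w, j⟩, rfl⟩)
  · exact Or.inl (Or.inl h)
  · fin_cases j
    · exact Or.inr ⟨w, P.d_diskY deg w⟩
    · exact Or.inl (Or.inr ⟨w, rfl⟩)

lemma disk_hom_ext {Z : DGAlg k} {f g : P.disk deg ⟶ Z} (h : P.diskι deg ≫ f = P.diskι deg ≫ g)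
    (hy : ∀ w, DGAlg.toAlgHom f (P.diskY deg w) = DGAlg.toAlgHom g (P.diskY deg w)) : f = g := by
  refine (P.diskRel deg).hom_ext h ?_
  rintro ⟨w, j⟩
  fin_cases j
  · change DGAlg.toAlgHom f ((P.diskRel deg).s (w, 0)) = DGAlg.toAlgHom g ((P.diskRel deg).s (w, 0))
    rw [← d_diskY, DGAlg.toAlgHom_d, DGAlg.toAlgHom_d, hy]
  · exact hy w

lemma exists_diskDesc {Z : DGAlg k} (f : A ⟶ Z) (c : W → Z.carrier)
    (hc : ∀ w, c w ∈ Z.gr (deg w)) :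
    ∃ g : P.disk deg ⟶ Z, P.diskι deg ≫ g = f ∧ ∀ w, DGAlg.toAlgHom g (P.diskY deg w) = c w := by
  let S := P.diskRel deg
  let e : W × Fin 2 → Z.carrier := fun v => ![Z.d (c v.1), c v.1] v.2
  refine ⟨S.homDesc f e ?_ ?_, S.comp_homDesc _ _ _ _, fun w => S.homDesc_s f e _ _ (w, 1)⟩
  · rintro ⟨w, j⟩
    fin_cases j
    · exact Z.d_mem (hc w)
    · exact hc w
  · rintro ⟨w, j⟩
    fin_cases j
    · change S.desc _ e ((P.disk deg).d (S.s (w, 0))) = Z.d (Z.d (c w))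
      rw [← d_diskY, DGAlg.d_d, DGAlg.d_d, map_zero]
    · change S.desc _ e ((P.disk deg).d (P.diskY deg w)) = Z.d (c w)
      rw [d_diskY]
      exact S.desc_s _ _ (w, 0)

/-- Attaching disks is a quasi-equivalence: the twisted derivation which is zero on `A` and
maps `d y` to `± y` and `y` to `0` is a contraction onto `A`. -/
lemma diskι_isQuasiEquivalence : DGAlg.IsQuasiEquivalence (P.diskι deg) := by
  obtain ⟨r, hr, hry⟩ := P.exists_diskDesc deg (𝟙 A) (fun _ => 0) fun _ => Submodule.zero_mem _
  have hr' : ∀ a, DGAlg.toAlgHom r (DGAlg.toAlgHom (P.diskι deg) a) = a :=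
    DFunLike.congr_fun (congrArg DGAlg.toAlgHom hr)
  let S := P.diskRel deg
  let E := P.disk deg
  obtain ⟨D, hD, h1, h2⟩ := S.exists_deriv (DGAlg.toAlgHom (𝟙 E))
    ((DGAlg.toAlgHom (r ≫ P.diskι deg)).comp E.sig) (D₀ := 0) (fun a b => by simp)
    (fun v : W × Fin 2 => ![- (sgn k (deg v.1) • P.diskY deg v.1), 0] v.2)
  have hy : ∀ w, D (P.diskY deg w) = 0 := fun w => h2 (w, 1)
  have hz : ∀ w, D (E.d (P.diskY deg w)) = - (sgn k (deg w) • P.diskY deg w) := fun w => by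
    rw [d_diskY]; exact h2 (w, 0)
  have hmem : ∀ {n : ℤ} {a : E.carrier}, a ∈ E.gr n → D a ∈ E.gr (n - 1) := by
    intro n a ha
    refine (P.diskGenerators deg).deriv_mem hD ?_ ha
    rintro (x | ⟨w, j⟩)
    · have e : (P.diskGenerators deg).gen (Sum.inl x) = DGAlg.toAlgHom (P.diskι deg) (P.gen x) :=
        (P.attachInc_gen x).symm
      rw [e, h1]
      exact Submodule.zero_mem _
    · fin_cases j
      · refine Set.mem_of_eq_of_mem (s := (E.gr _ : Set E.carrier)) (h2 (w, 0)) ?_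
        have : (P.diskGenerators deg).deg (Sum.inr (w, 0)) - 1 = deg w :=
          add_sub_cancel_right _ _
        change _ ∈ E.gr ((P.diskGenerators deg).deg (Sum.inr (w, 0)) - 1)
        rw [this]
        exact Submodule.neg_mem _ (Submodule.smul_mem _ _ (P.diskY_mem deg w))
      · refine Set.mem_of_eq_of_mem (s := (E.gr _ : Set E.carrier)) (h2 (w, 1)) ?_
        exact Submodule.zero_mem _
  have hd : ∀ b, E.d (D b) = DGAlg.toAlgHom (𝟙 E) (E.sig b) -
      DGAlg.toAlgHom (r ≫ P.diskι deg) (E.sig b) + D (E.d b) := by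
    intro b
    refine hD.homotopy_of_adjoin (DGAlg.sig_of_degree_neg_one hmem) ?_
      (P.adjoin_disk_eq_top deg ▸ Algebra.mem_top : b ∈ _)
    rintro _ ((⟨a, rfl⟩ | ⟨w, rfl⟩) | ⟨w, rfl⟩)
    · rw [← DGAlg.toAlgHom_d, h1, h1]
      simp [E, DGAlg.sig_toAlgHom, hr']
    · rw [hy, hz, E.sig_of_mem (P.diskY_mem deg w)]
      simp [E, hry]
    · change E.d (D (E.d (P.diskY deg w))) = DGAlg.toAlgHom (𝟙 E) (E.sig (E.d (P.diskY deg w))) -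
        DGAlg.toAlgHom (r ≫ P.diskι deg) (E.sig (E.d (P.diskY deg w))) +
          D (E.d (E.d (P.diskY deg w)))
      rw [hz, E.sig_of_mem (E.d_mem (P.diskY_mem deg w)), E.d_d, sgn_succ]
      simp [E, hry, DGAlg.toAlgHom_d]
  exact DGAlg.IsQuasiEquivalence.of_inverse (g := r) (by rw [hr])
    (DGAlg.cohomologyMap_eq_of_homotopy D hd)

end Generators

/-! ### Trivial semifree extensions -/

namespace RelGenerators

variable {A B : DGAlg k} {F : A ⟶ B} (S : RelGenerators F)

include S in
/-- A trivial semifree extension of `A` is a retract, under `A`, of an extension by disks. -/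
lemma exists_disk_retract (hF : DGAlg.IsQuasiEquivalence F) (P : Generators A) :
    ∃ (W : Type u) (deg : W → ℤ) (i : B ⟶ P.disk deg) (q : P.disk deg ⟶ B),
      F ≫ i = P.diskι deg ∧ P.diskι deg ≫ q = F ∧ i ≫ q = 𝟙 B := by
  let W : Type u := { w : ℤ × B.carrier // w.2 ∈ B.gr w.1 }
  obtain ⟨q, hq, hqy⟩ := P.exists_diskDesc (fun w : W => w.1.1) F (fun w => w.1.2) fun w => w.2
  have hq' : DGAlg.IsQuasiEquivalence q :=
    DGAlg.IsQuasiEquivalence.of_comp_left (P.diskι_isQuasiEquivalence _) (by rwa [hq])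
  have hs : Function.Surjective (DGAlg.toAlgHom q) := by
    intro b
    induction b using B.homog_induction with
    | zero => exact ⟨0, map_zero _⟩
    | add a b ha hb =>
      obtain ⟨a, rfl⟩ := ha
      obtain ⟨b, rfl⟩ := hb
      exact ⟨a + b, map_add _ _ _⟩
    | homog n b hb => exact ⟨_, hqy ⟨⟨n, b⟩, hb⟩⟩
  obtain ⟨i, h1, h2⟩ := S.exists_lift hq' hs (P.diskι _) (𝟙 B) (by rw [hq, Category.comp_id])
  exact ⟨W, _, i, q, h1, hq, h2⟩

include S in
/-- Every semifree dg algebra is fibrant. -/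
lemma exists_retraction (hF : DGAlg.IsQuasiEquivalence F) (P : Generators A) :
    ∃ r : B ⟶ A, F ≫ r = 𝟙 A := by
  obtain ⟨W, deg, i, q, h1, -, -⟩ := S.exists_disk_retract hF P
  obtain ⟨r, hr, -⟩ := P.exists_diskDesc deg (𝟙 A) (fun _ => 0) fun _ => Submodule.zero_mem _
  exact ⟨i ≫ r, by rw [← Category.assoc, h1, hr]⟩

include S in
/-- Trivial semifree extensions are stable under pushout, as they are retracts of extensions
by disks. -/
lemma isQuasiEquivalence_pushout (hF : DGAlg.IsQuasiEquivalence F) (P : Generators A)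
    {C D : DGAlg k} (R : Generators C) {G : A ⟶ C} {G' : B ⟶ D} {F' : C ⟶ D}
    (h : IsAlgPushout F G G' F') : DGAlg.IsQuasiEquivalence F' := by
  obtain ⟨W, deg, i, q, h1, h2, h3⟩ := S.exists_disk_retract hF P
  obtain ⟨g, hg, hgy⟩ := P.exists_diskDesc deg (G ≫ R.diskι deg) (R.diskY deg) (R.diskY_mem deg)
  obtain ⟨r, hr, hry⟩ := R.exists_diskDesc deg F'
    (fun w => DGAlg.toAlgHom (q ≫ G') (P.diskY deg w))
    fun w => DGAlg.toAlgHom_mem _ (P.diskY_mem deg w)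
  have e : g ≫ r = q ≫ G' := by
    refine P.disk_hom_ext deg ?_ fun w => ?_
    · rw [← Category.assoc, hg, Category.assoc, hr, ← Category.assoc, h2, h.w]
    · rw [DGAlg.toAlgHom_comp, AlgHom.comp_apply, hgy, hry]
  obtain ⟨s, ⟨hs1, hs2⟩, -⟩ := h.existsUnique_hom (i ≫ g) (R.diskι deg) (by
    rw [← Category.assoc, h1, hg])
  refine DGAlg.IsQuasiEquivalence.of_retract hs2 (r := r) ?_ (R.diskι_isQuasiEquivalence deg)
  refine (h.existsUnique_hom G' F' h.w).unique ⟨?_, ?_⟩ ⟨Category.comp_id _, Category.comp_id _⟩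
  · rw [← Category.assoc, hs1, Category.assoc, e, ← Category.assoc, h3, Category.id_comp]
  · rw [← Category.assoc, hs2, hr]

end RelGenerators

/-! ### The relative cylinder -/

/-- The relative cylinder of a semifree extension `F : A ⟶ B` with generators `s` is the semifree
extension with generators `t_s`. Here `D` stands for `B ∪_A Cyl A ∪_A B`; of its
universal property, only uniqueness is needed, because `G` and the universal property of `Cyl B`
provide existence. -/
def RelGenerators.relCyl {A B D : DGAlg k} {F : A ⟶ B} (S : RelGenerators F) (P : Generators A)
    (Q : Generators B) {j₁ j₂ : B ⟶ D} {l : P.cyl ⟶ D} {G : D ⟶ Q.cyl} (w₁ : F ≫ j₁ = P.i₁ ≫ l)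
    (w₂ : F ≫ j₂ = P.i₂ ≫ l) (h₁ : j₁ ≫ G = Q.i₁) (h₂ : j₂ ≫ G = Q.i₂)
    (hl : l ≫ G = P.cylMap Q F)
    (ext : ∀ (Z : Type u) [Ring Z] [Algebra k Z] (φ ψ : D.carrier →ₐ[k] Z),
      φ.comp (DGAlg.toAlgHom j₁) = ψ.comp (DGAlg.toAlgHom j₁) →
      φ.comp (DGAlg.toAlgHom j₂) = ψ.comp (DGAlg.toAlgHom j₂) →
      φ.comp (DGAlg.toAlgHom l) = ψ.comp (DGAlg.toAlgHom l) → φ = ψ) : RelGenerators G where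
  X := S.X
  lt := S.lt
  wo := S.wo
  deg x := S.deg x - 1
  s x := Q.T (S.s x)
  s_mem x := Q.T_mem (S.s_mem x)
  existsUnique Z _ _ f c := by
    have w₁ : ∀ a, DGAlg.toAlgHom j₁ (DGAlg.toAlgHom F a) =
      DGAlg.toAlgHom l (DGAlg.toAlgHom P.i₁ a) := DFunLike.congr_fun (congrArg DGAlg.toAlgHom w₁)
    have w₂ : ∀ a, DGAlg.toAlgHom j₂ (DGAlg.toAlgHom F a) =
      DGAlg.toAlgHom l (DGAlg.toAlgHom P.i₂ a) := DFunLike.congr_fun (congrArg DGAlg.toAlgHom w₂)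
    have h₁ : ∀ b, DGAlg.toAlgHom G (DGAlg.toAlgHom j₁ b) = DGAlg.toAlgHom Q.i₁ b :=
      DFunLike.congr_fun (congrArg DGAlg.toAlgHom h₁)
    have h₂ : ∀ b, DGAlg.toAlgHom G (DGAlg.toAlgHom j₂ b) = DGAlg.toAlgHom Q.i₂ b :=
      DFunLike.congr_fun (congrArg DGAlg.toAlgHom h₂)
    have hl : ∀ u, DGAlg.toAlgHom G (DGAlg.toAlgHom l u) = DGAlg.toAlgHom (P.cylMap Q F) u :=
      DFunLike.congr_fun (congrArg DGAlg.toAlgHom hl)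
    let f₁ := f.comp (DGAlg.toAlgHom j₁)
    let f₂ := f.comp (DGAlg.toAlgHom j₂)
    have hT := P.T_isDeriv.postcomp (f.comp (DGAlg.toAlgHom l))
    have e1 : (f.comp (DGAlg.toAlgHom l)).comp (DGAlg.toAlgHom P.i₂) =
        f₂.comp (DGAlg.toAlgHom F) := AlgHom.ext fun a => congrArg f (w₂ a).symm
    have e2 : (f.comp (DGAlg.toAlgHom l)).comp ((DGAlg.toAlgHom P.i₁).comp A.sig) =
        (f₁.comp B.sig).comp (DGAlg.toAlgHom F) := AlgHom.ext fun a => by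
      simp only [AlgHom.comp_apply, DGAlg.sig_toAlgHom, f₁, w₁]
    rw [e1, e2] at hT
    obtain ⟨D, hD, hD1, hD2⟩ := S.exists_deriv f₂ (f₁.comp B.sig) hT c
    obtain ⟨γ, g1, g2, g3⟩ := Q.exists_cylDesc hD
    have g1' : ∀ b, γ (DGAlg.toAlgHom Q.i₁ b) = f₁ b := DFunLike.congr_fun g1
    have g2' : ∀ b, γ (DGAlg.toAlgHom Q.i₂ b) = f₂ b := DFunLike.congr_fun g2
    refine ⟨γ, ⟨?_, fun x => by rw [g3, hD2]⟩, ?_⟩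
    · refine ext Z _ _ (AlgHom.ext fun b => ?_) (AlgHom.ext fun b => ?_)
        (P.cyl_ext (fun a => ?_) (fun a => ?_) fun a => ?_)
      · simp [h₁, g1', f₁]
      · simp [h₂, g2', f₂]
      · simp [hl, Generators.cylMap_i₁, g1', f₁, w₁]
      · simp [hl, Generators.cylMap_i₂, g2', f₂, w₂]
      · simp [hl, Generators.cylMap_T, g3, hD1]
    · rintro γ' ⟨r1, r2⟩
      have r1' : ∀ d, γ' (DGAlg.toAlgHom G d) = f d := DFunLike.congr_fun r1
      have s1 : γ'.comp (DGAlg.toAlgHom Q.i₁) = f₁ := AlgHom.ext fun b => by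
        rw [AlgHom.comp_apply, ← h₁, r1']; rfl
      have s2 : γ'.comp (DGAlg.toAlgHom Q.i₂) = f₂ := AlgHom.ext fun b => by
        rw [AlgHom.comp_apply, ← h₂, r1']; rfl
      have hT' := Q.T_isDeriv.postcomp γ'
      rw [← AlgHom.comp_assoc, s1, s2] at hT'
      refine Q.cyl_ext (fun b => ?_) (fun b => ?_) fun b => ?_
      · exact (DFunLike.congr_fun s1 b).trans (g1' b).symm
      · exact (DFunLike.congr_fun s2 b).trans (g2' b).symm
      · rw [g3]
        refine LinearMap.congr_fun (hT'.ext hD S.adjoin_eq_top ?_) b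
        rintro _ (⟨a, rfl⟩ | ⟨x, rfl⟩)
        · rw [hD1]
          simp [← Generators.cylMap_T P, ← hl, r1']
        · rw [hD2]
          exact r2 x
  d_s x := by
    have h₁ : ∀ b, DGAlg.toAlgHom Q.i₁ b ∈ Set.range (DGAlg.toAlgHom G) := fun b =>
      ⟨DGAlg.toAlgHom j₁ b, DFunLike.congr_fun (congrArg DGAlg.toAlgHom h₁) b⟩
    have h₂ : ∀ b, DGAlg.toAlgHom Q.i₂ b ∈ Set.range (DGAlg.toAlgHom G) := fun b =>
      ⟨DGAlg.toAlgHom j₂ b, DFunLike.congr_fun (congrArg DGAlg.toAlgHom h₂) b⟩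
    have hl : ∀ a, Q.T (DGAlg.toAlgHom F a) ∈ Set.range (DGAlg.toAlgHom G) := fun a => by
      rw [← P.cylMap_T]
      exact ⟨DGAlg.toAlgHom l (P.T a), DFunLike.congr_fun (congrArg DGAlg.toAlgHom hl) _⟩
    set U := Algebra.adjoin k (Set.range (DGAlg.toAlgHom G) ∪
      (fun x => Q.T (S.s x)) '' {y | S.lt y x}) with hU
    have hGU : Set.range (DGAlg.toAlgHom G) ⊆ U :=
      Set.subset_union_left.trans Algebra.subset_adjoin
    have key : ∀ b ∈ Algebra.adjoin k (Set.range (DGAlg.toAlgHom F) ∪ S.s '' {y | S.lt y x}),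
        Q.T b ∈ U := by
      intro b hb
      induction hb using Algebra.adjoin_induction with
      | mem b hb =>
        obtain ⟨a, rfl⟩ | ⟨y, hy, rfl⟩ := hb
        · exact hGU (hl a)
        · exact Algebra.subset_adjoin (Or.inr ⟨y, hy, rfl⟩)
      | algebraMap r => rw [Q.T_isDeriv.map_algebraMap]; exact U.zero_mem
      | add a b _ _ ha hb => rw [map_add]; exact U.add_mem ha hb
      | mul a b _ _ ha hb =>
        rw [Q.T_isDeriv]
        exact U.add_mem (U.mul_mem (hGU (h₂ a)) hb) (U.mul_mem ha (hGU (h₁ _)))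
    rw [Q.d_T]
    exact U.add_mem (U.sub_mem (hGU (h₂ _)) (hGU (h₁ _))) (key _ (S.d_s x))

/-! ### Initial objects -/

/-- A dg algebra is algebraically initial if its underlying algebra is initial. -/
def IsAlgInitial (E : DGAlg k) : Prop :=
  ∀ (Z : Type u) [Ring Z] [Algebra k Z], Nonempty (Unique (E.carrier →ₐ[k] Z))

namespace IsAlgInitial

variable {E : DGAlg k} (h : IsAlgInitial E)

include h

lemma algHom_ext {Z : Type u} [Ring Z] [Algebra k Z] (φ ψ : E.carrier →ₐ[k] Z) : φ = ψ := by
  obtain ⟨_⟩ := h Z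
  exact Subsingleton.elim _ _

lemma adjoin_empty : Algebra.adjoin k (∅ : Set E.carrier) = ⊤ := by
  obtain ⟨u⟩ := h (Algebra.adjoin k (∅ : Set E.carrier))
  rw [eq_top_iff]
  intro b _
  have := DFunLike.congr_fun (h.algHom_ext ((Subalgebra.val _).comp u.default) (AlgHom.id k _)) b
  rw [AlgHom.id_apply] at this
  rw [← this]
  exact (u.default b).2

lemma existsUnique_hom (Z : DGAlg k) : Nonempty (Unique (E ⟶ Z)) := by
  obtain ⟨u⟩ := h Z.carrier
  exact ⟨⟨⟨DGAlg.homOfAdjoin u.default h.adjoin_empty (by simp) (by simp)⟩,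
    fun f => DGAlg.hom_ext (h.algHom_ext _ _)⟩⟩

/-- The cylinder on the initial dg algebra is initial. -/
lemma cyl (P : Generators E) : IsAlgInitial P.cyl := by
  intro Z _ _
  obtain ⟨u⟩ := h Z
  obtain ⟨γ, -, -, -⟩ := P.exists_cylDesc (f₁ := u.default) (f₂ := u.default) (D := 0)
    (fun a b => by simp)
  refine ⟨⟨⟨γ⟩, fun γ' => P.cyl_ext
    (DFunLike.congr_fun (h.algHom_ext (γ'.comp (DGAlg.toAlgHom P.i₁)) (γ.comp (DGAlg.toAlgHom P.i₁))))
    (DFunLike.congr_fun (h.algHom_ext (γ'.comp (DGAlg.toAlgHom P.i₂)) (γ.comp (DGAlg.toAlgHom P.i₂))))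
    fun a => ?_⟩⟩
  have ha : a ∈ Algebra.adjoin k (∅ : Set E.carrier) := h.adjoin_empty ▸ Algebra.mem_top
  rw [Algebra.adjoin_empty, Algebra.mem_bot] at ha
  obtain ⟨r, rfl⟩ := ha
  rw [P.T_isDeriv.map_algebraMap, map_zero, map_zero]

/-- Every semifree dg algebra is a semifree extension of the initial one. -/
def relGenerators {A : DGAlg k} (F : E ⟶ A) (P : Generators A) : RelGenerators F where
  X := P.X
  lt := P.lt
  wo := P.wo
  deg := P.deg
  s := P.gen
  s_mem := P.gen_mem
  existsUnique C _ _ f c := by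
    refine ⟨(FreeAlgebra.lift k c).comp P.equiv.symm.toAlgHom, ⟨h.algHom_ext _ _, fun x => ?_⟩, ?_⟩
    · simp
    · rintro ψ ⟨-, hψ⟩
      exact P.algHom_ext fun x => by simp [hψ]
  d_s x := Algebra.adjoin_mono Set.subset_union_right (P.d_gen x)

end IsAlgInitial

variable (k) in
/-- The base ring as a semifree dg algebra without generators. -/
def unitDGAlg : SemifreeDGAlg k where
  obj := freeDGAlg (PEmpty.elim : PEmpty.{u + 1} → ℤ) PEmpty.elim (fun x => x.elim) fun x => x.elim
  property := ⟨{
    X := PEmpty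
    lt := emptyRelation
    wo := inferInstance
    deg := PEmpty.elim
    gen := FreeAlgebra.ι k
    gen_mem := fun x => x.elim
    bijective := by
      have : (FreeAlgebra.lift k (FreeAlgebra.ι k) : FreeAlgebra k PEmpty.{u + 1} →ₐ[k] _) =
          AlgHom.id k _ := AlgHom.ext lift_ι_self
      exact this ▸ Function.bijective_id
    d_gen := fun x => x.elim }⟩

lemma unitDGAlg_isAlgInitial : IsAlgInitial (unitDGAlg k).obj := fun _ _ _ =>
  ⟨⟨⟨FreeAlgebra.lift k PEmpty.elim⟩, fun φ =>
    FreeAlgebra.hom_ext (f := φ) (funext fun x : PEmpty => x.elim)⟩⟩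

/-- An algebraically initial semifree dg algebra is initial. -/
def IsAlgInitial.isInitial {E : SemifreeDGAlg k} (h : IsAlgInitial E.obj) : IsInitial E :=
  IsInitial.ofUniqueHom (fun Z => ObjectProperty.homMk (h.existsUnique_hom Z.obj).some.default)
    fun Z f => ObjectProperty.hom_ext _ ((h.existsUnique_hom Z.obj).some.uniq f.hom)

lemma isAlgInitial_of_isInitial {E : SemifreeDGAlg k} (hE : IsInitial E) :
    IsAlgInitial E.obj := by
  let e : E ≅ unitDGAlg k := hE.uniqueUpToIso (unitDGAlg_isAlgInitial (k := k)).isInitial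
  have e' : ∀ x, DGAlg.toAlgHom e.inv.hom (DGAlg.toAlgHom e.hom.hom x) = x :=
    DFunLike.congr_fun
      (congrArg DGAlg.toAlgHom (congrArg InducedCategory.Hom.hom e.hom_inv_id))
  intro Z _ _
  obtain ⟨u⟩ := unitDGAlg_isAlgInitial (k := k) Z
  refine ⟨⟨⟨u.default.comp (DGAlg.toAlgHom e.hom.hom)⟩, fun φ => AlgHom.ext fun x => ?_⟩⟩
  have := DFunLike.congr_fun (u.uniq (φ.comp (DGAlg.toAlgHom e.inv.hom)))
    (DGAlg.toAlgHom e.hom.hom x)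
  rw [AlgHom.comp_apply, e'] at this
  exact this

/-! ### The category of semifree dg algebras -/

section Category

variable {A B C D : SemifreeDGAlg k}

instance : HasInitial (SemifreeDGAlg k) :=
  (unitDGAlg_isAlgInitial (k := k)).isInitial.hasInitial

lemma semifreeExtensions_initial {E : SemifreeDGAlg k} (hE : IsInitial E) (F : E ⟶ A) :
    semifreeExtensions k F :=
  semifreeExtensions_iff.2
    ⟨(isAlgInitial_of_isInitial hE).relGenerators F.hom A.property.some⟩

lemma quasiEquivalences_of_isIso (F : A ⟶ B) (_ : IsIso F) : quasiEquivalences k F :=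
  DGAlg.IsQuasiEquivalence.of_iso (g := (inv F).hom)
    (congrArg InducedCategory.Hom.hom (IsIso.hom_inv_id F))
    (congrArg InducedCategory.Hom.hom (IsIso.inv_hom_id F))

instance : (quasiEquivalences k).HasTwoOutOfThreeProperty where
  comp_mem _ _ hf hg := DGAlg.IsQuasiEquivalence.comp hf hg
  of_postcomp _ _ hg h := DGAlg.IsQuasiEquivalence.of_comp_right hg h
  of_precomp _ _ hf h := DGAlg.IsQuasiEquivalence.of_comp_left hf h

lemma quasiEquivalences_of_pushout {F : A ⟶ B} {G : A ⟶ C} {G' : B ⟶ D} {F' : C ⟶ D}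
    (h : IsPushout F G G' F') (hF : semifreeExtensions k F) (hF' : quasiEquivalences k F) :
    quasiEquivalences k F' := by
  obtain ⟨S⟩ := semifreeExtensions_iff.1 hF
  exact S.isQuasiEquivalence_pushout hF' A.property.some C.property.some
    (isAlgPushout_and_cof_of_isPushout h hF).1

/-- Every semifree dg algebra is fibrant. -/
lemma isFibrantObject (A : SemifreeDGAlg k) :
    IsFibrantObject (semifreeExtensions k) (quasiEquivalences k) A := by
  intro B F hF hF'
  obtain ⟨S⟩ := semifreeExtensions_iff.1 hF
  obtain ⟨r, hr⟩ := S.exists_retraction hF' A.property.some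
  exact ⟨ObjectProperty.homMk r, ObjectProperty.hom_ext _ hr⟩

lemma isCofibrantObject (A : SemifreeDGAlg k) : IsCofibrantObject (semifreeExtensions k) A :=
  ⟨unitDGAlg k, unitDGAlg_isAlgInitial.isInitial, semifreeExtensions_initial
    unitDGAlg_isAlgInitial.isInitial _⟩

/-- A coproduct of semifree dg algebras is a coproduct of algebras. -/
lemma isAlgPushout_of_coproduct {E AB : SemifreeDGAlg k} (hE : IsInitial E) {a : A ⟶ AB}
    {b : B ⟶ AB} (h : IsColimit (BinaryCofan.mk a b)) :
    IsAlgPushout (hE.to A).hom (hE.to B).hom a.hom b.hom :=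
  (isAlgPushout_and_cof_of_isPushout (IsPushout.of_is_coproduct' h hE)
    (semifreeExtensions_initial hE _)).1

lemma exists_coproduct (A B : SemifreeDGAlg k) : ∃ (AB : SemifreeDGAlg k) (a : A ⟶ AB)
    (b : B ⟶ AB), Nonempty (IsColimit (BinaryCofan.mk a b)) := by
  obtain ⟨AB, a, b, h, -⟩ := exists_isPushout (initialIsInitial.to A) (initialIsInitial.to B)
    (semifreeExtensions_initial initialIsInitial _)
  exact ⟨AB, a, b, ⟨isCoproductOfIsInitialIsPushout a b _ _ initialIsInitial h.isColimit⟩⟩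

instance : HasFiniteCoproducts (SemifreeDGAlg k) := by
  have : ∀ {A B : SemifreeDGAlg k}, HasColimit (pair A B) := by
    intro A B
    obtain ⟨AB, a, b, ⟨h⟩⟩ := exists_coproduct A B
    exact ⟨⟨⟨_, h⟩⟩⟩
  have := hasBinaryCoproducts_of_hasColimit_pair (SemifreeDGAlg k)
  exact hasFiniteCoproducts_of_has_binary_and_initial

end Category

/-! ### The cylinder functor and semifree extensions -/

section Cylinder

variable (gens : ∀ A : SemifreeDGAlg k, Generators A.obj)

variable {A B C D : SemifreeDGAlg k}

/-- The components of `cylI₁` (for `r = 0`) and `cylI₂` (for `r = 1`). -/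
def cylInc (r : Fin 2) (A : SemifreeDGAlg k) : A ⟶ (Cyl gens).obj A :=
  ((![cylI₁ gens, cylI₂ gens] : Fin 2 → (𝟭 _ ⟶ Cyl gens)) r).app A

/-- The components of `cylP`. -/
def cylProj (A : SemifreeDGAlg k) : (Cyl gens).obj A ⟶ A := (cylP gens).app A

lemma cylInc_cylProj (r : Fin 2) (A : SemifreeDGAlg k) :
    cylInc gens r A ≫ cylProj gens A = 𝟙 A := by
  fin_cases r
  · exact ObjectProperty.hom_ext _ (gens A).i₁_proj
  · exact ObjectProperty.hom_ext _ (gens A).i₂_proj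

lemma cylInc_naturality (r : Fin 2) (F : A ⟶ B) :
    F ≫ cylInc gens r B = cylInc gens r A ≫ (Cyl gens).map F :=
  ((![cylI₁ gens, cylI₂ gens] : Fin 2 → (𝟭 _ ⟶ Cyl gens)) r).naturality F

lemma cylProj_quasiEquivalence (A : SemifreeDGAlg k) : quasiEquivalences k (cylProj gens A) :=
  (gens A).proj_isQuasiEquivalence

lemma cylInc_quasiEquivalence (r : Fin 2) (A : SemifreeDGAlg k) :
    quasiEquivalences k (cylInc gens r A) := by
  refine (quasiEquivalences k).of_postcomp _ _ (cylProj_quasiEquivalence gens A) ?_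
  rw [cylInc_cylProj]
  exact quasiEquivalences_of_isIso _ inferInstance

/-- Homotopic morphisms agree on cohomology. -/
lemma cohomologyMap_cylInc (H : (Cyl gens).obj A ⟶ B) :
    DGAlg.cohomologyMap (cylInc gens 0 A ≫ H).hom =
      DGAlg.cohomologyMap (cylInc gens 1 A ≫ H).hom := by
  refine (DGAlg.cohomologyMap_comp (cylInc gens 0 A).hom H.hom).trans (Eq.trans ?_
    (DGAlg.cohomologyMap_comp (cylInc gens 1 A).hom H.hom).symm)
  exact congrArg (DGAlg.cohomologyMap H.hom ∘ₗ ·) (gens A).cohomologyMap_i₁_eq_i₂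

/-- The cylinder on an initial object is initial. -/
def isInitialCyl {E : SemifreeDGAlg k} (hE : IsInitial E) : IsInitial ((Cyl gens).obj E) :=
  IsAlgInitial.isInitial (E := (Cyl gens).obj E) ((isAlgInitial_of_isInitial hE).cyl (gens E))

lemma isPushout_cyl {F : A ⟶ B} {G : A ⟶ C} {G' : B ⟶ D} {F' : C ⟶ D}
    (h : IsPushout F G G' F') (hF : semifreeExtensions k F) :
    IsPushout ((Cyl gens).map F) ((Cyl gens).map G) ((Cyl gens).map G') ((Cyl gens).map F') :=
  IsAlgPushout.isPushout (F := (Cyl gens).map F) (G := (Cyl gens).map G)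
    (G' := (Cyl gens).map G') (F' := (Cyl gens).map F')
    ((isAlgPushout_and_cof_of_isPushout h hF).1.cylMap (gens A) (gens B) (gens C) (gens D))

/-- The relative cylinder of a semifree extension is a semifree extension. -/
lemma semifreeExtensions_relCyl {F : A ⟶ B} (hF : semifreeExtensions k F) (j : Fin 2 → (B ⟶ D))
    {l : (Cyl gens).obj A ⟶ D} {G : D ⟶ (Cyl gens).obj B}
    (w : ∀ r, F ≫ j r = cylInc gens r A ≫ l) (hj : ∀ r, j r ≫ G = cylInc gens r B)
    (hl : l ≫ G = (Cyl gens).map F)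
    (ext : ∀ (Z : Type u) [Ring Z] [Algebra k Z] (φ ψ : D.obj.carrier →ₐ[k] Z),
      (∀ r, φ.comp (DGAlg.toAlgHom (j r).hom) = ψ.comp (DGAlg.toAlgHom (j r).hom)) →
      φ.comp (DGAlg.toAlgHom l.hom) = ψ.comp (DGAlg.toAlgHom l.hom) → φ = ψ) :
    semifreeExtensions k G := by
  obtain ⟨S⟩ := semifreeExtensions_iff.1 hF
  exact semifreeExtensions_iff.2 ⟨S.relCyl (gens A) (gens B)
    (congrArg InducedCategory.Hom.hom (w 0)) (congrArg InducedCategory.Hom.hom (w 1))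
    (congrArg InducedCategory.Hom.hom (hj 0)) (congrArg InducedCategory.Hom.hom (hj 1))
    (congrArg InducedCategory.Hom.hom hl) fun Z _ _ φ ψ h1 h2 h3 =>
      ext Z φ ψ (Fin.forall_fin_two.2 ⟨h1, h2⟩) h3⟩

/-- The inclusion `A ⊔ A ⟶ Cyl A` is a semifree extension. -/
lemma semifreeExtensions_coprod_cyl {AA : SemifreeDGAlg k} (a : Fin 2 → (A ⟶ AA))
    (h : IsColimit (BinaryCofan.mk (a 0) (a 1))) {iA : AA ⟶ (Cyl gens).obj A}
    (hi : ∀ r, a r ≫ iA = cylInc gens r A) : semifreeExtensions k iA := by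
  let hE : IsInitial (⊥_ SemifreeDGAlg k) := initialIsInitial
  refine semifreeExtensions_relCyl gens (semifreeExtensions_initial hE (hE.to A)) a
    (l := (isInitialCyl gens hE).to AA) (fun r => hE.hom_ext _ _) hi
    ((isInitialCyl gens hE).hom_ext _ _) ?_
  intro Z _ _ φ ψ h1 _
  exact (isAlgPushout_of_coproduct hE h).algHom_ext (h1 0) (h1 1)

/-- For a semifree extension `F : A ⟶ B`, the map `B ∪_A Cyl A ⟶ Cyl B` is a semifree extension. -/
lemma semifreeExtensions_mappingCyl {F : A ⟶ B} (hF : semifreeExtensions k F) (r : Fin 2)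
    {j : B ⟶ D} {l : (Cyl gens).obj A ⟶ D} (h : IsPushout F (cylInc gens r A) j l)
    {G : D ⟶ (Cyl gens).obj B} (hj : j ≫ G = cylInc gens r B)
    (hl : l ≫ G = (Cyl gens).map F) : semifreeExtensions k G := by
  -- attach the second copy of `B`
  obtain ⟨D', j', m, h', hm⟩ := exists_isPushout F (cylInc gens (1 - r) A ≫ l) hF
  have w : F ≫ cylInc gens (1 - r) B = (cylInc gens (1 - r) A ≫ l) ≫ G := by
    rw [Category.assoc, hl, cylInc_naturality]
  have hG : m ≫ h'.desc (cylInc gens (1 - r) B) G w = G := h'.inr_desc _ _ _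
  rw [← hG]
  refine semifreeExtensions_comp _ _ hm ?_
  have hne : 1 - r ≠ r := by fin_cases r <;> decide
  have hr : ∀ s, s = r ∨ s = 1 - r := by fin_cases r <;> decide
  refine semifreeExtensions_relCyl gens hF (fun s => if s = r then j ≫ m else j') (l := l ≫ m)
    (fun s => ?_) (fun s => ?_) (by rw [Category.assoc, hG, hl]) ?_
  · obtain rfl | rfl := hr s
    · rw [if_pos rfl, ← Category.assoc, ← Category.assoc, h.w]
    · rw [if_neg hne, h'.w, Category.assoc]
  · obtain rfl | rfl := hr s
    · rw [if_pos rfl, Category.assoc, hG, hj]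
    · rw [if_neg hne, h'.inl_desc]
  · intro Z _ _ φ ψ h1 h2
    have e1 := h1 r
    have e2 := h1 (1 - r)
    rw [if_pos rfl] at e1
    rw [if_neg hne] at e2
    refine (isAlgPushout_and_cof_of_isPushout h' hF).1.algHom_ext e2 ?_
    exact (isAlgPushout_and_cof_of_isPushout h hF).1.algHom_ext e1 h2

/-- The inclusions of the ends of the cylinder are semifree extensions. -/
lemma cylInc_semifreeExtension (r : Fin 2) (A : SemifreeDGAlg k) :
    semifreeExtensions k (cylInc gens r A) := by
  let hE : IsInitial (⊥_ SemifreeDGAlg k) := initialIsInitial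
  have : IsIso (cylInc gens r (⊥_ SemifreeDGAlg k)) :=
    ⟨(isInitialCyl gens hE).to _, hE.hom_ext _ _, (isInitialCyl gens hE).hom_ext _ _⟩
  refine semifreeExtensions_mappingCyl gens (semifreeExtensions_initial hE (hE.to A)) r
    (j := 𝟙 A) (l := (isInitialCyl gens hE).to A)
    (IsPushout.of_vert_isIso ⟨hE.hom_ext _ _⟩) (Category.id_comp _)
    ((isInitialCyl gens hE).hom_ext _ _)

/-- The homotopy extension property: `B ∪_A Cyl A ⟶ Cyl B` is a trivial semifree extension, hence
it has a retraction. -/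
lemma exists_homotopyExtension {F : A ⟶ B} (hF : semifreeExtensions k F) (r : Fin 2) (G : B ⟶ C)
    (H : (Cyl gens).obj A ⟶ C) (w : F ≫ G = cylInc gens r A ≫ H) :
    ∃ E : (Cyl gens).obj B ⟶ C, cylInc gens r B ≫ E = G ∧ (Cyl gens).map F ≫ E = H := by
  obtain ⟨D, j, l, h, -⟩ := exists_isPushout F (cylInc gens r A) hF
  let Φ := h.desc _ _ (cylInc_naturality gens r F)
  have hj : j ≫ Φ = cylInc gens r B := h.inl_desc _ _ _
  have hl : l ≫ Φ = (Cyl gens).map F := h.inr_desc _ _ _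
  have h1 : quasiEquivalences k j := quasiEquivalences_of_pushout h.flip
    (cylInc_semifreeExtension gens r A) (cylInc_quasiEquivalence gens r A)
  have h2 : quasiEquivalences k Φ := by
    refine (quasiEquivalences k).of_precomp _ _ h1 ?_
    rw [hj]
    exact cylInc_quasiEquivalence gens r B
  obtain ⟨ρ, hρ⟩ := isFibrantObject D Φ (semifreeExtensions_mappingCyl gens hF r h hj hl) h2
  refine ⟨ρ ≫ h.desc G H w, ?_, ?_⟩
  · rw [← hj, Category.assoc, ← Category.assoc Φ, hρ, Category.id_comp, h.inl_desc]
  · rw [← hl, Category.assoc, ← Category.assoc Φ, hρ, Category.id_comp, h.inr_desc]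

end Cylinder

/-! ### Mapping cylinders and left properness -/

section Proper

variable {A B C D : SemifreeDGAlg k}

/-- A choice of generators of every semifree dg algebra. -/
def someGens (A : SemifreeDGAlg k) : Generators A.obj := A.property.some

/-- The mapping cylinder factorization: the second map has a section. -/
lemma exists_factorization (F : A ⟶ B) :
    ∃ (Z : SemifreeDGAlg k) (j : A ⟶ Z) (q : Z ⟶ B) (s : B ⟶ Z), semifreeExtensions k j ∧
      quasiEquivalences k q ∧ j ≫ q = F ∧ s ≫ q = 𝟙 B := by
  let gens : ∀ A : SemifreeDGAlg k, Generators A.obj := someGens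
  let hE : IsInitial (⊥_ SemifreeDGAlg k) := initialIsInitial
  obtain ⟨AA, a₁, a₂, ⟨hAA⟩⟩ := exists_coproduct A A
  have pAA : IsPushout (hE.to A) (hE.to A) a₁ a₂ := IsPushout.of_is_coproduct' hAA hE
  have ha₂ : semifreeExtensions k a₂ :=
    (isAlgPushout_and_cof_of_isPushout pAA (semifreeExtensions_initial hE _)).2
  -- `AB` is the coproduct of `A` and `B`, as a pushout of `A ⊔ A`
  obtain ⟨AB, t, m, pAB, -⟩ := exists_isPushout a₂ F ha₂
  have ht : semifreeExtensions k (a₁ ≫ t) := by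
    have := pAA.paste_vert pAB
    exact (isAlgPushout_and_cof_of_isPushout this.flip (semifreeExtensions_initial hE _)).2
  let iA : AA ⟶ (Cyl gens).obj A := pAA.desc (cylInc gens 0 A) (cylInc gens 1 A)
    (hE.hom_ext _ _)
  have hi₁ : a₁ ≫ iA = cylInc gens 0 A := pAA.inl_desc _ _ _
  have hi₂ : a₂ ≫ iA = cylInc gens 1 A := pAA.inr_desc _ _ _
  have hiA : semifreeExtensions k iA := semifreeExtensions_coprod_cyl gens ![a₁, a₂] hAA
    (Fin.forall_fin_two.2 ⟨hi₁, hi₂⟩)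
  obtain ⟨Z, u, v, pZ, hv⟩ := exists_isPushout iA t hiA
  have pB : IsPushout (cylInc gens 1 A) F u (m ≫ v) := by
    rw [← hi₂]
    exact pAB.paste_horiz pZ
  have hB : quasiEquivalences k (m ≫ v) := quasiEquivalences_of_pushout pB
    (cylInc_semifreeExtension gens 1 A) (cylInc_quasiEquivalence gens 1 A)
  let q : Z ⟶ B := pB.desc (cylProj gens A ≫ F) (𝟙 B)
    (by rw [← Category.assoc, cylInc_cylProj, Category.id_comp, Category.comp_id])
  have hq₁ : u ≫ q = cylProj gens A ≫ F := pB.inl_desc _ _ _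
  have hq₂ : (m ≫ v) ≫ q = 𝟙 B := pB.inr_desc _ _ _
  refine ⟨Z, (a₁ ≫ t) ≫ v, q, m ≫ v, semifreeExtensions_comp _ _ ht hv, ?_, ?_, hq₂⟩
  · refine (quasiEquivalences k).of_precomp _ _ hB ?_
    rw [hq₂]
    exact quasiEquivalences_of_isIso _ inferInstance
  · rw [Category.assoc a₁, ← pZ.w, Category.assoc, Category.assoc, hq₁, ← Category.assoc, hi₁,
      ← Category.assoc, cylInc_cylProj, Category.id_comp]

/-- A quasi-equivalence `q` with a section `s` is a homotopy equivalence over its target; by the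
homotopy extension property, so is its pushout along a semifree extension. -/
lemma quasiEquivalences_pushout_of_section {F : A ⟶ B} {q : A ⟶ C} {q' : B ⟶ D} {F' : C ⟶ D}
    (h : IsPushout F q q' F') (hF : semifreeExtensions k F) (hq : quasiEquivalences k q)
    {s : C ⟶ A} (hs : s ≫ q = 𝟙 C) : quasiEquivalences k q' := by
  let gens : ∀ A : SemifreeDGAlg k, Generators A.obj := someGens
  obtain ⟨AA, a₁, a₂, ⟨hAA⟩⟩ := exists_coproduct A A
  have pAA := IsPushout.of_is_coproduct' hAA (initialIsInitial (C := SemifreeDGAlg k))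
  let iA : AA ⟶ (Cyl gens).obj A := pAA.desc (cylInc gens 0 A) (cylInc gens 1 A)
    (initialIsInitial.hom_ext _ _)
  have hi₁ : a₁ ≫ iA = cylInc gens 0 A := pAA.inl_desc _ _ _
  have hi₂ : a₂ ≫ iA = cylInc gens 1 A := pAA.inr_desc _ _ _
  have hiA : semifreeExtensions k iA := semifreeExtensions_coprod_cyl gens ![a₁, a₂] hAA
    (Fin.forall_fin_two.2 ⟨hi₁, hi₂⟩)
  -- a homotopy `H` from `𝟙 A` to `q ≫ s` over `C`, by lifting against `q`
  let v : AA ⟶ A := pAA.desc (𝟙 A) (q ≫ s) (initialIsInitial.hom_ext _ _)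
  have hv₁ : a₁ ≫ v = 𝟙 A := pAA.inl_desc _ _ _
  have hv₂ : a₂ ≫ v = q ≫ s := pAA.inr_desc _ _ _
  obtain ⟨H, hH₁, hH₂⟩ : ∃ H : (Cyl gens).obj A ⟶ A, iA ≫ H = v ∧
      H ≫ q = cylProj gens A ≫ q := by
    obtain ⟨S⟩ := semifreeExtensions_iff.1 hiA
    have hsurj : Function.Surjective (DGAlg.toAlgHom q.hom) := fun c =>
      ⟨DGAlg.toAlgHom s.hom c,
        DFunLike.congr_fun (congrArg DGAlg.toAlgHom (congrArg InducedCategory.Hom.hom hs)) c⟩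
    have e : iA ≫ cylProj gens A ≫ q = v ≫ q := by
      apply pAA.hom_ext
      · rw [← Category.assoc, hi₁, ← Category.assoc, cylInc_cylProj, ← Category.assoc, hv₁]
      · rw [← Category.assoc, hi₂, ← Category.assoc, cylInc_cylProj, ← Category.assoc, hv₂,
          Category.assoc, hs, Category.id_comp, Category.comp_id]
    obtain ⟨H, h1, h2⟩ := S.exists_lift hq hsurj v.hom (cylProj gens A ≫ q).hom
      (congrArg InducedCategory.Hom.hom e)
    exact ⟨ObjectProperty.homMk H, ObjectProperty.hom_ext _ h1, ObjectProperty.hom_ext _ h2⟩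
  have hH₀ : cylInc gens 0 A ≫ H = 𝟙 A := by rw [← hi₁, Category.assoc, hH₁, hv₁]
  have hH₀' : cylInc gens 1 A ≫ H = q ≫ s := by rw [← hi₂, Category.assoc, hH₁, hv₂]
  -- extend the homotopy to `B`
  obtain ⟨K, hK₁, hK₂⟩ := exists_homotopyExtension gens hF 0 (𝟙 B) (H ≫ F)
    (by rw [← Category.assoc, hH₀, Category.comp_id, Category.id_comp])
  let e := cylInc gens 1 B ≫ K
  have he : F ≫ e = q ≫ s ≫ F := by
    rw [← Category.assoc, cylInc_naturality, Category.assoc, hK₂, ← Category.assoc, hH₀',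
      Category.assoc]
  let g : D ⟶ B := h.desc e (s ≫ F) he
  have hg₁ : q' ≫ g = e := h.inl_desc _ _ _
  have hg₂ : F' ≫ g = s ≫ F := h.inr_desc _ _ _
  -- the induced homotopy on `D`
  have pC := isPushout_cyl gens h hF
  let K' : (Cyl gens).obj D ⟶ D := pC.desc (K ≫ q') (cylProj gens C ≫ F') (by
    rw [← Category.assoc, hK₂, Category.assoc, h.w, ← Category.assoc, hH₂, ← Category.assoc]
    congr 1
    exact ((cylP gens).naturality q).symm)
  have hK'₁ : (Cyl gens).map q' ≫ K' = K ≫ q' := pC.inl_desc _ _ _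
  have hK'₂ : (Cyl gens).map F' ≫ K' = cylProj gens C ≫ F' := pC.inr_desc _ _ _
  have hF'i : ∀ r, F' ≫ cylInc gens r D ≫ K' = F' := fun r => by
    rw [← Category.assoc, cylInc_naturality, Category.assoc, hK'₂, ← Category.assoc, cylInc_cylProj,
      Category.id_comp]
  have hq'i : ∀ r, q' ≫ cylInc gens r D ≫ K' = (cylInc gens r B ≫ K) ≫ q' := fun r => by
    rw [← Category.assoc, cylInc_naturality, Category.assoc, hK'₁, Category.assoc]
  have e0 : cylInc gens 0 D ≫ K' = 𝟙 D := by
    apply h.hom_ext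
    · rw [hq'i, hK₁, Category.id_comp, Category.comp_id]
    · rw [hF'i, Category.comp_id]
  have e1 : cylInc gens 1 D ≫ K' = g ≫ q' := by
    apply h.hom_ext
    · rw [hq'i, ← Category.assoc q', hg₁]
    · rw [hF'i, ← Category.assoc, hg₂, Category.assoc, h.w, ← Category.assoc, hs, Category.id_comp]
  have c1 := cohomologyMap_cylInc gens K
  have c2 := cohomologyMap_cylInc gens K'
  rw [hK₁, show cylInc gens 1 B ≫ K = q' ≫ g from hg₁.symm] at c1
  rw [e0, e1] at c2
  exact DGAlg.IsQuasiEquivalence.of_inverse (g := g.hom) c1.symm c2.symm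

/-- Left properness: quasi-equivalences are stable under pushout along semifree extensions. -/
lemma quasiEquivalences_pushout_along {F : A ⟶ B} {G : A ⟶ C} {G' : B ⟶ D} {F' : C ⟶ D}
    (h : IsPushout F G G' F') (hF : semifreeExtensions k F) (hG : quasiEquivalences k G) :
    quasiEquivalences k G' := by
  obtain ⟨Z, j, q, s, hj, hq, rfl, hs⟩ := exists_factorization G
  have hj' : quasiEquivalences k j := (quasiEquivalences k).of_postcomp _ _ hq hG
  obtain ⟨B₁, j', F₁, h₁, hF₁⟩ := exists_isPushout F j hF
  have w : F ≫ G' = j ≫ q ≫ F' := by rw [h.w, Category.assoc]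
  have e : j' ≫ h₁.desc G' (q ≫ F') w = G' := h₁.inl_desc _ _ _
  have h₂ : IsPushout F₁ q (h₁.desc G' (q ≫ F') w) F' :=
    IsPushout.of_top (by rw [e]; exact h) (h₁.inr_desc _ _ _) h₁
  rw [← e]
  exact (quasiEquivalences k).comp_mem _ _ (quasiEquivalences_of_pushout h₁.flip hj hj')
    (quasiEquivalences_pushout_of_section h₂ hF₁ hq hs)

end Proper

/-! ### The axioms -/

lemma isICategory (gens : ∀ A : SemifreeDGAlg k, Generators A.obj) :
    IsICategory (semifreeExtensions k) (Cyl gens) ![cylI₁ gens, cylI₂ gens] (cylP gens) where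
  hasInitial := inferInstance
  cylinder := cylInc_cylProj gens
  exists_pushout := exists_isPushout
  cof_of_isPushout h hF := (isAlgPushout_and_cof_of_isPushout h hF).2
  initial_map := fun ⟨hE⟩ => ⟨isInitialCyl gens hE⟩
  isPushout_map := isPushout_cyl gens
  cof_of_isIso := semifreeExtensions_of_isIso
  cof_initial hE _ := semifreeExtensions_initial hE _
  cof_comp := semifreeExtensions_comp
  hep _ hF := exists_homotopyExtension gens hF
  relative_cylinder := by
    intro A B F hF AA BB D a₁ a₂ b₁ b₂ ⟨hAA⟩ ⟨hBB⟩ FF iA iB f₁ f₂ hi₁ hi₂ hb₁ hb₂ j l hD G hj hl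
    change a₁ ≫ iA = cylInc gens 0 A at hi₁
    change a₂ ≫ iA = cylInc gens 1 A at hi₂
    have hiA : semifreeExtensions k iA := semifreeExtensions_coprod_cyl gens ![a₁, a₂] hAA
      (Fin.forall_fin_two.2 ⟨hi₁, hi₂⟩)
    refine semifreeExtensions_relCyl gens hF ![b₁ ≫ j, b₂ ≫ j] (l := l)
      (Fin.forall_fin_two.2 ⟨?_, ?_⟩) (Fin.forall_fin_two.2 ⟨?_, ?_⟩) hl ?_
    · change F ≫ b₁ ≫ j = _
      rw [← Category.assoc, ← f₁, Category.assoc, hD.w, ← Category.assoc, hi₁]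
    · change F ≫ b₂ ≫ j = _
      rw [← Category.assoc, ← f₂, Category.assoc, hD.w, ← Category.assoc, hi₂]
    · change (b₁ ≫ j) ≫ G = _
      exact (Category.assoc _ _ _).trans ((congrArg (b₁ ≫ ·) hj).trans hb₁)
    · change (b₂ ≫ j) ≫ G = _
      exact (Category.assoc _ _ _).trans ((congrArg (b₂ ≫ ·) hj).trans hb₂)
    · intro Z _ _ φ ψ h1 h2
      refine (isAlgPushout_and_cof_of_isPushout hD.flip hiA).1.algHom_ext h2 ?_
      exact (isAlgPushout_of_coproduct initialIsInitial hBB).algHom_ext (h1 0) (h1 1)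
  interchange A := by
    obtain ⟨γ, ⟨h1, h2⟩, h3, h4⟩ := (gens A).exists_interchange (gens ((Cyl gens).obj A))
    refine ⟨ObjectProperty.homMk γ, Fin.forall_fin_two.2 ⟨⟨?_, ?_⟩, ?_, ?_⟩⟩
    · exact ObjectProperty.hom_ext _ h1
    · exact ObjectProperty.hom_ext _ h2
    · exact ObjectProperty.hom_ext _ h3
    · exact ObjectProperty.hom_ext _ h4

variable (k) in
lemma isCofibrationCategory :
    IsCofibrationCategory (semifreeExtensions k) (quasiEquivalences k) where
  cof_of_isIso := semifreeExtensions_of_isIso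
  we_of_isIso := quasiEquivalences_of_isIso
  two_out_of_three := inferInstance
  cof_comp := semifreeExtensions_comp
  exists_pushout := exists_isPushout
  cof_of_isPushout h hF := (isAlgPushout_and_cof_of_isPushout h hF).2
  we_of_isPushout := quasiEquivalences_pushout_along
  we_of_isPushout_of_cof := quasiEquivalences_of_pushout
  factorization F := by
    obtain ⟨Z, j, q, s, hj, hq, h, -⟩ := exists_factorization F
    exact ⟨Z, j, q, hj, hq, h⟩
  fibrant_model X := ⟨X, 𝟙 X, semifreeExtensions_of_isIso _ inferInstance,
    quasiEquivalences_of_isIso _ inferInstance, isFibrantObject X⟩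

variable (k) in
lemma isCategoryOfCofibrantObjects :
    IsCategoryOfCofibrantObjects (semifreeExtensions k) (quasiEquivalences k) where
  hasFiniteCoproducts := inferInstance
  we_of_isIso := quasiEquivalences_of_isIso
  two_out_of_three := inferInstance
  cof_of_isIso := semifreeExtensions_of_isIso
  cof_comp := semifreeExtensions_comp
  exists_pushout F G hF := by
    obtain ⟨D, G', F', h, -⟩ := exists_isPushout F G hF
    exact ⟨D, G', F', h⟩
  cof_of_isPushout h hF := (isAlgPushout_and_cof_of_isPushout h hF).2
  we_of_isPushout := quasiEquivalences_of_pushout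
  cylinder := by
    intro X XX a₁ a₂ ⟨hXX⟩
    let gens : ∀ A : SemifreeDGAlg k, Generators A.obj := someGens
    have p := IsPushout.of_is_coproduct' hXX (initialIsInitial (C := SemifreeDGAlg k))
    let i : XX ⟶ (Cyl gens).obj X := p.desc (cylInc gens 0 X) (cylInc gens 1 X)
      (initialIsInitial.hom_ext _ _)
    have h₁ : a₁ ≫ i = cylInc gens 0 X := p.inl_desc _ _ _
    have h₂ : a₂ ≫ i = cylInc gens 1 X := p.inr_desc _ _ _
    refine ⟨(Cyl gens).obj X, i, cylProj gens X, semifreeExtensions_coprod_cyl gens ![a₁, a₂] hXX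
      (Fin.forall_fin_two.2 ⟨h₁, h₂⟩), cylProj_quasiEquivalence gens X, ?_, ?_⟩
    · rw [← Category.assoc, h₁, cylInc_cylProj]
    · rw [← Category.assoc, h₂, cylInc_cylProj]
  cofibrant := isCofibrantObject

end

end SemifreeDGA

theorem mainTheorem10 {k : Type u} [CommRing k]
    (gens : ∀ A : SemifreeDGA.SemifreeDGAlg k, SemifreeDGA.Generators A.obj) :
    SemifreeDGA.IsICategory (SemifreeDGA.semifreeExtensions k) (SemifreeDGA.Cyl gens)
      ![SemifreeDGA.cylI₁ gens, SemifreeDGA.cylI₂ gens] (SemifreeDGA.cylP gens) ∧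
    SemifreeDGA.IsCofibrationCategory (SemifreeDGA.semifreeExtensions k)
      (SemifreeDGA.quasiEquivalences k) ∧
    (∀ A : SemifreeDGA.SemifreeDGAlg k,
      SemifreeDGA.IsFibrantObject (SemifreeDGA.semifreeExtensions k)
        (SemifreeDGA.quasiEquivalences k) A ∧
      SemifreeDGA.IsCofibrantObject (SemifreeDGA.semifreeExtensions k) A) ∧
    SemifreeDGA.IsCategoryOfCofibrantObjects (SemifreeDGA.semifreeExtensions k)
      (SemifreeDGA.quasiEquivalences k) :=
  ⟨SemifreeDGA.isICategory gens, SemifreeDGA.isCofibrationCategory k,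
    fun A => ⟨SemifreeDGA.isFibrantObject A, SemifreeDGA.isCofibrantObject A⟩,
    SemifreeDGA.isCategoryOfCofibrantObjects k⟩
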